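/- **Theorem 3.10.** Let $\alpha$ and $\beta$ be rational numbers with $1\le\alpha\le\beta$. To every pair $(K,L)$ of (tame) knots in the unit sphere $S^3\subset\mathbb R^4$ one can associate a semialgebraic surface germ $X^{\alpha\beta}_{KL}$ at the origin of $\mathbb R^4$ such that: 1. For all knots $K$ and $L$, the link at the origin of $X^{\alpha\beta}_{KL}$ is isotopic to $L$: for all sufficiently small $\varepsilon>0$, the set $\varepsilon^{-1}\bigl(X^{\alpha\beta}_{KL}\cap\{\|p\|=\varepsilon\}\bigr)$ is ambient isotopic to $L$ in $S^3$. 2. For all knots $K$ and $L$, the tangent link of $X^{\alpha\beta}_{KL}$, that is, the link at the origin of the tangent cone $\{\lim_n c_np_n : p_n\in X^{\alpha\beta}_{KL},\ p_n\to 0,\ c_n>0\}$, is isotopic to $K$. 3. For all knots $K,L,K',L'$, the germs $X^{\alpha\beta}_{KL}$ and $X^{\alpha\beta}_{K'L'}$ are semialgebraically outer bi-Lipschitz equivalent: there are neighbourhoods $U,V$ of $0$ in $\mathbb R^4$ and a semialgebraic bijection $X^{\alpha\beta}_{KL}\cap U\to X^{\alpha\beta}_{K'L'}\cap V$ that fixes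 $0$ and is bi-Lipschitz for the distance $\|p-q\|$. Moreover, if $\alpha>1$, each $X^{\alpha\beta}_{KL}$ contains an $(\alpha,\beta)$-wedge. Here, for $0<\delta\le 1$, let $Z^\alpha_\delta=\{(x,y,z): 0\le z\le\delta,\ |x|\le z^\alpha,\ |y|\le z\}$, and let $E^{\alpha\beta}_\delta\subset Z^\alpha_\delta$ be the standard $(\alpha,\beta)$-wedge, the set whose section at each height $z=t\in[0,\delta]$ consists of the two segments that join $(\pm t^\alpha,t)$ to $(0,t^\beta)$ and the two segments that join $(\pm t^\alpha,-t)$ to $(0,-t^\beta)$. The assertion is that there are $\delta\in(0,1]$ and a semialgebraic map $\Theta:Z^\alpha_\delta\to\mathbb R^4$, bi-Lipschitz onto its image, with $\Theta(0)=0$ and $X^{\alpha\beta}_{KL}\cap\Theta(Z^\alpha_\delta)=\Theta(E^{\alpha\beta}_\delta)$. Here a knot in $S^3$ is a subset that is ambient isotopic to a simple closed polygon, where $\mathbb R^3$ is identified with an open hemisphere of $S^3$ by central projection; a semialgebraic surface germ is represented by a semialgebraic set that contains $0$ and has dimension $2$ in every neighbourhood of $0$. -/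

import Mathlib

open Set Filter Topology Metric

noncomputable section

namespace KnottedGerm

/-- The space `ℝ³`. -/
abbrev E3 : Type := EuclideanSpace ℝ (Fin 3)

/-- The space `ℝ⁴`. -/
abbrev E4 : Type := EuclideanSpace ℝ (Fin 4)

/-- The unit sphere `S³` in `ℝ⁴`. -/
abbrev S3 : Type := Metric.sphere (0 : E4) 1

/-! ### Semialgebraic sets and maps -/

/-- Real semialgebraic sets: the smallest Boolean algebra of subsets that contains all the sets
`{p > 0}`, where `p` is a real polynomial in the coordinates. -/
inductive IsSemialgebraic {ι : Type*} : Set (EuclideanSpace ℝ ι) → Prop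
  | pos (p : MvPolynomial ι ℝ) :
      IsSemialgebraic {x : EuclideanSpace ℝ ι | 0 < MvPolynomial.eval (fun i => x i) p}
  | compl (S : Set (EuclideanSpace ℝ ι)) : IsSemialgebraic S → IsSemialgebraic Sᶜ
  | union (S T : Set (EuclideanSpace ℝ ι)) :
      IsSemialgebraic S → IsSemialgebraic T → IsSemialgebraic (S ∪ T)

/-- The graph of `f` over `S`, as a subset of the product of the two Euclidean spaces. -/
def graphOver {ι κ : Type*} (f : EuclideanSpace ℝ ι → EuclideanSpace ℝ κ)
    (S : Set (EuclideanSpace ℝ ι)) : Set (EuclideanSpace ℝ (ι ⊕ κ)) :=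
  {z | WithLp.toLp 2 (fun i => z (Sum.inl i)) ∈ S ∧
    f (WithLp.toLp 2 (fun i => z (Sum.inl i))) = WithLp.toLp 2 (fun j => z (Sum.inr j))}

/-- The map `f` is semialgebraic on `S`: its graph over `S` is a semialgebraic set. -/
def IsSemialgebraicMapOn {ι κ : Type*} (f : EuclideanSpace ℝ ι → EuclideanSpace ℝ κ)
    (S : Set (EuclideanSpace ℝ ι)) : Prop :=
  IsSemialgebraic (graphOver f S)

/-- The map `f` is bi-Lipschitz on `S` with respect to the outer metrics, that is, the distances
of the ambient spaces. Such a map is a homeomorphism from `S` onto `f '' S`. -/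
def IsBiLipschitzOn {A B : Type*} [MetricSpace A] [MetricSpace B] (f : A → B) (S : Set A) : Prop :=
  ∃ C : ℝ, 0 < C ∧ ∀ x ∈ S, ∀ y ∈ S,
    C⁻¹ * dist x y ≤ dist (f x) (f y) ∧ dist (f x) (f y) ≤ C * dist x y

/-! ### Surface germs and their outer bi-Lipschitz equivalence -/

/-- The set `X` represents a semialgebraic surface germ at the origin of `ℝ⁴`. For semialgebraic
sets the Hausdorff dimension is the usual dimension. -/
def IsSurfaceGerm (X : Set E4) : Prop :=
  IsSemialgebraic X ∧ (0 : E4) ∈ X ∧ ∀ r : ℝ, 0 < r → dimH (X ∩ ball 0 r) = 2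

/-- The germs at the origin of `X` and `Y` are semialgebraically outer bi-Lipschitz equivalent. -/
def OuterBiLipschitzEquiv (X Y : Set E4) : Prop :=
  ∃ U ∈ 𝓝 (0 : E4), ∃ V ∈ 𝓝 (0 : E4), ∃ H : E4 → E4,
    BijOn H (X ∩ U) (Y ∩ V) ∧ H 0 = 0 ∧
    IsBiLipschitzOn H (X ∩ U) ∧ IsSemialgebraicMapOn H (X ∩ U)

/-! ### Knots in the three-sphere -/

/-- Ambient isotopy of subsets of `S³`. -/
def AmbientIsotopic (A B : Set S3) : Prop :=
  ∃ F : unitInterval × S3 → S3, Continuous F ∧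
    (∀ t, IsHomeomorph (fun x => F (t, x))) ∧
    (∀ x, F (0, x) = x) ∧ (fun x => F (1, x)) '' A = B

/-- The closed polygon with the cyclically ordered vertices `p 0, p 1, …` (the index `i + 1` is
taken modulo the number of vertices). -/
def closedPolygon {n : ℕ} (p : Fin (n + 3) → E3) : Set E3 :=
  ⋃ i, segment ℝ (p i) (p (i + 1))

/-- The closed polygon with vertices `p` is simple: no edge is degenerate, consecutive edges meet
only in their common vertex, and other pairs of edges are disjoint. -/
def IsSimplePolygon {n : ℕ} (p : Fin (n + 3) → E3) : Prop :=
  (∀ i, p i ≠ p (i + 1)) ∧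
  (∀ i, segment ℝ (p i) (p (i + 1)) ∩ segment ℝ (p (i + 1)) (p (i + 1 + 1)) = {p (i + 1)}) ∧
  (∀ i j, j ≠ i → j ≠ i + 1 → i ≠ j + 1 →
    Disjoint (segment ℝ (p i) (p (i + 1))) (segment ℝ (p j) (p (j + 1))))

/-- The copy in `S³` of a subset of `ℝ³`: here `ℝ³` is identified with the open upper hemisphere
by the central projection, which takes `u` to `(u₀, u₁, u₂) / u₃` and turns arcs of great circles
into straight segments. -/
def inSphere (P : Set E3) : Set S3 :=
  {u | 0 < u.1 3 ∧ !₂[u.1 0 / u.1 3, u.1 1 / u.1 3, u.1 2 / u.1 3] ∈ P}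

/-- A (tame) knot in `S³`: a subset that is ambient isotopic to a simple closed polygon. -/
def IsKnot (K : Set S3) : Prop :=
  ∃ (n : ℕ) (p : Fin (n + 3) → E3), IsSimplePolygon p ∧ AmbientIsotopic (inSphere (closedPolygon p)) K

/-- The type of all (tame, unoriented) knots in `S³`. -/
def Knot : Type := {K : Set S3 // IsKnot K}

/-! ### The link at the origin and the tangent link -/

/-- The section of `X` by the sphere of radius `ε` about the origin, scaled to the unit sphere. -/
def sphereSection (X : Set E4) (ε : ℝ) : Set S3 :=
  {u | ε • (u : E4) ∈ X}

/-- The link at the origin of `X` is isotopic to `K`. -/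
def LinkIsotopicTo (X : Set E4) (K : Knot) : Prop :=
  ∀ᶠ ε in 𝓝[>] (0 : ℝ), AmbientIsotopic (sphereSection X ε) K.1

/-- The tangent cone of `X` at the origin: all limits of `cₙ • xₙ` with `xₙ ∈ X`, `xₙ → 0` and
`cₙ > 0`. -/
def tangentCone (X : Set E4) : Set E4 :=
  {v | ∃ (x : ℕ → E4) (c : ℕ → ℝ), (∀ n, x n ∈ X) ∧ (∀ n, 0 < c n) ∧
    Tendsto x atTop (𝓝 0) ∧ Tendsto (fun n => c n • x n) atTop (𝓝 v)}

/-- The tangent link of `X`, that is, the link at the origin of the tangent cone of `X`, is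
isotopic to `K`. -/
def TangentLinkIsotopicTo (X : Set E4) (K : Knot) : Prop :=
  LinkIsotopicTo (tangentCone X) K

/-! ### Wedges -/

/-- The union of the rectangles `{|x| ≤ t ^ α, |y| ≤ t}` in the planes `{z = t}`, `0 ≤ t ≤ δ`. -/
def wedgeBox (α : ℚ) (δ : ℝ) : Set E3 :=
  {q | 0 ≤ q 2 ∧ q 2 ≤ δ ∧ |q 0| ≤ q 2 ^ (α : ℝ) ∧ |q 1| ≤ q 2}

/-- The standard `(α, β)`-wedge cut at height `δ`: in each plane `{z = t}`, `0 ≤ t ≤ δ`, it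
consists of the two segments from `(± t ^ α, t)` to `(0, t ^ β)` and of the two segments from
`(± t ^ α, - t)` to `(0, - t ^ β)`. -/
def wedge (α β : ℚ) (δ : ℝ) : Set E3 :=
  {q | 0 ≤ q 2 ∧ q 2 ≤ δ ∧ ∃ σ ∈ ({1, -1} : Set ℝ), ∃ τ ∈ ({1, -1} : Set ℝ),
    (q 0, q 1) ∈ segment ℝ (σ * q 2 ^ (α : ℝ), τ * q 2) ((0 : ℝ), τ * q 2 ^ (β : ℝ))}

/-- The germ `X` contains an `(α, β)`-wedge: some semialgebraic bi-Lipschitz embedding of the germ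
of the box around the standard wedge takes that wedge onto the part of `X` in its image. -/
def ContainsWedge (α β : ℚ) (X : Set E4) : Prop :=
  ∃ δ : ℝ, 0 < δ ∧ δ ≤ 1 ∧ ∃ Θ : E3 → E4, Θ 0 = 0 ∧
    IsBiLipschitzOn Θ (wedgeBox α δ) ∧ IsSemialgebraicMapOn Θ (wedgeBox α δ) ∧
    Θ '' wedge α β δ = X ∩ Θ '' wedgeBox α δ

end KnottedGerm

end

open Set Filter Topology Metric

noncomputable section

namespace KnottedGerm

/-! In the affine chart of the upper hemisphere the germ is a family of closed polygons in `E3`, one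
for each radius `t`, whose vertices depend polynomially on a root of `t`. For `K`, take a polygonal
arc in the half space of nonnegative third coordinate, from `(2, 0, 0)` to `(-1, 0, 0)`, which
becomes `K` when it is closed by the segment between its ends (`exists_bandArc`). Thicken the closed
arc to a flat band of half-width `ρ` in the direction `bandDir`. Keep the two sides of the band over
the arc; along the closing segment, cut the band open by two V-shaped pieces with tips `(-g, 0, 0)`
and `(g, 0, 0)`. Into one side, next to the right V, tie a copy of `L` of size `ρ` that hangs below
the plane of the wedge.

The cut band is a disc. Pulling its boundary back across it leaves only the small copy of `L`, so
every polygon of the family has the type of `L` (`exists_link`). As `ρ` and `g` tend to `0`, the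
polygons collapse onto the closed arc of `K`, which gives the tangent link (`tangentLink_germ`). Put
`ρ = t ^ (p / N)` and `g = t ^ (q / N)`. Going from the chart to radius `t` multiplies lengths by
about `t`, so the two V's form an `(α, β)`-wedge with `α = 1 + p / N` and `β = 1 + q / N`
(`containsWedge_germ`). If `α = 1`, no wedge is required and any exponents will do.

The outer equivalence holds because the metric of the polygons does not see the knots. Two points of
the band have a distance comparable to a combinatorial expression (`modelDist`) plus the difference
of their transverse coordinates; the rectangle with the V's is the same for all knots, so the gap
`g` never has to be estimated. The loops are rescalings of fixed arcs. The band lies above the plane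
and the loop below it, so a distance from the one to the other controls the distance of the loop
point to an end of the loop, and this end lies on the band. Hence corresponding points of two
polygons have distances comparable uniformly in `ρ` and `g` (`exists_piece_compare`). The passage to
germs (`outerBiLipschitzEquiv_coneOver`) needs only that the parametrizations, multiplied by `t`,
vary in `t` at a Lipschitz rate, which roots of `t` do (`mul_posRoot_pow_sub_le`). Arcs with
different numbers of edges are first subdivided, which leaves the polygons unchanged as sets.

All isotopies are compositions of affine maps of the chart and of moves that push two sides of a
triangle to the third (`ambientIsotopic_triangle_move`). Semialgebraicity is verified directly on
Boolean combinations of polynomial inequalities: the only quantifier is a parameter in a segment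
(`IsSemialgebraic.exists_Icc`), and the only irrational functions are roots
(`IsSemialgebraic.root`). -/

/-! ### Semialgebraic sets -/

/-- Polynomial functions on a Euclidean space. -/
@[fun_prop]
def IsPoly {ι : Type*} (f : EuclideanSpace ℝ ι → ℝ) : Prop :=
  ∃ p : MvPolynomial ι ℝ, ∀ z, f z = MvPolynomial.eval (fun i => z i) p

section IsPoly

variable {ι : Type*} {f g : EuclideanSpace ℝ ι → ℝ}

@[fun_prop]
theorem IsPoly.const (c : ℝ) : IsPoly (fun _ : EuclideanSpace ℝ ι => c) :=
  ⟨MvPolynomial.C c, by simp⟩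

@[fun_prop]
theorem IsPoly.coord (i : ι) : IsPoly (fun z : EuclideanSpace ℝ ι => z i) :=
  ⟨MvPolynomial.X i, by simp⟩

@[fun_prop]
theorem IsPoly.add (hf : IsPoly f) (hg : IsPoly g) : IsPoly (fun z => f z + g z) := by
  obtain ⟨p, hp⟩ := hf
  obtain ⟨q, hq⟩ := hg
  exact ⟨p + q, by simp [hp, hq]⟩

@[fun_prop]
theorem IsPoly.mul (hf : IsPoly f) (hg : IsPoly g) : IsPoly (fun z => f z * g z) := by
  obtain ⟨p, hp⟩ := hf
  obtain ⟨q, hq⟩ := hg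
  exact ⟨p * q, by simp [hp, hq]⟩

@[fun_prop]
theorem IsPoly.neg (hf : IsPoly f) : IsPoly (fun z => -f z) := by
  obtain ⟨p, hp⟩ := hf
  exact ⟨-p, by simp [hp]⟩

@[fun_prop]
theorem IsPoly.sub (hf : IsPoly f) (hg : IsPoly g) : IsPoly (fun z => f z - g z) := by
  obtain ⟨p, hp⟩ := hf
  obtain ⟨q, hq⟩ := hg
  exact ⟨p - q, by simp [hp, hq]⟩

@[fun_prop]
theorem IsPoly.pow (hf : IsPoly f) (n : ℕ) : IsPoly (fun z => f z ^ n) := by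
  obtain ⟨p, hp⟩ := hf
  exact ⟨p ^ n, by simp [hp]⟩

theorem IsPoly.sum {κ : Type*} (s : Finset κ) {F : κ → EuclideanSpace ℝ ι → ℝ}
    (hF : ∀ k, IsPoly (F k)) : IsPoly (fun z => ∑ k ∈ s, F k z) := by
  choose p hp using hF
  exact ⟨∑ k ∈ s, p k, by simp [hp]⟩

theorem IsPoly.isSemialgebraic_pos (hf : IsPoly f) : IsSemialgebraic {z | 0 < f z} := by
  obtain ⟨p, hp⟩ := hf
  simpa [hp] using IsSemialgebraic.pos p

end IsPoly

namespace IsSemialgebraic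

variable {ι κ : Type*} {S T : Set (EuclideanSpace ℝ ι)} {f g : EuclideanSpace ℝ ι → ℝ}

theorem inter (hS : IsSemialgebraic S) (hT : IsSemialgebraic T) : IsSemialgebraic (S ∩ T) := by
  have := ((hS.compl _).union _ _ (hT.compl _)).compl
  rwa [compl_union, compl_compl, compl_compl] at this

theorem and {p q : EuclideanSpace ℝ ι → Prop} (hS : IsSemialgebraic {z | p z})
    (hT : IsSemialgebraic {z | q z}) : IsSemialgebraic {z | p z ∧ q z} := hS.inter hT

theorem or {p q : EuclideanSpace ℝ ι → Prop} (hS : IsSemialgebraic {z | p z})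
    (hT : IsSemialgebraic {z | q z}) : IsSemialgebraic {z | p z ∨ q z} := hS.union _ _ hT

theorem not {p : EuclideanSpace ℝ ι → Prop} (hS : IsSemialgebraic {z | p z}) :
    IsSemialgebraic {z | ¬ p z} := hS.compl

theorem lt (hf : IsPoly f) (hg : IsPoly g) : IsSemialgebraic {z | f z < g z} := by
  simpa using (hg.sub hf).isSemialgebraic_pos

theorem le (hf : IsPoly f) (hg : IsPoly g) : IsSemialgebraic {z | f z ≤ g z} := by
  simpa using (lt hg hf).not

theorem eq (hf : IsPoly f) (hg : IsPoly g) : IsSemialgebraic {z | f z = g z} := by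
  simpa [le_antisymm_iff] using (le hf hg).and (le hg hf)

theorem univ : IsSemialgebraic (Set.univ : Set (EuclideanSpace ℝ ι)) := by
  simpa using lt (ι := ι) (IsPoly.const 0) (IsPoly.const 1)

theorem empty : IsSemialgebraic (∅ : Set (EuclideanSpace ℝ ι)) := by
  simpa using (univ (ι := ι)).compl

theorem iUnion [Finite κ] {A : κ → Set (EuclideanSpace ℝ ι)}
    (h : ∀ k, IsSemialgebraic (A k)) : IsSemialgebraic (⋃ k, A k) := by
  have key : ∀ s : Set κ, s.Finite → IsSemialgebraic (⋃ k ∈ s, A k) := by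
    intro s hs
    induction s, hs using Set.Finite.induction_on with
    | empty => simpa using empty
    | insert _ _ ih => rw [biUnion_insert]; exact (h _).union _ _ ih
  simpa using key Set.univ Set.finite_univ

theorem exists_finite [Finite κ] {p : κ → EuclideanSpace ℝ ι → Prop}
    (h : ∀ k, IsSemialgebraic {z | p k z}) : IsSemialgebraic {z | ∃ k, p k z} := by
  simpa [ofPred_exists] using iUnion h

theorem forall_finite [Finite κ] {p : κ → EuclideanSpace ℝ ι → Prop}
    (h : ∀ k, IsSemialgebraic {z | p k z}) : IsSemialgebraic {z | ∀ k, p k z} := by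
  simpa using (exists_finite fun k => (h k).not).not

theorem preimage {φ : EuclideanSpace ℝ κ → EuclideanSpace ℝ ι} (hφ : ∀ i, IsPoly (fun z => φ z i))
    (hS : IsSemialgebraic S) : IsSemialgebraic (φ ⁻¹' S) := by
  induction hS with
  | pos p =>
    choose q hq using hφ
    have : IsPoly (fun z => MvPolynomial.eval (fun i => φ z i) p) :=
      ⟨MvPolynomial.bind₁ q p, fun z => by
        simp only [hq]
        exact (MvPolynomial.eval₂Hom_bind₁ (RingHom.id ℝ) _ q p).symm⟩
    exact this.isSemialgebraic_pos
  | compl _ _ ih => exact ih.compl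
  | union _ _ _ _ ih₁ ih₂ => exact ih₁.union _ _ ih₂

/-- Elimination of a parameter in a segment. -/
theorem exists_Icc [Fintype κ] {F G : κ → EuclideanSpace ℝ ι → ℝ} (hF : ∀ k, IsPoly (F k))
    (hG : ∀ k, IsPoly (G k)) :
    IsSemialgebraic {z | ∃ t ∈ Icc (0 : ℝ) 1, ∀ k, F k z + t * G k z = 0} := by
  -- If some `G k z` is nonzero, the only candidate for `t` is the least squares solution `D z / N
  -- z`. If all vanish, `t` is irrelevant.
  set N : EuclideanSpace ℝ ι → ℝ := fun z => ∑ k, G k z ^ 2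
  set D : EuclideanSpace ℝ ι → ℝ := fun z => -∑ k, F k z * G k z
  have hN : IsPoly N := IsPoly.sum _ fun k => (hG k).pow 2
  have hD : IsPoly D := (IsPoly.sum _ fun k => (hF k).mul (hG k)).neg
  have hN0 : ∀ z, N z = 0 → ∀ k, G k z = 0 := fun z h k => by
    have := (Finset.sum_eq_zero_iff_of_nonneg (fun k _ => sq_nonneg (G k z))).1 h k
    simpa using this
  have key : {z | ∃ t ∈ Icc (0 : ℝ) 1, ∀ k, F k z + t * G k z = 0} =
      {z | (∀ k, N z * F k z + D z * G k z = 0) ∧ ((0 < N z ∧ 0 ≤ D z ∧ D z ≤ N z) ∨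
        (N z = 0 ∧ ∀ k, F k z = 0))} := by
    ext z
    have hNz : 0 ≤ N z := Finset.sum_nonneg fun k _ => sq_nonneg _
    constructor
    · rintro ⟨t, ⟨h0, h1⟩, ht⟩
      have hFk : ∀ k, F k z = -(t * G k z) := fun k => by linarith [ht k]
      have hDt : D z = t * N z := by
        simp only [D, N, hFk, Finset.mul_sum, ← Finset.sum_neg_distrib]
        exact Finset.sum_congr rfl fun k _ => by ring
      refine ⟨fun k => by rw [hDt, hFk]; ring, ?_⟩
      rcases hNz.lt_or_eq with h | h
      · exact Or.inl ⟨h, by rw [hDt]; positivity, by rw [hDt]; nlinarith⟩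
      · exact Or.inr ⟨h.symm, fun k => by simp [hFk, hN0 z h.symm k]⟩
    · rintro ⟨hk, ⟨h, h0, h1⟩ | ⟨h, h0⟩⟩
      · refine ⟨D z / N z, ⟨by positivity, (div_le_one h).2 h1⟩, fun k => ?_⟩
        have := hk k
        field_simp
        linarith
      · exact ⟨0, by simp, fun k => by simp [h0]⟩
  rw [key]
  refine IsSemialgebraic.and (forall_finite fun k => eq (by fun_prop) (by fun_prop)) ?_
  refine IsSemialgebraic.or ?_ ?_
  · exact (lt (by fun_prop) hN).and ((le (by fun_prop) hD).and (le hD hN))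
  · exact (eq hN (by fun_prop)).and (forall_finite fun k => eq (hF k) (by fun_prop))

end IsSemialgebraic

/-! ### Substitution of roots in semialgebraic sets -/

/-- The point with coordinates `z` and the additional coordinate `s`. -/
def optExt {ι : Type*} (z : EuclideanSpace ℝ ι) (s : ℝ) : EuclideanSpace ℝ (Option ι) :=
  WithLp.toLp 2 (fun o => o.elim s z)

@[simp] theorem optExt_none {ι : Type*} (z : EuclideanSpace ℝ ι) (s : ℝ) :
    optExt z s none = s := rfl

@[simp] theorem optExt_some {ι : Type*} (z : EuclideanSpace ℝ ι) (s : ℝ) (i : ι) :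
    optExt z s (some i) = z i := rfl

/-- The nonnegative `N`-th root of the positive part of a real number. -/
def posRoot (N : ℕ) (x : ℝ) : ℝ := (max x 0) ^ ((N : ℝ)⁻¹)

theorem posRoot_nonneg (N : ℕ) (x : ℝ) : 0 ≤ posRoot N x :=
  Real.rpow_nonneg (le_max_right _ _) _

theorem posRoot_pow {N : ℕ} (hN : N ≠ 0) {x : ℝ} (hx : 0 ≤ x) : posRoot N x ^ N = x := by
  rw [posRoot, max_eq_left hx, Real.rpow_inv_natCast_pow hx hN]

theorem posRoot_of_nonpos {N : ℕ} (hN : N ≠ 0) {x : ℝ} (hx : x ≤ 0) : posRoot N x = 0 := by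
  rw [posRoot, max_eq_right hx, Real.zero_rpow (by simpa using hN)]

theorem posRoot_mul (M N : ℕ) (x : ℝ) : posRoot (M * N) x = posRoot N (posRoot M x) := by
  rw [posRoot, posRoot, max_eq_left (posRoot_nonneg _ _), posRoot,
    ← Real.rpow_mul (le_max_right _ _)]
  congr 1
  push_cast
  rw [mul_inv]

open Polynomial in
/-- Positivity of a polynomial just to the right of the origin is a semialgebraic condition on the
coefficients. -/
theorem isSemialgebraic_eventually_pos {ι : Type*} (r : (MvPolynomial ι ℝ)[X]) :
    IsSemialgebraic {z : EuclideanSpace ℝ ι |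
      ∀ᶠ c in 𝓝[>] (0 : ℝ), 0 < (r.map (MvPolynomial.eval (fun i => z i))).eval c} := by
  induction hn : r.natDegree using Nat.strong_induction_on generalizing r with
  | _ n ih =>
  by_cases h0 : r.natDegree = 0
  · rw [Polynomial.eq_C_of_natDegree_eq_zero h0]
    simpa using IsSemialgebraic.pos (r.coeff 0)
  · have ih' := ih r.divX.natDegree (by rw [natDegree_divX_eq_natDegree_tsub_one]; omega) r.divX rfl
    -- The sign to the right of `0` is that of the first nonvanishing coefficient: either the
    -- constant term decides, or it vanishes and a factor `c > 0` can be divided out.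
    have key : ∀ z : EuclideanSpace ℝ ι,
        (∀ᶠ c in 𝓝[>] (0 : ℝ), 0 < (r.map (MvPolynomial.eval (fun i => z i))).eval c) ↔
        (0 < MvPolynomial.eval (fun i => z i) (r.coeff 0) ∨
          (MvPolynomial.eval (fun i => z i) (r.coeff 0) = 0 ∧ ∀ᶠ c in 𝓝[>] (0 : ℝ),
            0 < (r.divX.map (MvPolynomial.eval (fun i => z i))).eval c)) := by
      intro z
      set φ := MvPolynomial.eval (fun i => z i)
      have hr : ∀ c : ℝ, (r.map φ).eval c = (r.divX.map φ).eval c * c + φ (r.coeff 0) := by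
        intro c
        conv_lhs => rw [← divX_mul_X_add r]
        simp
      have hlim : Tendsto (fun c => (r.map φ).eval c) (𝓝[>] 0) (𝓝 (φ (r.coeff 0))) := by
        have : Continuous fun c => (r.map φ).eval c := (r.map φ).continuous
        simpa [hr 0] using (this.tendsto 0).mono_left (nhdsWithin_le_nhds (s := Ioi 0))
      rcases lt_trichotomy (φ (r.coeff 0)) 0 with h | h | h
      · have h1 := hlim.eventually_lt_const h
        constructor
        · intro h2
          obtain ⟨c, hc1, hc2⟩ := (h1.and h2).exists
          exact absurd hc1 (not_lt.2 hc2.le)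
        · rintro (h2 | ⟨h2, -⟩) <;> linarith
      · simp only [h, lt_irrefl, false_or, true_and, hr, add_zero]
        refine eventually_congr ?_
        filter_upwards [self_mem_nhdsWithin] with c hc
        exact mul_pos_iff_of_pos_right hc
      · simp only [h, true_or, iff_true]
        exact hlim.eventually_const_lt h
    simp only [key]
    exact (IsSemialgebraic.pos _).or
      ((IsSemialgebraic.eq ⟨r.coeff 0, fun _ => rfl⟩ (by fun_prop)).and ih')

theorem prod_conj_pairs (M : ℕ) {F : ℕ → ℂ}
    (h : ∀ i, i ≤ 2 * M + 1 → F (2 * M + 1 - i) = starRingEnd ℂ (F i)) :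
    ∏ i ∈ Finset.range (2 * M), F (i + 1) =
      ((∏ i ∈ Finset.range M, Complex.normSq (F (i + 1)) : ℝ) : ℂ) := by
  rw [two_mul, Finset.prod_range_add, ← Finset.prod_range_reflect (fun i => F (M + i + 1)) M,
    ← Finset.prod_mul_distrib, Complex.ofReal_prod]
  refine Finset.prod_congr rfl fun i hi => ?_
  have hi := Finset.mem_range.1 hi
  rw [← Complex.mul_conj, ← h _ (by omega)]
  congr 2
  omega

-- The resultant is the product of the values of `h` at the roots `ζ ^ i * s`. For odd degree only
-- `i = 0` gives a real root when `s ≠ 0`; the other factors pair into squared moduli, so the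
-- resultant has the sign of `h.eval s` whenever those moduli do not vanish.
open Polynomial in
theorem resultant_X_pow_sub_C (h : ℝ[X]) (M : ℕ) {s : ℝ} {d : ℕ} (hd : h.natDegree ≤ d)
    {ζ : ℂ} (hζ : IsPrimitiveRoot ζ (2 * M + 1)) :
    resultant (X ^ (2 * M + 1) - C (s ^ (2 * M + 1))) h (2 * M + 1) d =
      (∏ i ∈ Finset.range M, Complex.normSq (aeval (ζ ^ (i + 1) * s) h)) * h.eval s := by
  apply Complex.ofReal_injective
  change Complex.ofRealHom _ = _
  rw [← resultant_map_map]
  have hN : 0 < 2 * M + 1 := by omega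
  have hf : (X ^ (2 * M + 1) - C (s ^ (2 * M + 1)) : ℝ[X]).map Complex.ofRealHom =
      X ^ (2 * M + 1) - C ((s : ℂ) ^ (2 * M + 1)) := by simp
  have hprod := X_pow_sub_C_eq_prod hζ hN (rfl : (s : ℂ) ^ (2 * M + 1) = _)
  have hroots : (X ^ (2 * M + 1) - C ((s : ℂ) ^ (2 * M + 1))).roots =
      (Multiset.range (2 * M + 1)).map (fun i => ζ ^ i * s) := by
    rw [hprod, ← roots_multiset_prod_X_sub_C ((Multiset.range (2 * M + 1)).map _),
      Multiset.map_map]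
    rfl
  have hdeg : (X ^ (2 * M + 1) - C ((s : ℂ) ^ (2 * M + 1))).natDegree = 2 * M + 1 :=
    natDegree_X_pow_sub_C
  have := resultant_eq_prod_eval (X ^ (2 * M + 1) - C ((s : ℂ) ^ (2 * M + 1)))
    (h.map Complex.ofRealHom) d (natDegree_map_le.trans hd) (IsAlgClosed.splits _)
  rw [hdeg, (monic_X_pow_sub_C _ hN.ne').leadingCoeff, one_pow, one_mul, hroots,
    Multiset.map_map] at this
  rw [hf, this]
  change ∏ i ∈ Finset.range (2 * M + 1), eval (ζ ^ i * s) (h.map Complex.ofRealHom) = _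
  have hF : ∀ w : ℂ, eval w (h.map Complex.ofRealHom) = aeval w h := fun w => by
    rw [eval_map, aeval_def]; rfl
  rw [Finset.prod_range_succ', Complex.ofReal_mul]
  congr 1
  · simp only [hF]
    refine prod_conj_pairs M (F := fun i => aeval (ζ ^ i * (s : ℂ)) h) fun i hi => ?_
    have hζn : ‖ζ‖ = 1 := hζ.norm'_eq_one hN.ne'
    have h1 : ζ ^ (2 * M + 1 - i) = starRingEnd ℂ (ζ ^ i) := by
      have h2 : ζ ^ (2 * M + 1 - i) * ζ ^ i = 1 := by
        rw [← pow_add, Nat.sub_add_cancel hi, hζ.pow_eq_one]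
      have h3 : starRingEnd ℂ (ζ ^ i) * ζ ^ i = 1 := by
        rw [mul_comm, Complex.mul_conj, Complex.normSq_eq_norm_sq, norm_pow, hζn]; simp
      exact mul_right_cancel₀ (pow_ne_zero _ (hζ.ne_zero hN.ne')) (h2.trans h3.symm)
    change aeval (ζ ^ (2 * M + 1 - i) * (s : ℂ)) h = starRingEnd ℂ (aeval (ζ ^ i * (s : ℂ)) h)
    rw [h1, ← aeval_conj]
    simp
  · rw [hF, pow_zero, one_mul]
    exact (aeval_algebraMap_apply ℂ s h)

open Polynomial in
/-- The sign of a polynomial at the real root of odd degree `2 * M + 1` of `g`. -/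
theorem isSemialgebraic_pos_odd_root {ι : Type*} (P : (MvPolynomial ι ℝ)[X])
    (g : MvPolynomial ι ℝ) (M : ℕ) :
    IsSemialgebraic {z : EuclideanSpace ℝ ι | 0 ≤ MvPolynomial.eval (fun i => z i) g ∧
      0 < (P.map (MvPolynomial.eval (fun i => z i))).eval
        (posRoot (2 * M + 1) (MvPolynomial.eval (fun i => z i) g))} := by
  obtain ⟨ζ, hζ⟩ : ∃ ζ : ℂ, IsPrimitiveRoot ζ (2 * M + 1) :=
    ⟨_, Complex.isPrimitiveRoot_exp _ (by omega)⟩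
  -- The variable of `r` is a constant `c` added to `P`. A small `c ≠ 0` keeps the squared moduli
  -- positive even where `P` itself vanishes at a complex root.
  set r : (MvPolynomial ι ℝ)[X] :=
    resultant (X ^ (2 * M + 1) - C (C g)) (P.map C + C X) (2 * M + 1) P.natDegree
  have hr : ∀ (z : EuclideanSpace ℝ ι) (c : ℝ), 0 ≤ MvPolynomial.eval (fun i => z i) g →
      (r.map (MvPolynomial.eval (fun i => z i))).eval c =
      (∏ i ∈ Finset.range M, Complex.normSq (aeval (ζ ^ (i + 1) * (posRoot (2 * M + 1)
        (MvPolynomial.eval (fun i => z i) g) : ℂ)) (P.map (MvPolynomial.eval (fun i => z i))) + c)) *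
      ((P.map (MvPolynomial.eval (fun i => z i))).eval
        (posRoot (2 * M + 1) (MvPolynomial.eval (fun i => z i) g)) + c) := by
    intro z c hz
    set e := MvPolynomial.eval (fun i => z i)
    set s := posRoot (2 * M + 1) (e g)
    have hs : s ^ (2 * M + 1) = e g := posRoot_pow (by omega) hz
    have h1 : (r.map e).eval c = eval₂RingHom e c r := by
      rw [eval_map]; rfl
    have h2 : (X ^ (2 * M + 1) - C (C g) : (MvPolynomial ι ℝ)[X][X]).map (eval₂RingHom e c) =
        X ^ (2 * M + 1) - C (s ^ (2 * M + 1)) := by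
      simp [hs]
    have h3 : (P.map C + C X : (MvPolynomial ι ℝ)[X][X]).map (eval₂RingHom e c) =
        P.map e + C c := by
      simp only [Polynomial.map_add, Polynomial.map_map, Polynomial.map_C]
      congr 2
      · ext <;> simp
      · simp
    rw [h1, ← resultant_map_map, h2, h3, resultant_X_pow_sub_C _ M _ hζ]
    · simp
    · refine (natDegree_add_le _ _).trans ?_
      simp [natDegree_map_le]
  -- Positivity at the real root `s` means that `P(s) + c` and `P(s) - c` are both positive for all
  -- small `c > 0`. These two signs are those of the resultant at `c` and at `-c`.
  have key : {z : EuclideanSpace ℝ ι | 0 ≤ MvPolynomial.eval (fun i => z i) g ∧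
      0 < (P.map (MvPolynomial.eval (fun i => z i))).eval
        (posRoot (2 * M + 1) (MvPolynomial.eval (fun i => z i) g))} =
      {z | 0 ≤ MvPolynomial.eval (fun i => z i) g ∧
        (∀ᶠ c in 𝓝[>] (0 : ℝ), 0 < (r.map (MvPolynomial.eval (fun i => z i))).eval c) ∧
        ∀ᶠ c in 𝓝[>] (0 : ℝ),
          0 < ((r.comp (-X)).map (MvPolynomial.eval (fun i => z i))).eval c} := by
    ext z
    simp only [mem_ofPred_eq, and_congr_right_iff]
    intro hz
    set e := MvPolynomial.eval (fun i => z i)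
    set s := posRoot (2 * M + 1) (e g)
    have hcomp : ∀ c : ℝ, ((r.comp (-X)).map e).eval c = (r.map e).eval (-c) := fun c => by
      simp [Polynomial.map_comp, eval_comp]
    have hpos : ∀ w : ℂ, ∀ᶠ c : ℝ in 𝓝[≠] 0, 0 < Complex.normSq (w + c) := by
      intro w
      simp only [Complex.normSq_pos]
      by_cases hw : w = 0
      · filter_upwards [self_mem_nhdsWithin] with c hc
        simpa [hw] using hc
      · have : Continuous fun c : ℝ => w + c := by fun_prop
        exact ((this.tendsto 0).mono_left nhdsWithin_le_nhds).eventually_ne (by simpa using hw)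
    have hκ : ∀ᶠ c : ℝ in 𝓝[≠] 0, 0 < ∏ i ∈ Finset.range M, Complex.normSq
        (aeval (ζ ^ (i + 1) * (s : ℂ)) (P.map e) + c) := by
      have : ∀ᶠ c : ℝ in 𝓝[≠] 0, ∀ i ∈ Finset.range M, 0 < Complex.normSq
          (aeval (ζ ^ (i + 1) * (s : ℂ)) (P.map e) + c) :=
        (Finset.eventually_all _).2 fun i _ => hpos _
      filter_upwards [this] with c hc
      exact Finset.prod_pos hc
    have hκ1 : ∀ᶠ c : ℝ in 𝓝[>] 0, (0 < (r.map e).eval c ↔ 0 < (P.map e).eval s + c) := by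
      filter_upwards [hκ.filter_mono (nhdsWithin_mono _ fun c (hc : 0 < c) => hc.ne')] with c hc
      rw [hr z c hz]
      exact mul_pos_iff_of_pos_left hc
    have hκ2 : ∀ᶠ c : ℝ in 𝓝[>] 0,
        (0 < ((r.comp (-X)).map e).eval c ↔ 0 < (P.map e).eval s - c) := by
      have ht : Tendsto (fun c : ℝ => -c) (𝓝[>] 0) (𝓝[≠] 0) := by
        refine tendsto_nhdsWithin_iff.2 ⟨?_, ?_⟩
        · have : Continuous fun c : ℝ => -c := by fun_prop
          simpa using (this.tendsto 0).mono_left (nhdsWithin_le_nhds (s := Ioi 0))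
        · filter_upwards [self_mem_nhdsWithin] with c (hc : 0 < c)
          simpa using hc.ne'
      filter_upwards [ht.eventually hκ] with c hc
      rw [hcomp, hr z _ hz, sub_eq_add_neg]
      exact mul_pos_iff_of_pos_left hc
    rw [eventually_congr hκ1, eventually_congr hκ2]
    constructor
    · intro h
      refine ⟨?_, ?_⟩
      · filter_upwards [self_mem_nhdsWithin] with c (hc : 0 < c)
        linarith
      · have : Ioo (0 : ℝ) ((P.map e).eval s) ∈ 𝓝[>] (0 : ℝ) := Ioo_mem_nhdsGT h
        filter_upwards [this] with c hc
        linarith [hc.2]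
    · rintro ⟨-, h⟩
      obtain ⟨c, hc1, hc2⟩ := (h.and self_mem_nhdsWithin).exists
      have : 0 < c := hc2
      linarith
  rw [key]
  exact (IsSemialgebraic.le (by fun_prop) ⟨g, fun _ => rfl⟩).and
    ((isSemialgebraic_eventually_pos r).and (isSemialgebraic_eventually_pos _))

open Polynomial in
/-- A polynomial in a square root of `g` is affine in it. -/
theorem exists_affine_in_sqrt {ι : Type*} (P : (MvPolynomial ι ℝ)[X]) (g : MvPolynomial ι ℝ) :
    ∃ A B : MvPolynomial ι ℝ, ∀ (z : ι → ℝ) (s : ℝ), s ^ 2 = MvPolynomial.eval z g →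
      (P.map (MvPolynomial.eval z)).eval s = MvPolynomial.eval z A + MvPolynomial.eval z B * s := by
  induction P using Polynomial.induction_on' with
  | add p q hp hq =>
    obtain ⟨A, B, h⟩ := hp
    obtain ⟨A', B', h'⟩ := hq
    refine ⟨A + A', B + B', fun z s hs => ?_⟩
    simp only [Polynomial.map_add, eval_add, h z s hs, h' z s hs, map_add]
    ring
  | monomial n a =>
    rcases n.even_or_odd' with ⟨k, rfl | rfl⟩
    · refine ⟨a * g ^ k, 0, fun z s hs => ?_⟩
      simp [← hs, pow_mul]
    · refine ⟨0, a * g ^ k, fun z s hs => ?_⟩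
      simp [← hs, pow_mul, pow_succ, mul_assoc]

-- The polynomial becomes `a + b * √t`, whose sign is read off from the signs of `a`, `b` and `a ^ 2
-- - b ^ 2 * t`.
open Polynomial in
theorem isSemialgebraic_pos_sqrt {ι : Type*} (P : (MvPolynomial ι ℝ)[X]) (g : MvPolynomial ι ℝ) :
    IsSemialgebraic {z : EuclideanSpace ℝ ι | 0 ≤ MvPolynomial.eval (fun i => z i) g ∧
      0 < (P.map (MvPolynomial.eval (fun i => z i))).eval
        (posRoot 2 (MvPolynomial.eval (fun i => z i) g))} := by
  obtain ⟨A, B, h⟩ := exists_affine_in_sqrt P g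
  set a : EuclideanSpace ℝ ι → ℝ := fun z => MvPolynomial.eval (fun i => z i) A
  set b : EuclideanSpace ℝ ι → ℝ := fun z => MvPolynomial.eval (fun i => z i) B
  set t : EuclideanSpace ℝ ι → ℝ := fun z => MvPolynomial.eval (fun i => z i) g
  have ha : IsPoly a := ⟨A, fun _ => rfl⟩
  have hb : IsPoly b := ⟨B, fun _ => rfl⟩
  have ht : IsPoly t := ⟨g, fun _ => rfl⟩
  have key : {z : EuclideanSpace ℝ ι | 0 ≤ MvPolynomial.eval (fun i => z i) g ∧
      0 < (P.map (MvPolynomial.eval (fun i => z i))).eval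
        (posRoot 2 (MvPolynomial.eval (fun i => z i) g))} =
      {z | 0 ≤ t z ∧ ((0 ≤ b z ∧ (0 < a z ∨ a z ^ 2 < b z ^ 2 * t z)) ∨
        (b z < 0 ∧ 0 < a z ∧ b z ^ 2 * t z < a z ^ 2))} := by
    ext z
    simp only [mem_ofPred_eq]
    change (0 ≤ t z ∧ _) ↔ _
    refine and_congr_right fun hz => ?_
    have hs2 : posRoot 2 (t z) ^ 2 = t z := posRoot_pow two_ne_zero hz
    have hs0 := posRoot_nonneg 2 (t z)
    rw [h _ _ hs2]
    change 0 < a z + b z * posRoot 2 (t z) ↔ _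
    generalize posRoot 2 (t z) = s at hs2 hs0
    rw [← hs2, ← mul_pow]
    constructor
    · intro hpos
      rcases le_or_gt 0 (b z) with hb0 | hb0
      · refine Or.inl ⟨hb0, ?_⟩
        rcases lt_or_ge 0 (a z) with ha0 | ha0
        · exact Or.inl ha0
        · exact Or.inr (by nlinarith)
      · have := mul_nonneg (neg_nonneg.2 hb0.le) hs0
        exact Or.inr ⟨hb0, by nlinarith, by nlinarith⟩
    · rintro (⟨hb0, ha0 | ha0⟩ | ⟨hb0, ha0, hab⟩)
      · have := mul_nonneg hb0 hs0
        linarith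
      · have := mul_nonneg hb0 hs0
        have := abs_lt_of_sq_lt_sq ha0 this
        linarith [neg_abs_le (a z)]
      · have := mul_nonneg (neg_nonneg.2 hb0.le) hs0
        have := abs_lt_of_sq_lt_sq hab ha0.le
        linarith [neg_abs_le (b z * s)]
  rw [key]
  refine (IsSemialgebraic.le (by fun_prop) ht).and (.or ?_ ?_)
  · exact (IsSemialgebraic.le (by fun_prop) hb).and
      ((IsSemialgebraic.lt (by fun_prop) ha).or (.lt (by fun_prop) (by fun_prop)))
  · exact (IsSemialgebraic.lt hb (by fun_prop)).and
      ((IsSemialgebraic.lt (by fun_prop) ha).and (.lt (by fun_prop) (by fun_prop)))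

open Polynomial in
/-- A polynomial with an additional variable, as a polynomial in that variable. -/
theorem exists_polynomial_of_option {ι : Type*} (p : MvPolynomial (Option ι) ℝ) :
    ∃ P : (MvPolynomial ι ℝ)[X], ∀ (z : EuclideanSpace ℝ ι) (s : ℝ),
      MvPolynomial.eval (fun i => optExt z s i) p =
        (P.map (MvPolynomial.eval (fun i => z i))).eval s := by
  refine ⟨MvPolynomial.aeval (fun o => o.elim X (fun i => C (MvPolynomial.X i))) p, fun z s => ?_⟩
  induction p using MvPolynomial.induction_on with
  | C a => simp [IsScalarTower.algebraMap_apply ℝ (MvPolynomial ι ℝ) (MvPolynomial ι ℝ)[X],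
      MvPolynomial.algebraMap_eq]
  | add p q hp hq => simp [hp, hq]
  | mul_X p i hp => cases i <;> simp [hp]

theorem isSemialgebraic_pos_root {ι : Type*} (p : MvPolynomial (Option ι) ℝ)
    (g : MvPolynomial ι ℝ) {N : ℕ} (hN : N = 2 ∨ Odd N) :
    IsSemialgebraic {z : EuclideanSpace ℝ ι | 0 < MvPolynomial.eval
      (fun i => optExt z (posRoot N (MvPolynomial.eval (fun i => z i) g)) i) p} := by
  obtain ⟨P, hP⟩ := exists_polynomial_of_option p
  have hN0 : N ≠ 0 := by
    rcases hN with rfl | ⟨M, rfl⟩ <;> omega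
  have h1 : IsSemialgebraic {z : EuclideanSpace ℝ ι | 0 ≤ MvPolynomial.eval (fun i => z i) g ∧
      0 < (P.map (MvPolynomial.eval (fun i => z i))).eval
        (posRoot N (MvPolynomial.eval (fun i => z i) g))} := by
    rcases hN with rfl | ⟨M, rfl⟩
    · exact isSemialgebraic_pos_sqrt P g
    · exact isSemialgebraic_pos_odd_root P g M
  -- Where `g` is negative, `posRoot` takes the value `0`, so only the constant coefficient of `P`
  -- remains.
  have h2 : IsSemialgebraic {z : EuclideanSpace ℝ ι | MvPolynomial.eval (fun i => z i) g < 0 ∧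
      0 < (P.map (MvPolynomial.eval (fun i => z i))).eval 0} := by
    refine (IsSemialgebraic.lt ⟨g, fun _ => rfl⟩ (by fun_prop)).and ?_
    refine IsPoly.isSemialgebraic_pos ⟨P.coeff 0, fun z => ?_⟩
    change Polynomial.eval 0 _ = _
    rw [← Polynomial.coeff_zero_eq_eval_zero, Polynomial.coeff_map]
  convert h1.or h2 using 1
  ext z
  simp only [mem_ofPred_eq, hP]
  rcases le_or_gt 0 (MvPolynomial.eval (fun i => z i) g) with h | h
  · simp [h, not_lt.2 h]
  · simp [h, not_le.2 h, posRoot_of_nonpos hN0 h.le]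

/-- Substituting the `N`-th root of a polynomial preserves semialgebraicity. -/
theorem IsSemialgebraic.root {N : ℕ} (hN : N ≠ 0) {ι : Type*}
    {S : Set (EuclideanSpace ℝ (Option ι))} (hS : IsSemialgebraic S)
    {g : EuclideanSpace ℝ ι → ℝ} (hg : IsPoly g) :
    IsSemialgebraic {z | optExt z (posRoot N (g z)) ∈ S} := by
  induction N using Nat.strong_induction_on generalizing ι with
  | _ N ih =>
  by_cases hN' : N = 2 ∨ Odd N
  · obtain ⟨g, hg⟩ := hg
    simp only [hg]
    induction hS with
    | pos p => exact isSemialgebraic_pos_root p g hN'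
    | compl _ _ ih => exact ih.compl
    | union _ _ _ _ ih₁ ih₂ => exact ih₁.union _ _ ih₂
  -- For even `N = 2 * K` the root is the `K`-th root of a square root. The square root is first
  -- kept as a coordinate, so that the `K`-th root is again taken of a polynomial.
  · rw [not_or, Nat.not_odd_iff_even] at hN'
    obtain ⟨K, hK⟩ := hN'.2
    have hK0 : K ≠ 0 := by omega
    have hNK : N = 2 * K := by omega
    have h1 : IsSemialgebraic {w : EuclideanSpace ℝ (Option ι) |
        optExt (WithLp.toLp 2 (fun i => w (some i)) : EuclideanSpace ℝ ι)
          (posRoot K (w none)) ∈ S} := by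
      have h2 := ih K (by omega) hK0 (ι := Option ι) (S := (fun v : EuclideanSpace ℝ _ =>
        optExt (WithLp.toLp 2 (fun i => v (some (some i))) : EuclideanSpace ℝ ι) (v none)) ⁻¹' S)
        (hS.preimage (fun o => by cases o <;> simp <;> fun_prop)) (IsPoly.coord none)
      exact h2
    have h3 := ih 2 (by omega) two_ne_zero h1 hg
    rw [hNK]
    simpa [posRoot_mul] using h3

/-! ### Ambient isotopies of the three-sphere -/

theorem AmbientIsotopic.refl (A : Set S3) : AmbientIsotopic A A :=
  ⟨fun p => p.2, continuous_snd, fun _ => IsHomeomorph.id, fun _ => rfl, by simp⟩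

theorem AmbientIsotopic.trans {A B C : Set S3} (h₁ : AmbientIsotopic A B)
    (h₂ : AmbientIsotopic B C) : AmbientIsotopic A C := by
  obtain ⟨F, hF, hFh, hF0, rfl⟩ := h₁
  obtain ⟨G, hG, hGh, hG0, rfl⟩ := h₂
  refine ⟨fun p => G (p.1, F p), by fun_prop, fun t => (hGh t).comp (hFh t), fun x => ?_, ?_⟩
  · simp [hF0, hG0]
  · simp [image_image]

theorem AmbientIsotopic.symm {A B : Set S3} (h : AmbientIsotopic A B) : AmbientIsotopic B A := by
  obtain ⟨F, hF, hFh, hF0, rfl⟩ := h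
  set e := (hFh 1).homeomorph
  have he : ∀ x, F (1, e.symm x) = x := fun x => e.apply_symm_apply x
  have he' : ∀ x, e.symm (F (1, x)) = x := fun x => e.symm_apply_apply x
  have hs : Continuous e.symm := e.symm.continuous
  refine ⟨fun p => F (unitInterval.symm p.1, e.symm p.2), ?_, fun t => ?_, fun x => ?_, ?_⟩
  · fun_prop
  · exact (hFh (unitInterval.symm t)).comp e.symm.isHomeomorph
  · simp [he]
  · simp [image_image, hF0, he']

/-- The point of the upper hemisphere over a point of `ℝ³`. -/
def hemi (y : E3) : S3 :=
  ⟨(√(1 + ‖y‖ ^ 2))⁻¹ • !₂[y 0, y 1, y 2, 1], by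
    have h : ‖(!₂[y 0, y 1, y 2, 1] : E4)‖ = √(1 + ‖y‖ ^ 2) := by
      rw [EuclideanSpace.norm_eq, EuclideanSpace.norm_sq_eq]
      congr 1
      simp [Fin.sum_univ_four, Fin.sum_univ_three]
      ring
    have h0 : 0 < √(1 + ‖y‖ ^ 2) := by positivity
    rw [mem_sphere_zero_iff_norm, norm_smul, h, norm_inv, Real.norm_of_nonneg h0.le,
      inv_mul_cancel₀ h0.ne']⟩

/-- The central projection to the affine chart `ℝ³`. -/
def chart (p : E4) : E3 := !₂[p 0 / p 3, p 1 / p 3, p 2 / p 3]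

theorem mem_inSphere {P : Set E3} {u : S3} : u ∈ inSphere P ↔ 0 < u.1 3 ∧ chart u.1 ∈ P := Iff.rfl

theorem hemi_pos (y : E3) : 0 < (hemi y).1 3 := by
  simp only [hemi, PiLp.smul_apply, smul_eq_mul]
  simp
  positivity

theorem chart_smul {c : ℝ} (hc : c ≠ 0) (p : E4) : chart (c • p) = chart p := by
  ext i
  fin_cases i <;> simp [chart, mul_div_mul_left _ _ hc]

@[simp] theorem chart_hemi (y : E3) : chart (hemi y).1 = y := by
  have h0 : (√(1 + ‖y‖ ^ 2))⁻¹ ≠ 0 := by positivity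
  rw [hemi, chart_smul h0]
  ext i
  fin_cases i <;> simp [chart]

theorem norm_chart_sq {p : E4} (hp : 0 < p 3) : ‖p‖ ^ 2 = p 3 ^ 2 * (1 + ‖chart p‖ ^ 2) := by
  rw [EuclideanSpace.norm_sq_eq, EuclideanSpace.norm_sq_eq]
  simp [Fin.sum_univ_four, Fin.sum_univ_three, chart]
  field_simp
  ring

theorem smul_hemi_chart {p : E4} (hp : 0 < p 3) : ‖p‖ • (hemi (chart p)).1 = p := by
  have h1 : ‖p‖ = p 3 * √(1 + ‖chart p‖ ^ 2) := by
    rw [← Real.sqrt_sq (norm_nonneg p), norm_chart_sq hp, Real.sqrt_mul (by positivity),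
      Real.sqrt_sq hp.le]
  have h0 : √(1 + ‖chart p‖ ^ 2) ≠ 0 := by positivity
  rw [hemi, smul_smul, h1, mul_assoc, mul_inv_cancel₀ h0, mul_one]
  ext i
  fin_cases i <;> simp [chart] <;> field_simp

theorem hemi_chart {u : S3} (hu : 0 < u.1 3) : hemi (chart u.1) = u := by
  have := smul_hemi_chart hu
  rw [mem_sphere_zero_iff_norm.1 u.2, one_smul] at this
  exact Subtype.ext this

@[fun_prop]
theorem continuous_hemi : Continuous hemi := by
  refine Continuous.subtype_mk ?_ _
  have h1 : Continuous fun y : E3 => (√(1 + ‖y‖ ^ 2))⁻¹ :=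
    Continuous.inv₀ (by fun_prop) fun y => by positivity
  refine h1.smul ?_
  refine (PiLp.continuous_toLp 2 _).comp (continuous_pi fun i => ?_)
  fin_cases i <;> simp <;> fun_prop

theorem continuousAt_chart {p : E4} (hp : 0 < p 3) : ContinuousAt chart p := by
  refine (PiLp.continuous_toLp 2 _).continuousAt.comp (continuousAt_pi.2 fun i => ?_)
  fin_cases i <;>
  · simp
    refine ContinuousAt.div ?_ ?_ hp.ne' <;> fun_prop

theorem inSphere_eq_image (P : Set E3) : inSphere P = hemi '' P := by
  ext u
  rw [mem_inSphere]
  constructor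
  · exact fun h => ⟨_, h.2, hemi_chart h.1⟩
  · rintro ⟨y, hy, rfl⟩
    exact ⟨hemi_pos y, by simpa⟩

/-- An isotopy of `ℝ³` with bounded support extends to the sphere. -/
theorem ambientIsotopic_of_bounded_support (G : unitInterval × E3 → E3) (hG : Continuous G)
    (hb : ∀ t, Function.Bijective fun y => G (t, y)) (h0 : ∀ y, G (0, y) = y) (R : ℝ)
    (hR : ∀ t y, R ≤ ‖y‖ → G (t, y) = y) (Q : Set E3) :
    AmbientIsotopic (inSphere Q) (inSphere ((fun y => G (1, y)) '' Q)) := by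
  classical
  set F : unitInterval × S3 → S3 := fun p =>
    if 0 < p.2.1 3 then hemi (G (p.1, chart p.2.1)) else p.2
  have hFpos : ∀ (t) (u : S3), 0 < u.1 3 → F (t, u) = hemi (G (t, chart u.1)) :=
    fun t u hu => if_pos hu
  have hFneg : ∀ (t) (u : S3), ¬ 0 < u.1 3 → F (t, u) = u := fun t u hu => if_neg hu
  -- Points of the hemisphere near the equator have charts of norm at least `R`, where `G` is the
  -- identity. This makes `F` continuous across the equator.
  have hfar : ∀ (t) (u : S3), u.1 3 < (1 + |R|)⁻¹ → F (t, u) = u := by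
    intro t u hu
    by_cases hp : 0 < u.1 3
    · rw [hFpos t u hp, hR, hemi_chart hp]
      have h1 := norm_chart_sq hp
      rw [mem_sphere_zero_iff_norm.1 u.2] at h1
      refine (le_abs_self R).trans (abs_le_of_sq_le_sq' ?_ (norm_nonneg _)).2
      have hR0 : 0 < 1 + |R| := by positivity
      have h2 : u.1 3 * (1 + |R|) < 1 := by rwa [← one_div, lt_div_iff₀ hR0] at hu
      have h3 : (u.1 3 * (1 + |R|)) ^ 2 < 1 := by
        rw [sq_lt_one_iff₀ (by positivity)]; exact h2
      by_contra hlt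
      have : u.1 3 ^ 2 * ‖chart u.1‖ ^ 2 ≤ u.1 3 ^ 2 * |R| ^ 2 :=
        mul_le_mul_of_nonneg_left (le_of_not_ge hlt) (by positivity)
      nlinarith [abs_nonneg R, mul_pos hp hp, mul_nonneg (mul_pos hp hp).le (abs_nonneg R)]
    · exact hFneg t u hp
  have hc3 : Continuous fun p : unitInterval × S3 => p.2.1 3 := by fun_prop
  have hF : Continuous F := by
    refine continuous_iff_continuousAt.2 fun ⟨t, u⟩ => ?_
    by_cases hp : 0 < u.1 3
    · have h1 : F =ᶠ[𝓝 (t, u)] fun p => hemi (G (p.1, chart p.2.1)) := by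
        filter_upwards [hc3.continuousAt.eventually_const_lt hp] with p h
        exact hFpos _ _ h
      refine ContinuousAt.congr ?_ h1.symm
      refine (continuous_hemi.comp hG).continuousAt.comp (continuousAt_fst.prodMk ?_)
      exact ContinuousAt.comp (f := fun p : unitInterval × S3 => p.2.1) (x := (t, u))
        (continuousAt_chart hp) (by fun_prop)
    · have h1 : F =ᶠ[𝓝 (t, u)] fun p => p.2 := by
        have : u.1 3 < (1 + |R|)⁻¹ := (not_lt.1 hp).trans_lt (by positivity)
        filter_upwards [hc3.continuousAt.eventually_lt_const this] with p h
        exact hfar _ _ h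
      exact ContinuousAt.congr continuousAt_snd h1.symm
  refine ⟨F, hF, fun t => ?_, fun u => ?_, ?_⟩
  · rw [isHomeomorph_iff_continuous_bijective]
    refine ⟨by fun_prop, fun u v huv => ?_, fun v => ?_⟩
    · dsimp only at huv
      by_cases hu : 0 < u.1 3 <;> by_cases hv : 0 < v.1 3
      · rw [hFpos t u hu, hFpos t v hv] at huv
        have h2 := congrArg (fun w : S3 => chart w.1) huv
        simp only [chart_hemi] at h2
        rw [← hemi_chart hu, ← hemi_chart hv, (hb t).1 h2]
      · rw [hFpos t u hu, hFneg t v hv] at huv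
        exact absurd (huv ▸ hemi_pos _) hv
      · rw [hFneg t u hu, hFpos t v hv] at huv
        exact absurd (huv ▸ hemi_pos _) hu
      · rwa [hFneg t u hu, hFneg t v hv] at huv
    · by_cases hv : 0 < v.1 3
      · obtain ⟨y, hy⟩ := (hb t).2 (chart v.1)
        refine ⟨hemi y, ?_⟩
        dsimp only at hy ⊢
        rw [hFpos t _ (hemi_pos y), chart_hemi, hy, hemi_chart hv]
      · exact ⟨v, hFneg t v hv⟩
  · by_cases hu : 0 < u.1 3
    · rw [hFpos 0 u hu, h0, hemi_chart hu]
    · exact hFneg 0 u hu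
  · rw [inSphere_eq_image, inSphere_eq_image, image_image, image_image]
    refine image_congr fun y _ => ?_
    rw [hFpos 1 _ (hemi_pos y), chart_hemi]

/-- A path of invertible linear maps of `ℝ⁴` induces an isotopy of the sphere. -/
theorem ambientIsotopic_of_linear_path (γ : unitInterval × E4 → E4) (hγ : Continuous γ)
    (hlin : ∀ t, IsLinearMap ℝ fun p => γ (t, p)) (hinj : ∀ t p, γ (t, p) = 0 → p = 0)
    (h0 : ∀ p, γ (0, p) = p) (A : Set S3) :
    AmbientIsotopic A {v | ∃ u ∈ A, ∃ c : ℝ, 0 < c ∧ c • v.1 = γ (1, u.1)} := by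
  have hne : ∀ t (u : S3), γ (t, u.1) ≠ 0 := fun t u h => by
    have h1 := mem_sphere_zero_iff_norm.1 u.2
    rw [hinj t _ h] at h1
    simp at h1
  have hpos : ∀ t (u : S3), 0 < ‖γ (t, u.1)‖ := fun t u => norm_pos_iff.2 (hne t u)
  set F : unitInterval × S3 → S3 := fun p => ⟨‖γ (p.1, p.2.1)‖⁻¹ • γ (p.1, p.2.1), by
    rw [mem_sphere_zero_iff_norm, norm_smul, norm_inv, norm_norm, inv_mul_cancel₀ (hpos _ _).ne']⟩
  have hFs : ∀ t u, ‖γ (t, u.1)‖ • (F (t, u)).1 = γ (t, u.1) := fun t u => by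
    simp only [F, smul_smul]
    rw [mul_inv_cancel₀ (hpos t u).ne', one_smul]
  have huniq : ∀ (u v : S3) (a b : ℝ), 0 < a → 0 < b → a • u.1 = b • v.1 → u = v := by
    intro u v a b ha hb h
    have h1 := congrArg norm h
    rw [norm_smul, norm_smul, mem_sphere_zero_iff_norm.1 u.2, mem_sphere_zero_iff_norm.1 v.2,
      Real.norm_of_nonneg ha.le, Real.norm_of_nonneg hb.le, mul_one, mul_one] at h1
    subst h1
    exact Subtype.ext (smul_right_injective E4 ha.ne' h)
  have hFc : Continuous F := by
    refine Continuous.subtype_mk ?_ _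
    refine Continuous.smul (Continuous.inv₀ (by fun_prop) fun p => (hpos _ _).ne') (by fun_prop)
  refine ⟨F, hFc, fun t => ?_, fun u => ?_, ?_⟩
  · rw [isHomeomorph_iff_continuous_bijective]
    set l : E4 →ₗ[ℝ] E4 := (hlin t).mk' _
    have hl : Function.Injective l := by
      rw [← LinearMap.ker_eq_bot, LinearMap.ker_eq_bot']
      exact fun p hp => hinj t p hp
    refine ⟨by fun_prop, fun u v huv => ?_, fun v => ?_⟩
    · dsimp only at huv
      have hu := hFs t u
      have hv := hFs t v
      rw [huv] at hu
      refine huniq u v (‖γ (t, v.1)‖) (‖γ (t, u.1)‖) (hpos _ _) (hpos _ _) (hl ?_)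
      rw [map_smul, map_smul]
      change ‖γ (t, v.1)‖ • γ (t, u.1) = ‖γ (t, u.1)‖ • γ (t, v.1)
      calc ‖γ (t, v.1)‖ • γ (t, u.1)
          = ‖γ (t, v.1)‖ • ‖γ (t, u.1)‖ • (F (t, v)).1 := by rw [hu]
        _ = ‖γ (t, u.1)‖ • ‖γ (t, v.1)‖ • (F (t, v)).1 := smul_comm _ _ _
        _ = ‖γ (t, u.1)‖ • γ (t, v.1) := by rw [hv]
    · obtain ⟨p, hp⟩ := LinearMap.injective_iff_surjective.1 hl v.1
      have hp0 : p ≠ 0 := by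
        rintro rfl
        have := mem_sphere_zero_iff_norm.1 v.2
        rw [← hp] at this
        simp at this
      have hpn : 0 < ‖p‖ := norm_pos_iff.2 hp0
      set u : S3 := ⟨‖p‖⁻¹ • p, by
        rw [mem_sphere_zero_iff_norm, norm_smul, norm_inv, norm_norm, inv_mul_cancel₀ hpn.ne']⟩
      refine ⟨u, huniq _ _ (‖γ (t, u.1)‖) (‖p‖⁻¹) (hpos _ _) (by positivity) ?_⟩
      rw [hFs t u, ← hp, ← map_smul]
      rfl
  · refine huniq _ _ _ 1 (hpos 0 u) one_pos ?_
    rw [hFs, h0, one_smul]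
  · ext v
    constructor
    · rintro ⟨u, hu, rfl⟩
      exact ⟨u, hu, _, hpos 1 u, hFs 1 u⟩
    · rintro ⟨u, hu, c, hc, h⟩
      refine ⟨u, hu, huniq _ _ _ c (hpos 1 u) hc ?_⟩
      rw [h]
      exact hFs 1 u

/-! ### Affine maps of the chart -/

theorem joinedIn_mul {A B : Matrix (Fin 3) (Fin 3) ℝ}
    (hA : JoinedIn {M : Matrix (Fin 3) (Fin 3) ℝ | M.det ≠ 0} 1 A)
    (hB : JoinedIn {M : Matrix (Fin 3) (Fin 3) ℝ | M.det ≠ 0} 1 B) :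
    JoinedIn {M : Matrix (Fin 3) (Fin 3) ℝ | M.det ≠ 0} 1 (A * B) := by
  refine hB.trans ?_
  have h := hA.map (f := fun M => M * B) (by fun_prop)
  rw [one_mul] at h
  refine h.mono ?_
  rintro _ ⟨M, hM, rfl⟩
  simpa using ⟨hM, hB.target_mem⟩

theorem joinedIn_of_continuous {A : Matrix (Fin 3) (Fin 3) ℝ}
    (f : ℝ → Matrix (Fin 3) (Fin 3) ℝ) (hf : Continuous f) (h0 : f 0 = 1) (h1 : f 1 = A)
    (hd : ∀ t ∈ Icc (0 : ℝ) 1, (f t).det ≠ 0) :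
    JoinedIn {M : Matrix (Fin 3) (Fin 3) ℝ | M.det ≠ 0} 1 A :=
  JoinedIn.ofLine hf.continuousOn h0 h1 (by rintro _ ⟨t, ht, rfl⟩; exact hd t ht)

theorem joinedIn_diagonal_pos {D : Fin 3 → ℝ} (hD : ∀ i, 0 < D i) :
    JoinedIn {M : Matrix (Fin 3) (Fin 3) ℝ | M.det ≠ 0} 1 (Matrix.diagonal D) := by
  refine joinedIn_of_continuous (fun t => Matrix.diagonal fun i => (1 - t) + t * D i) ?_ ?_ ?_ ?_
  · exact Continuous.matrix_diagonal (by fun_prop)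
  · simp
  · simp
  · intro t ht
    rw [Matrix.det_diagonal]
    refine Finset.prod_ne_zero_iff.2 fun i _ => ?_
    have := hD i
    rcases ht.1.eq_or_lt with rfl | h
    · simp
    · have : 0 < (1 - t) + t * D i := add_pos_of_nonneg_of_pos (by linarith [ht.2]) (by positivity)
      exact this.ne'

theorem joinedIn_rotation (Rot : ℝ → Matrix (Fin 3) (Fin 3) ℝ) (hR : Continuous Rot)
    (h0 : Rot 0 = 1) (hdet : ∀ t, (Rot t).det = 1) :
    JoinedIn {M : Matrix (Fin 3) (Fin 3) ℝ | M.det ≠ 0} 1 (Rot Real.pi) :=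
  joinedIn_of_continuous (fun t => Rot (t * Real.pi)) (by fun_prop) (by simpa) (by simp)
    fun t _ => by simp [hdet]

theorem continuous_matrix_three {X : Type*} [TopologicalSpace X]
    {f : X → Matrix (Fin 3) (Fin 3) ℝ} (h : ∀ i j, Continuous fun x => f x i j) :
    Continuous f := continuous_matrix h

theorem joinedIn_of_det_pos {M : Matrix (Fin 3) (Fin 3) ℝ} (hM : 0 < M.det) :
    JoinedIn {M : Matrix (Fin 3) (Fin 3) ℝ | M.det ≠ 0} 1 M := by
  -- Transvections are joined to `1` by scaling their parameter. A diagonal matrix of positive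
  -- determinant has an even number of negative entries, hence is a half-turn or `1`, times a
  -- positive diagonal matrix.
  refine Matrix.diagonal_transvection_induction _ M (fun D hD => ?_) (fun t => ?_)
    fun A B => joinedIn_mul
  · rw [Matrix.det_diagonal, Fin.prod_univ_three] at hD
    rw [← hD] at hM
    have key : ∀ S : Fin 3 → ℝ, (∀ i, 0 < S i * D i) → (∀ i, S i * S i = 1) →
        JoinedIn {M : Matrix (Fin 3) (Fin 3) ℝ | M.det ≠ 0} 1 (Matrix.diagonal S) →
        JoinedIn {M : Matrix (Fin 3) (Fin 3) ℝ | M.det ≠ 0} 1 (Matrix.diagonal D) := by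
      intro S hS hS1 h
      have h2 := joinedIn_mul h (joinedIn_diagonal_pos hS)
      rw [Matrix.diagonal_mul_diagonal] at h2
      have h3 : (fun i => S i * (S i * D i)) = D := by
        ext i
        rw [← mul_assoc, hS1, one_mul]
      rwa [h3] at h2
    have hne : ∀ i, D i ≠ 0 := by
      intro i h
      fin_cases i <;> simp at h <;> simp [h] at hM
    have hr1 := joinedIn_rotation
      (fun t => !![Real.cos t, -Real.sin t, 0; Real.sin t, Real.cos t, 0; 0, 0, 1])
      (continuous_matrix_three fun i j => by fin_cases i <;> fin_cases j <;> simp <;> fun_prop)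
      (by ext i j; fin_cases i <;> fin_cases j <;> simp)
      (fun t => by simp [Matrix.det_fin_three]; nlinarith [Real.sin_sq_add_cos_sq t])
    have hr2 := joinedIn_rotation
      (fun t => !![Real.cos t, 0, -Real.sin t; 0, 1, 0; Real.sin t, 0, Real.cos t])
      (continuous_matrix_three fun i j => by fin_cases i <;> fin_cases j <;> simp <;> fun_prop)
      (by ext i j; fin_cases i <;> fin_cases j <;> simp)
      (fun t => by simp [Matrix.det_fin_three]; nlinarith [Real.sin_sq_add_cos_sq t])
    have hr3 := joinedIn_rotation
      (fun t => !![1, 0, 0; 0, Real.cos t, -Real.sin t; 0, Real.sin t, Real.cos t])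
      (continuous_matrix_three fun i j => by fin_cases i <;> fin_cases j <;> simp <;> fun_prop)
      (by ext i j; fin_cases i <;> fin_cases j <;> simp)
      (fun t => by simp [Matrix.det_fin_three]; nlinarith [Real.sin_sq_add_cos_sq t])
    have e1 : !![Real.cos Real.pi, -Real.sin Real.pi, 0; Real.sin Real.pi, Real.cos Real.pi, 0;
        0, 0, 1] = Matrix.diagonal ![-1, -1, 1] := by
      ext i j; fin_cases i <;> fin_cases j <;> simp
    have e2 : !![Real.cos Real.pi, 0, -Real.sin Real.pi; 0, 1, 0;
        Real.sin Real.pi, 0, Real.cos Real.pi] = Matrix.diagonal ![-1, 1, -1] := by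
      ext i j; fin_cases i <;> fin_cases j <;> simp
    have e3 : !![1, 0, 0; 0, Real.cos Real.pi, -Real.sin Real.pi;
        0, Real.sin Real.pi, Real.cos Real.pi] = Matrix.diagonal ![1, -1, -1] := by
      ext i j; fin_cases i <;> fin_cases j <;> simp
    rw [e1] at hr1
    rw [e2] at hr2
    rw [e3] at hr3
    rcases (hne 0).lt_or_gt with h0 | h0 <;> rcases (hne 1).lt_or_gt with h1 | h1
    · have h2 : 0 < D 2 := pos_of_mul_pos_right hM (mul_pos_of_neg_of_neg h0 h1).le
      refine key _ (fun i => ?_) (fun i => ?_) hr1 <;> fin_cases i <;> simp <;> assumption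
    · have h2 : D 2 < 0 := by
        by_contra h
        have := mul_neg_of_neg_of_pos h0 h1
        nlinarith [not_lt.1 h]
      refine key _ (fun i => ?_) (fun i => ?_) hr2 <;> fin_cases i <;> simp <;> assumption
    · have h2 : D 2 < 0 := by
        by_contra h
        have := mul_neg_of_pos_of_neg h0 h1
        nlinarith [not_lt.1 h]
      refine key _ (fun i => ?_) (fun i => ?_) hr3 <;> fin_cases i <;> simp <;> assumption
    · have h2 : 0 < D 2 := pos_of_mul_pos_right hM (mul_pos h0 h1).le
      exact joinedIn_diagonal_pos fun i => by fin_cases i <;> assumption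
  · refine joinedIn_of_continuous (fun s => Matrix.transvection t.i t.j (s * t.c)) ?_ ?_ ?_ ?_
    · refine continuous_matrix_three fun i j => ?_
      simp only [Matrix.transvection, Matrix.add_apply, Matrix.single_apply]
      split_ifs <;> fun_prop
    · simp
    · simp [Matrix.TransvectionStruct.toMatrix]
    · intro s _
      simp [Matrix.det_transvection_of_ne _ _ t.hij]

/-- The affine map of `ℝ³` with matrix `M` and translation part `b`. -/
def affMap (M : Matrix (Fin 3) (Fin 3) ℝ) (b : E3) (y : E3) : E3 :=
  WithLp.toLp 2 (M.mulVec y) + b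

theorem continuous_affine_row {f g h : unitInterval → ℝ} (hf : Continuous f) (hg : Continuous g)
    (hh : Continuous h) (c : ℝ) : Continuous fun q : unitInterval × E4 =>
      f q.1 * q.2 0 + g q.1 * q.2 1 + h q.1 * q.2 2 + q.1 * q.2 3 * c := by
  fun_prop

/-- Orientation preserving affine maps of the chart do not change the ambient isotopy class. -/
theorem ambientIsotopic_affMap {M : Matrix (Fin 3) (Fin 3) ℝ} (hM : 0 < M.det) (b : E3)
    (P : Set E3) : AmbientIsotopic (inSphere P) (inSphere (affMap M b '' P)) := by
  obtain ⟨Γ, hΓ⟩ := joinedIn_of_det_pos hM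
  -- In homogeneous coordinates an affine map is linear and fixes the fourth coordinate. Its linear
  -- part follows the path `Γ` while the translation grows linearly.
  set γ : unitInterval × E4 → E4 := fun q =>
    !₂[Γ q.1 0 0 * q.2 0 + Γ q.1 0 1 * q.2 1 + Γ q.1 0 2 * q.2 2 + q.1 * q.2 3 * b 0,
      Γ q.1 1 0 * q.2 0 + Γ q.1 1 1 * q.2 1 + Γ q.1 1 2 * q.2 2 + q.1 * q.2 3 * b 1,
      Γ q.1 2 0 * q.2 0 + Γ q.1 2 1 * q.2 1 + Γ q.1 2 2 * q.2 2 + q.1 * q.2 3 * b 2, q.2 3]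
  have hrow : ∀ i, Continuous fun q : unitInterval × E4 => Γ q.1 i 0 * q.2 0 + Γ q.1 i 1 * q.2 1 +
      Γ q.1 i 2 * q.2 2 + q.1 * q.2 3 * b i := fun i => by
    have hΓc : ∀ j, Continuous fun t : unitInterval => Γ t i j := fun j =>
      (continuous_apply_apply i j).comp Γ.continuous
    exact continuous_affine_row (hΓc 0) (hΓc 1) (hΓc 2) (b i)
  have hγ : Continuous γ := by
    refine (PiLp.continuous_toLp 2 _).comp (continuous_pi fun i => ?_)
    fin_cases i
    exacts [hrow 0, hrow 1, hrow 2, by simp; fun_prop]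
  have h3 : ∀ t p, γ (t, p) 3 = p 3 := fun t p => rfl
  have hchart : ∀ p : E4, p 3 ≠ 0 → chart (γ (1, p)) = affMap M b (chart p) := by
    intro p hp
    ext i
    fin_cases i <;>
      simp [γ, chart, affMap, Matrix.mulVec, dotProduct, Fin.sum_univ_three] <;> field_simp
  have hadd : ∀ t p q, γ (t, p + q) = γ (t, p) + γ (t, q) := fun t p q => by
    ext i
    fin_cases i <;> simp [γ] <;> ring
  have hsmul : ∀ t (c : ℝ) p, γ (t, c • p) = c • γ (t, p) := fun t c p => by
    ext i
    fin_cases i <;> simp [γ] <;> ring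
  have hinj : ∀ t p, γ (t, p) = 0 → p = 0 := fun t p h => by
    have hp3 : p 3 = 0 := by rw [← h3 t, h]; rfl
    have hz : ![p 0, p 1, p 2] = 0 := by
      refine Matrix.eq_zero_of_mulVec_eq_zero (hΓ t) ?_
      ext i
      have h0 := congrArg (fun p : E4 => p 0) h
      have h1 := congrArg (fun p : E4 => p 1) h
      have h2 := congrArg (fun p : E4 => p 2) h
      simp [γ, hp3] at h0 h1 h2
      fin_cases i <;> simpa [Matrix.mulVec, dotProduct, Fin.sum_univ_three]
    have h0 := congrFun hz 0
    have h1 := congrFun hz 1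
    have h2 := congrFun hz 2
    simp at h0 h1 h2
    ext i
    fin_cases i <;> simp [h0, h1, h2, hp3]
  have hzero : ∀ p, γ (0, p) = p := fun p => by
    ext i
    fin_cases i <;> simp [γ]
  clear_value γ
  have main := ambientIsotopic_of_linear_path γ hγ (fun t => ⟨hadd t, hsmul t⟩) hinj hzero
    (inSphere P)
  have hset : inSphere (affMap M b '' P) =
      {v | ∃ u ∈ inSphere P, ∃ c : ℝ, 0 < c ∧ c • v.1 = γ (1, u.1)} := by
    ext v
    simp only [mem_inSphere, mem_ofPred_eq]
    constructor
    · rintro ⟨hv, y, hy, hyv⟩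
      have hpos : 0 < (hemi y).1 3 := hemi_pos y
      refine ⟨hemi y, ⟨hpos, by simpa⟩, ‖γ (1, (hemi y).1)‖, ?_, ?_⟩
      · refine norm_pos_iff.2 fun h => ?_
        have := h3 1 (hemi y).1
        rw [h] at this
        simp at this
        linarith
      · have h1 : chart (γ (1, (hemi y).1)) = chart v.1 := by
          rw [hchart _ hpos.ne', chart_hemi, hyv]
        have h2 := smul_hemi_chart (p := γ (1, (hemi y).1)) (by rwa [h3])
        rwa [h1, hemi_chart hv] at h2
    · rintro ⟨u, ⟨hu, hP⟩, c, hc, h⟩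
      have h1 : c * v.1 3 = u.1 3 := by
        have := congrArg (fun p : E4 => p 3) h
        simpa [h3] using this
      refine ⟨pos_of_mul_pos_right (h1 ▸ hu) hc.le, chart u.1, hP, ?_⟩
      rw [← hchart _ hu.ne', ← h, chart_smul hc.ne']
  rw [hset]
  exact main

/-! ### Lipschitz perturbations and triangle moves -/

/-- Moving the points of a bounded set in a fixed direction by a function with small Lipschitz
constant does not change the ambient isotopy class. -/
theorem ambientIsotopic_of_lipschitz {Q : Set E3} (hQ : Bornology.IsBounded Q) {φ : E3 → ℝ}
    {K : NNReal} (hφ : LipschitzOnWith K φ Q) (h01 : ∀ x ∈ Q, φ x ∈ Icc (0 : ℝ) 1) (d : E3)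
    (hd : K * ‖d‖ < 1) :
    AmbientIsotopic (inSphere Q) (inSphere ((fun x => x + φ x • d) '' Q)) := by
  obtain ⟨g, hg, hgφ⟩ := hφ.extend_real
  obtain ⟨B, hB⟩ := hQ.exists_norm_le
  set c := 1 - K * ‖d‖
  have hc : 0 < c := by simp only [c]; linarith
  -- This is the slope of the cutoff. It is so small that the product of cutoff and extension keeps
  -- a Lipschitz constant `K + δ` with `(K + δ) * ‖d‖ < 1`.
  set δ : ℝ := c / (2 * (‖d‖ + 1))
  have hdn := norm_nonneg d
  have hδ : 0 < δ := by positivity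
  have hδd : δ * ‖d‖ < c := by
    have : δ * (2 * (‖d‖ + 1)) = c := div_mul_cancel₀ _ (by positivity)
    nlinarith
  set cut : E3 → ℝ := fun x => max 0 (min 1 (1 + δ * (B - ‖x‖)))
  set ψ : E3 → ℝ := fun x => max 0 (min 1 (g x))
  set f : E3 → ℝ := fun x => cut x * ψ x
  have hclamp : ∀ a b : ℝ, |max 0 (min 1 a) - max 0 (min 1 b)| ≤ |a - b| := fun a b => by
    rw [max_comm 0, max_comm 0, min_comm 1, min_comm 1]
    exact (abs_max_sub_max_le_abs _ _ _).trans (abs_inf_sub_inf_le_abs a b 1)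
  have hclamp0 : ∀ a : ℝ, 0 ≤ max 0 (min 1 a) ∧ max 0 (min 1 a) ≤ 1 := fun a =>
    ⟨le_max_left _ _, max_le zero_le_one (min_le_left _ _)⟩
  have hf : ∀ x y, |f x - f y| ≤ (K + δ) * ‖x - y‖ := by
    intro x y
    have h1 : |ψ x - ψ y| ≤ K * ‖x - y‖ := by
      refine (hclamp _ _).trans ?_
      have := hg.dist_le_mul x y
      rwa [Real.dist_eq, dist_eq_norm] at this
    have h2 : |cut x - cut y| ≤ δ * ‖x - y‖ := by
      refine (hclamp _ _).trans ?_
      have : 1 + δ * (B - ‖x‖) - (1 + δ * (B - ‖y‖)) = δ * (‖y‖ - ‖x‖) := by ring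
      rw [this, abs_mul, abs_of_pos hδ]
      gcongr
      rw [← norm_neg (x - y), neg_sub]
      exact abs_norm_sub_norm_le _ _
    have h3 : f x - f y = cut x * (ψ x - ψ y) + (cut x - cut y) * ψ y := by simp only [f]; ring
    rw [h3]
    refine (abs_add_le _ _).trans ?_
    rw [abs_mul, abs_mul, abs_of_nonneg (hclamp0 (1 + δ * (B - ‖x‖))).1,
      abs_of_nonneg (hclamp0 (g y)).1]
    have h4 : cut x * |ψ x - ψ y| ≤ 1 * (K * ‖x - y‖) :=
      mul_le_mul (hclamp0 _).2 h1 (abs_nonneg _) zero_le_one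
    have h5 : |cut x - cut y| * ψ y ≤ δ * ‖x - y‖ * 1 :=
      mul_le_mul h2 (hclamp0 _).2 (hclamp0 _).1 (by positivity)
    linarith
  have hL : (K + δ) * ‖d‖ < 1 := by
    have : c = 1 - K * ‖d‖ := rfl
    linarith
  have hfc : Continuous f := by
    have : Continuous g := hg.continuous
    simp only [f, cut, ψ]
    fun_prop
  have hcut0 : ∀ x, B + δ⁻¹ ≤ ‖x‖ → cut x = 0 := by
    intro x hx
    refine max_eq_left ((min_le_right _ _).trans ?_)
    have h1 : δ * (B - ‖x‖) ≤ δ * (-δ⁻¹) := by gcongr; linarith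
    rw [mul_neg, mul_inv_cancel₀ hδ.ne'] at h1
    linarith
  have hfQ : ∀ x ∈ Q, f x = φ x := by
    intro x hx
    have h1 : cut x = 1 := by
      have : (1 : ℝ) ≤ 1 + δ * (B - ‖x‖) := by
        have := hB x hx
        have : 0 ≤ δ * (B - ‖x‖) := mul_nonneg hδ.le (by linarith)
        linarith
      simp only [cut]
      rw [min_eq_left this, max_eq_right zero_le_one]
    have h2 : ψ x = φ x := by
      simp only [ψ]
      rw [← hgφ hx, min_eq_right (h01 x hx).2, max_eq_right (h01 x hx).1]
    simp only [f]
    rw [h1, h2, one_mul]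
  have main := ambientIsotopic_of_bounded_support (fun p => p.2 + ((p.1 : ℝ) * f p.2) • d)
    (by fun_prop) (fun t => ⟨fun x y hxy => ?_, fun z => ?_⟩) (fun y => by simp) (B + δ⁻¹)
    (fun t y hy => by simp [f, hcut0 y hy]) Q
  · convert main using 2
    refine image_congr fun x hx => ?_
    simp [hfQ x hx]
  · dsimp only at hxy
    by_contra hne
    -- Two points with the same image would differ by a displacement whose norm is at most `(K + δ)
    -- * ‖d‖` times their distance, and this factor is less than `1`.
    have h1 : x - y = ((t : ℝ) * (f y - f x)) • d := by
      rw [mul_sub, sub_smul, sub_eq_sub_iff_add_eq_add, hxy, add_comm]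
    have h2 : ‖x - y‖ ≤ (K + δ) * ‖x - y‖ * ‖d‖ := by
      conv_lhs => rw [h1, norm_smul, norm_mul, Real.norm_of_nonneg t.2.1]
      have h4 := hf y x
      rw [norm_sub_rev] at h4
      have h5 : (t : ℝ) * ‖f y - f x‖ ≤ 1 * ‖f y - f x‖ :=
        mul_le_mul_of_nonneg_right t.2.2 (norm_nonneg _)
      rw [one_mul] at h5
      exact mul_le_mul_of_nonneg_right (h5.trans h4) (norm_nonneg _)
    have h3 : 0 < ‖x - y‖ := norm_pos_iff.2 (sub_ne_zero.2 hne)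
    nlinarith
  · -- the equation is solved along the line through `z` in direction `d`
    have hcont : Continuous fun s : ℝ => s + t * f (z + s • d) := by fun_prop
    have hfb : ∀ x, 0 ≤ f x ∧ f x ≤ 1 := fun x =>
      ⟨mul_nonneg (hclamp0 _).1 (hclamp0 _).1,
        mul_le_one₀ (hclamp0 _).2 (hclamp0 _).1 (hclamp0 _).2⟩
    have ht := t.2
    have h1 : (-1 : ℝ) + t * f (z + (-1 : ℝ) • d) ≤ 0 := by
      have := mul_le_one₀ ht.2 (hfb (z + (-1 : ℝ) • d)).1 (hfb (z + (-1 : ℝ) • d)).2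
      linarith
    have h2 : (0 : ℝ) ≤ 0 + t * f (z + (0 : ℝ) • d) := by
      rw [zero_add]; exact mul_nonneg ht.1 (hfb _).1
    obtain ⟨s, -, hs⟩ := intermediate_value_Icc (by norm_num : (-1 : ℝ) ≤ 0)
      hcont.continuousOn ⟨h1, h2⟩
    refine ⟨z + s • d, ?_⟩
    dsimp only at hs ⊢
    rw [add_assoc, ← add_smul, hs, zero_smul, add_zero]

/-- Lower bound for nonnegative combinations of vectors spanning a pointed cone. -/
theorem exists_cone_bound {p q r : E3}
    (h : ∀ a b c : ℝ, 0 ≤ a → 0 ≤ b → 0 ≤ c → a • p + b • q + c • r = 0 → a = 0 ∧ b = 0 ∧ c = 0) :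
    ∃ m : ℝ, 0 < m ∧ ∀ a b c : ℝ, 0 ≤ a → 0 ≤ b → 0 ≤ c →
      m * (a + b + c) ≤ ‖a • p + b • q + c • r‖ := by
  set K : Set (ℝ × ℝ × ℝ) :=
    {x | x.1 + x.2.1 + x.2.2 = 1} ∩ Icc (0, 0, 0) (1, 1, 1)
  have hK : IsCompact K := by
    refine isCompact_Icc.inter_left (isClosed_eq ?_ ?_) <;> fun_prop
  have hKne : K.Nonempty := ⟨(1, 0, 0), by simp, by simp [Prod.le_def]⟩
  have hc : Continuous fun x : ℝ × ℝ × ℝ => ‖x.1 • p + x.2.1 • q + x.2.2 • r‖ := by fun_prop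
  obtain ⟨x, hx, hmin⟩ := hK.exists_isMinOn hKne hc.continuousOn
  refine ⟨‖x.1 • p + x.2.1 • q + x.2.2 • r‖, norm_pos_iff.2 fun h0 => ?_, fun a b c ha hb hc => ?_⟩
  · have h1 : x.1 + x.2.1 + x.2.2 = 1 := hx.1
    obtain ⟨⟨ha, hb, hc⟩, -⟩ := hx.2
    obtain ⟨h2, h3, h4⟩ := h _ _ _ ha hb hc h0
    rw [h2, h3, h4] at h1
    norm_num at h1
  · rcases (add_nonneg (add_nonneg ha hb) hc).eq_or_lt with hs | hs
    · rw [← hs, mul_zero]; positivity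
    · set s := a + b + c
      have hmem : ((a / s, b / s, c / s) : ℝ × ℝ × ℝ) ∈ K := by
        refine ⟨?_, ⟨?_, ?_, ?_⟩, ⟨?_, ?_, ?_⟩⟩
        · change a / s + b / s + c / s = 1
          rw [← add_div, ← add_div, div_self hs.ne']
        all_goals first | positivity | (refine (div_le_one hs).2 ?_; simp only [s]; linarith)
      have h1 := hmin hmem
      have h2 : a • p + b • q + c • r = s • ((a / s) • p + (b / s) • q + (c / s) • r) := by
        simp only [smul_add, smul_smul, mul_div_cancel₀ _ hs.ne']
      rw [h2, norm_smul, Real.norm_of_nonneg hs.le, mul_comm]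
      exact mul_le_mul_of_nonneg_left h1 hs.le

/-- The triangle with vertices `a`, `b`, `c`. -/
def triangle (a b c : E3) : Set E3 :=
  {x | ∃ s t : ℝ, 0 ≤ s ∧ 0 ≤ t ∧ s + t ≤ 1 ∧ x = a + s • (b - a) + t • (c - a)}

theorem isCompact_triangle (a b c : E3) : IsCompact (triangle a b c) := by
  have : triangle a b c = (fun x : ℝ × ℝ => a + x.1 • (b - a) + x.2 • (c - a)) ''
      (Icc (0, 0) (1, 1) ∩ {x | x.1 + x.2 ≤ 1}) := by
    ext x
    constructor
    · rintro ⟨s, t, hs, ht, hst, rfl⟩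
      exact ⟨(s, t), ⟨⟨⟨hs, ht⟩, ⟨by simp; linarith, by simp; linarith⟩⟩, hst⟩, rfl⟩
    · rintro ⟨⟨s, t⟩, ⟨⟨⟨hs, ht⟩, -⟩, hst⟩, rfl⟩
      exact ⟨s, t, hs, ht, hst, rfl⟩
  rw [this]
  refine (isCompact_Icc.inter_right (isClosed_le ?_ ?_)).image ?_ <;> fun_prop

theorem convex_triangle (a b c : E3) : Convex ℝ (triangle a b c) := by
  rintro x ⟨s, t, hs, ht, hst, rfl⟩ y ⟨s', t', hs', ht', hst', rfl⟩ m n hm hn hmn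
  refine ⟨m * s + n * s', m * t + n * t', by positivity, by positivity, by nlinarith, ?_⟩
  obtain rfl : m = 1 - n := by linarith
  module

theorem left_mem_triangle (a b c : E3) : a ∈ triangle a b c :=
  ⟨0, 0, le_rfl, le_rfl, by norm_num, by simp⟩

theorem right_mem_triangle (a b c : E3) : c ∈ triangle a b c :=
  ⟨0, 1, le_rfl, zero_le_one, by norm_num, by simp⟩

theorem triangle_swap (a b c : E3) : triangle c b a = triangle a b c := by
  have : ∀ a c : E3, triangle a b c ⊆ triangle c b a := by
    rintro a c x ⟨s, t, hs, ht, hst, rfl⟩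
    exact ⟨s, 1 - s - t, hs, by linarith, by linarith, by module⟩
  exact (this c a).antisymm (this a c)

/-- Finite unions of segments. -/
def IsSegmentUnion (R : Set E3) : Prop :=
  ∃ (ι : Type) (_ : Finite ι) (u v : ι → E3), R = ⋃ i, segment ℝ (u i) (v i)

theorem isSegmentUnion_segment (a b : E3) : IsSegmentUnion (segment ℝ a b) :=
  ⟨Unit, inferInstance, fun _ => a, fun _ => b, by simp [iUnion_const]⟩

theorem IsSegmentUnion.union {R R' : Set E3} (h : IsSegmentUnion R) (h' : IsSegmentUnion R') :
    IsSegmentUnion (R ∪ R') := by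
  obtain ⟨ι, _, u, v, rfl⟩ := h
  obtain ⟨ι', _, u', v', rfl⟩ := h'
  exact ⟨ι ⊕ ι', inferInstance, Sum.elim u u', Sum.elim v v', by simp [iUnion_sum]⟩

theorem IsSegmentUnion.iUnion {κ : Type} [Finite κ] {R : κ → Set E3}
    (h : ∀ k, IsSegmentUnion (R k)) : IsSegmentUnion (⋃ k, R k) := by
  choose ι hι u v hR using h
  refine ⟨Σ k, ι k, inferInstance, fun x => u x.1 x.2, fun x => v x.1 x.2, ?_⟩
  simp only [hR, iUnion_sigma]

theorem isCompact_segment (a b : E3) : IsCompact (segment ℝ a b) := by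
  rw [segment_eq_image']
  exact isCompact_Icc.image (by fun_prop)

theorem IsSegmentUnion.isCompact {R : Set E3} (h : IsSegmentUnion R) : IsCompact R := by
  obtain ⟨ι, _, u, v, rfl⟩ := h
  exact isCompact_iUnion fun i => isCompact_segment _ _

/-- Estimates are proved for each edge or pair of edges separately; this turns their constants into
a uniform one. -/
theorem exists_common_pos {ι : Type*} [Finite ι] {P : ι → ℝ → Prop}
    (hmono : ∀ i m m', 0 < m' → m' ≤ m → P i m → P i m') (h : ∀ i, ∃ m, 0 < m ∧ P i m) :
    ∃ m, 0 < m ∧ ∀ i, P i m := by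
  choose m hm hP using h
  rcases isEmpty_or_nonempty ι with hι | hι
  · exact ⟨1, one_pos, fun i => (hι.false i).elim⟩
  · obtain ⟨i₀, hi₀⟩ := Finite.exists_min m
    exact ⟨m i₀, hm i₀, fun i => hmono i _ _ (hm i₀) (hi₀ i) (hP i)⟩

theorem mem_segment_split {u v a y : E3} (ha : a ∈ segment ℝ u v) (hy : y ∈ segment ℝ u v) :
    y ∈ segment ℝ a u ∨ y ∈ segment ℝ a v := by
  rw [segment_eq_image_lineMap] at ha hy
  obtain ⟨τ, hτ, rfl⟩ := ha
  obtain ⟨θ, hθ, rfl⟩ := hy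
  have key : ∀ w : ℝ, θ ∈ segment ℝ τ w → AffineMap.lineMap u v θ ∈
      segment ℝ (AffineMap.lineMap u v τ) (AffineMap.lineMap u v w) := fun w h => by
    rw [← image_segment]
    exact mem_image_of_mem _ h
  rcases le_total θ τ with h | h
  · left
    simpa using key 0 (by rw [segment_symm, segment_eq_Icc hτ.1]; exact ⟨hθ.1, h⟩)
  · right
    simpa using key 1 (by rw [segment_eq_Icc hτ.2]; exact ⟨h, hθ.2⟩)

/-- Seen from `a`, the triangle and the segment span cones that meet only in the apex: a common
direction, scaled down, would give a second common point. Compactness (`exists_cone_bound`) makes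
this quantitative. -/
theorem exists_sep_vertex {a b c v : E3}
    (hLI : ∀ s t : ℝ, s • (b - a) + t • (c - a) = 0 → s = 0 ∧ t = 0)
    (h : triangle a b c ∩ segment ℝ a v ⊆ {a}) :
    ∃ m : ℝ, 0 < m ∧ ∀ x ∈ triangle a b c, ∀ y ∈ segment ℝ a v, m * dist x a ≤ dist x y := by
  by_cases hv : v = a
  · subst hv
    refine ⟨1, one_pos, fun x _ y hy => ?_⟩
    rw [segment_same] at hy
    rw [mem_singleton_iff.1 hy, one_mul]
  obtain ⟨m, hm, hmb⟩ := exists_cone_bound (p := b - a) (q := c - a) (r := -(v - a))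
    (fun s t μ hs ht hμ h0 => by
      have h1 : s • (b - a) + t • (c - a) = μ • (v - a) := by
        rw [smul_neg, ← sub_eq_add_neg, sub_eq_zero] at h0
        exact h0
      set κ : ℝ := (s + t + μ + 1)⁻¹
      have hκ : 0 < κ := by positivity
      have hκ1 : κ * (s + t + μ + 1) = 1 := inv_mul_cancel₀ (by positivity)
      have h2 : a + κ • (s • (b - a) + t • (c - a)) ∈ ({a} : Set E3) := by
        refine h ⟨⟨κ * s, κ * t, by positivity, by positivity, by nlinarith, by module⟩, ?_⟩
        rw [h1, segment_eq_image']
        exact ⟨κ * μ, ⟨by positivity, by nlinarith⟩, by simp [smul_smul]⟩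
      have h3 : κ • (s • (b - a) + t • (c - a)) = 0 := by simpa using h2
      rw [smul_eq_zero_iff_right hκ.ne'] at h3
      obtain ⟨rfl, rfl⟩ := hLI _ _ h3
      rw [h3] at h1
      refine ⟨rfl, rfl, ?_⟩
      rcases smul_eq_zero.1 h1.symm with h4 | h4
      · exact h4
      · exact absurd (sub_eq_zero.1 h4) hv)
  refine ⟨m / (‖b - a‖ + ‖c - a‖ + 1), by positivity, ?_⟩
  rintro x ⟨s, t, hs, ht, hst, rfl⟩ y hy
  rw [segment_eq_image'] at hy
  obtain ⟨μ, hμ, rfl⟩ := hy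
  have h1 := hmb s t μ hs ht hμ.1
  have h2 : dist (a + s • (b - a) + t • (c - a)) (a + μ • (v - a)) =
      ‖s • (b - a) + t • (c - a) + μ • -(v - a)‖ := by
    rw [dist_eq_norm]; congr 1; module
  have h3 : dist (a + s • (b - a) + t • (c - a)) a ≤ (s + t) * (‖b - a‖ + ‖c - a‖ + 1) := by
    have : dist (a + s • (b - a) + t • (c - a)) a = ‖s • (b - a) + t • (c - a)‖ := by
      rw [dist_eq_norm]; congr 1; module
    rw [this]
    refine (norm_add_le _ _).trans ?_
    rw [norm_smul, norm_smul, Real.norm_of_nonneg hs, Real.norm_of_nonneg ht]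
    nlinarith [norm_nonneg (b - a), norm_nonneg (c - a), mul_nonneg hs (norm_nonneg (c - a)),
      mul_nonneg ht (norm_nonneg (b - a))]
  rw [h2]
  refine le_trans ?_ h1
  rw [div_mul_eq_mul_div, div_le_iff₀ (by positivity)]
  nlinarith [hμ.1, mul_le_mul_of_nonneg_left h3 hm.le, mul_nonneg hm.le (mul_nonneg hμ.1
    (by positivity : 0 ≤ ‖b - a‖ + ‖c - a‖ + 1))]

/-- A segment disjoint from the triangle has a positive distance from it. Otherwise it contains
exactly one of `a` and `c`, since by convexity both would put their midpoint into the intersection.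
It is then split at that vertex. -/
theorem exists_sep_segment {a b c u v : E3}
    (hLI : ∀ s t : ℝ, s • (b - a) + t • (c - a) = 0 → s = 0 ∧ t = 0)
    (h : triangle a b c ∩ segment ℝ u v ⊆ {a, c}) :
    ∃ m : ℝ, 0 < m ∧ ∀ x ∈ triangle a b c, ∀ y ∈ segment ℝ u v,
      m * min (dist x a) (dist x c) ≤ dist x y := by
  have hac : a ≠ c := by
    rintro rfl
    have := (hLI 0 1 (by simp)).2
    norm_num at this
  rcases (triangle a b c ∩ segment ℝ u v).eq_empty_or_nonempty with he | ⟨z, hzT, hz⟩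
  · have hne : (triangle a b c ×ˢ segment ℝ u v).Nonempty :=
      ⟨(a, u), left_mem_triangle _ _ _, left_mem_segment ℝ _ _⟩
    obtain ⟨⟨x₀, y₀⟩, hxy, hmin⟩ := ((isCompact_triangle a b c).prod
      (isCompact_segment u v)).exists_isMinOn hne continuous_dist.continuousOn
    have hpos : 0 < dist x₀ y₀ := dist_pos.2 fun h0 => by
      have : x₀ ∈ triangle a b c ∩ segment ℝ u v := ⟨hxy.1, h0 ▸ hxy.2⟩
      rw [he] at this
      exact this
    obtain ⟨D, hD⟩ := (isCompact_triangle a b c).isBounded.subset_closedBall a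
    have hD0 : 0 ≤ D := by
      have := hD (left_mem_triangle a b c)
      simpa using this
    refine ⟨dist x₀ y₀ / (D + 1), by positivity, fun x hx y hy => ?_⟩
    have h1 : dist x₀ y₀ ≤ dist x y := isMinOn_iff.1 hmin (x, y) ⟨hx, hy⟩
    have h2 : dist x a ≤ D := hD hx
    refine le_trans ?_ h1
    rw [div_mul_eq_mul_div, div_le_iff₀ (by positivity)]
    have : min (dist x a) (dist x c) ≤ D + 1 := (min_le_left _ _).trans (by linarith)
    nlinarith
  · have key : ∀ a c : E3, a ≠ c → (∀ s t : ℝ, s • (b - a) + t • (c - a) = 0 → s = 0 ∧ t = 0) →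
        triangle a b c ∩ segment ℝ u v ⊆ {a, c} → a ∈ segment ℝ u v →
        ∃ m : ℝ, 0 < m ∧ ∀ x ∈ triangle a b c, ∀ y ∈ segment ℝ u v, m * dist x a ≤ dist x y := by
      intro a c hac hLI h ha
      have hcs : c ∉ segment ℝ u v := fun hc => by
        have hm : (2⁻¹ : ℝ) • a + (2⁻¹ : ℝ) • c ∈ triangle a b c ∩ segment ℝ u v :=
          ((convex_triangle a b c).inter (convex_segment u v))
            ⟨left_mem_triangle _ _ _, ha⟩ ⟨right_mem_triangle _ _ _, hc⟩
            (by norm_num) (by norm_num) (by norm_num)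
        have h2 : (2⁻¹ : ℝ) • (c - a) = 0 := by
          rcases h hm with h1 | h1
          · calc (2⁻¹ : ℝ) • (c - a) = ((2⁻¹ : ℝ) • a + (2⁻¹ : ℝ) • c) - a := by module
              _ = 0 := by rw [h1, sub_self]
          · rw [mem_singleton_iff] at h1
            calc (2⁻¹ : ℝ) • (c - a) = c - ((2⁻¹ : ℝ) • a + (2⁻¹ : ℝ) • c) := by module
              _ = 0 := by rw [h1, sub_self]
        rw [smul_eq_zero_iff_right (by norm_num), sub_eq_zero] at h2
        exact hac h2.symm
      have hsub : triangle a b c ∩ segment ℝ u v ⊆ {a} := fun x hx => by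
        rcases h hx with h1 | h1
        · exact h1
        · rw [mem_singleton_iff] at h1
          exact absurd (h1 ▸ hx.2) hcs
      obtain ⟨m₁, hm₁, h₁⟩ := exists_sep_vertex (v := u) hLI fun x hx =>
        hsub ⟨hx.1, (convex_segment u v).segment_subset ha (left_mem_segment ℝ u v) hx.2⟩
      obtain ⟨m₂, hm₂, h₂⟩ := exists_sep_vertex (v := v) hLI fun x hx =>
        hsub ⟨hx.1, (convex_segment u v).segment_subset ha (right_mem_segment ℝ u v) hx.2⟩
      refine ⟨min m₁ m₂, lt_min hm₁ hm₂, fun x hx y hy => ?_⟩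
      rcases mem_segment_split ha hy with hy | hy
      · exact (mul_le_mul_of_nonneg_right (min_le_left _ _) dist_nonneg).trans (h₁ x hx y hy)
      · exact (mul_le_mul_of_nonneg_right (min_le_right _ _) dist_nonneg).trans (h₂ x hx y hy)
    rcases h ⟨hzT, hz⟩ with rfl | h1
    · obtain ⟨m, hm, hmb⟩ := key z c hac hLI h hz
      exact ⟨m, hm, fun x hx y hy =>
        (mul_le_mul_of_nonneg_left (min_le_left _ _) hm.le).trans (hmb x hx y hy)⟩
    · rw [mem_singleton_iff] at h1
      subst h1
      obtain ⟨m, hm, hmb⟩ := key z a hac.symm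
        (fun s t hst => by
          have := hLI s (-s - t) (by rw [← hst]; module)
          exact ⟨this.1, by linarith [this.1, this.2]⟩)
        (by rw [triangle_swap, pair_comm]; exact h) hz
      rw [triangle_swap] at hmb
      exact ⟨m, hm, fun x hx y hy =>
        (mul_le_mul_of_nonneg_left (min_le_right _ _) hm.le).trans (hmb x hx y hy)⟩

theorem exists_sep_union {a b c : E3} {R : Set E3} (hR : IsSegmentUnion R)
    (hLI : ∀ s t : ℝ, s • (b - a) + t • (c - a) = 0 → s = 0 ∧ t = 0)
    (h : triangle a b c ∩ R ⊆ {a, c}) :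
    ∃ m : ℝ, 0 < m ∧ ∀ x ∈ triangle a b c, ∀ y ∈ R, m * min (dist x a) (dist x c) ≤ dist x y := by
  obtain ⟨ι, _, u, v, rfl⟩ := hR
  obtain ⟨m, hm, hmb⟩ := exists_common_pos (P := fun i m => ∀ x ∈ triangle a b c,
      ∀ y ∈ segment ℝ (u i) (v i), m * min (dist x a) (dist x c) ≤ dist x y)
    (fun i m m' hm' hmm hP x hx y hy => (mul_le_mul_of_nonneg_right hmm
      (le_min dist_nonneg dist_nonneg)).trans (hP x hx y hy))
    (fun i => exists_sep_segment hLI fun x hx => h ⟨hx.1, mem_iUnion.2 ⟨i, hx.2⟩⟩)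
  refine ⟨m, hm, fun x hx y hy => ?_⟩
  obtain ⟨i, hi⟩ := mem_iUnion.1 hy
  exact hmb i x hx y hi

/-- The functionals provide affine coordinates of the triangle, which extend to all of `E3`. -/
theorem exists_dual_pair {p q : E3} (hLI : ∀ s t : ℝ, s • p + t • q = 0 → s = 0 ∧ t = 0) :
    ∃ A B : E3 →L[ℝ] ℝ, A p = 1 ∧ A q = 0 ∧ B p = 0 ∧ B q = 1 := by
  have hli : LinearIndependent ℝ ![p, q] := LinearIndependent.pair_iff.2 hLI
  obtain ⟨f, hf⟩ := (LinearMap.exists_leftInverse_of_injective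
    (Fintype.linearCombination ℝ ![p, q]) (LinearMap.ker_eq_bot.2
      hli.fintypeLinearCombination_injective))
  have hf' : ∀ w, f (Fintype.linearCombination ℝ ![p, q] w) = w := fun w =>
    LinearMap.congr_fun hf w
  have hp := hf' (Pi.single 0 1)
  have hq := hf' (Pi.single 1 1)
  simp [Fintype.linearCombination_apply] at hp hq
  refine ⟨((LinearMap.proj 0).comp f).toContinuousLinearMap,
    ((LinearMap.proj 1).comp f).toContinuousLinearMap, ?_, ?_, ?_, ?_⟩ <;> simp [hp, hq]

/-- Replacing two sides of a triangle by the third one, when the rest of the curve meets the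
triangle at most in the endpoints of the third side. -/
theorem ambientIsotopic_triangle_move {a b c : E3} {R : Set E3} (hR : IsSegmentUnion R)
    (hLI : ∀ s t : ℝ, s • (b - a) + t • (c - a) = 0 → s = 0 ∧ t = 0)
    (h : triangle a b c ∩ R ⊆ {a, c}) :
    AmbientIsotopic (inSphere (R ∪ (segment ℝ a b ∪ segment ℝ b c)))
      (inSphere (R ∪ segment ℝ a c)) := by
  classical
  obtain ⟨m, hm, hsep⟩ := exists_sep_union hR hLI h
  obtain ⟨A, B, hAp, hAq, hBp, hBq⟩ := exists_dual_pair hLI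
  -- A tent function on the triangle, zero at `a` and `c`. On each intermediate path from `a` over
  -- `bb τ` to `c` it is linear on both sides and equals `1` at the apex, so moving by `ψ` times a
  -- multiple of `d` carries such a path to another one.
  set ψ : E3 → ℝ := fun x => A (x - a) + 2 * min (1 - A (x - a) - B (x - a)) (B (x - a))
  have hψT : ∀ s t : ℝ, ψ (a + s • (b - a) + t • (c - a)) = s + 2 * min (1 - s - t) t := by
    intro s t
    have : a + s • (b - a) + t • (c - a) - a = s • (b - a) + t • (c - a) := by module
    simp only [ψ, this, map_add, map_smul, hAp, hAq, hBp, hBq, smul_eq_mul]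
    simp
  have hψa : ψ a = 0 := by simpa using hψT 0 0
  have hψc : ψ c = 0 := by simpa using hψT 0 1
  obtain ⟨C, hC0, hC⟩ : ∃ C : ℝ, 0 ≤ C ∧ ∀ x y, |ψ x - ψ y| ≤ C * dist x y := by
    refine ⟨‖A‖ + 2 * (‖A‖ + ‖B‖), by positivity, fun x y => ?_⟩
    have hA : |A (x - a) - A (y - a)| ≤ ‖A‖ * dist x y := by
      rw [← map_sub, dist_eq_norm, sub_sub_sub_cancel_right]; exact A.le_opNorm _
    have hB : |B (x - a) - B (y - a)| ≤ ‖B‖ * dist x y := by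
      rw [← map_sub, dist_eq_norm, sub_sub_sub_cancel_right]; exact B.le_opNorm _
    have h1 : |min (1 - A (x - a) - B (x - a)) (B (x - a)) -
        min (1 - A (y - a) - B (y - a)) (B (y - a))| ≤ (‖A‖ + ‖B‖) * dist x y := by
      refine (abs_min_sub_min_le_max _ _ _ _).trans (max_le ?_ ?_)
      · have : 1 - A (x - a) - B (x - a) - (1 - A (y - a) - B (y - a)) =
            -((A (x - a) - A (y - a)) + (B (x - a) - B (y - a))) := by ring
        rw [this, abs_neg]
        refine (abs_add_le _ _).trans ?_
        linarith
      · have : 0 ≤ ‖A‖ * dist x y := by positivity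
        linarith
    have h2 : ψ x - ψ y = (A (x - a) - A (y - a)) +
        2 * (min (1 - A (x - a) - B (x - a)) (B (x - a)) -
        min (1 - A (y - a) - B (y - a)) (B (y - a))) := by simp only [ψ]; ring
    rw [h2]
    refine (abs_add_le _ _).trans ?_
    rw [abs_mul, abs_of_pos (two_pos : (0 : ℝ) < 2)]
    nlinarith
  set T := triangle a b c
  set φ : E3 → ℝ := fun x => if x ∈ T then ψ x else 0
  have hφT : ∀ x ∈ T, φ x = ψ x := fun x hx => if_pos hx
  have hφR : ∀ x ∈ R, φ x = 0 := by
    intro x hx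
    by_cases hT : x ∈ T
    · rw [hφT x hT]
      rcases h ⟨hT, hx⟩ with h1 | h1
      · rw [h1, hψa]
      · rw [mem_singleton_iff.1 h1, hψc]
    · exact if_neg hT
  -- Extending `ψ` by `0` to `R` stays Lipschitz because `ψ` vanishes at `a` and `c`, and a point of
  -- the triangle is separated from `R` in proportion to its distance from them.
  have hTR : ∀ x ∈ T, ∀ y ∈ R, |ψ x| ≤ (C / m) * dist x y := by
    intro x hx y hy
    have h1 := hsep x hx y hy
    have h2 : |ψ x| ≤ C * min (dist x a) (dist x c) := by
      rw [mul_min_of_nonneg _ _ hC0]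
      refine le_min ?_ ?_
      · simpa [hψa] using hC x a
      · simpa [hψc] using hC x c
    rw [div_mul_eq_mul_div, le_div_iff₀ hm]
    nlinarith
  set K : NNReal := ⟨C + C / m, by positivity⟩
  have hKC : C ≤ K ∧ C / m ≤ K := by
    have : 0 ≤ C / m := by positivity
    have hKv : (K : ℝ) = C + C / m := rfl
    constructor <;> linarith
  have hlip : LipschitzOnWith K φ (T ∪ R) := by
    refine LipschitzOnWith.of_dist_le_mul fun x hx y hy => ?_
    rw [Real.dist_eq]
    rcases hx with hx | hx <;> rcases hy with hy | hy
    · rw [hφT x hx, hφT y hy]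
      exact (hC x y).trans (mul_le_mul_of_nonneg_right hKC.1 dist_nonneg)
    · rw [hφT x hx, hφR y hy, sub_zero]
      exact (hTR x hx y hy).trans (mul_le_mul_of_nonneg_right hKC.2 dist_nonneg)
    · rw [hφR x hx, hφT y hy, zero_sub, abs_neg, dist_comm]
      exact (hTR y hy x hx).trans (mul_le_mul_of_nonneg_right hKC.2 dist_nonneg)
    · rw [hφR x hx, hφR y hy, sub_self, abs_zero]
      positivity
  have h01 : ∀ x ∈ T ∪ R, φ x ∈ Icc (0 : ℝ) 1 := by
    rintro x (hx | hx)
    · rw [hφT x hx]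
      obtain ⟨s, t, hs, ht, hst, rfl⟩ := hx
      rw [hψT]
      rcases min_cases (1 - s - t) t with ⟨h1, h2⟩ | ⟨h1, h2⟩ <;> rw [h1] <;>
        constructor <;> linarith
    · rw [hφR x hx]; simp
  set d : E3 := (2⁻¹ : ℝ) • (a + c) - b
  -- The whole displacement may be too large for `ambientIsotopic_of_lipschitz`, so it is divided
  -- into `n` equal steps. The function `φ` is the same in all of them.
  obtain ⟨n, hn⟩ := exists_nat_gt (K * ‖d‖)
  have hn0 : (0 : ℝ) < n := lt_of_le_of_lt (by positivity) hn
  set bb : ℝ → E3 := fun τ => b + τ • d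
  set Q : ℝ → Set E3 := fun τ => R ∪ (segment ℝ a (bb τ) ∪ segment ℝ (bb τ) c)
  have hleft : ∀ τ ∈ Icc (0 : ℝ) 1, ∀ l ∈ Icc (0 : ℝ) 1, a + l • (bb τ - a) ∈ T ∧
      ψ (a + l • (bb τ - a)) = l := by
    intro τ hτ l hl
    have h1 : a + l • (bb τ - a) = a + (l * (1 - τ)) • (b - a) + (l * τ / 2) • (c - a) := by
      simp only [bb, d]; module
    have h2 : 0 ≤ l * (1 - τ) := mul_nonneg hl.1 (by linarith [hτ.2])
    have h3 : 0 ≤ l * τ := mul_nonneg hl.1 hτ.1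
    have h4 : l * τ ≤ l := mul_le_of_le_one_right hl.1 hτ.2
    rw [h1]
    refine ⟨⟨_, _, h2, by linarith, by linarith [hl.2], rfl⟩, ?_⟩
    rw [hψT, min_eq_right (by linarith [hl.2])]
    ring
  have hright : ∀ τ ∈ Icc (0 : ℝ) 1, ∀ l ∈ Icc (0 : ℝ) 1, c + l • (bb τ - c) ∈ T ∧
      ψ (c + l • (bb τ - c)) = l := by
    intro τ hτ l hl
    have h1 : c + l • (bb τ - c) =
        a + (l * (1 - τ)) • (b - a) + (1 - l + l * τ / 2) • (c - a) := by
      simp only [bb, d]; module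
    have h2 : 0 ≤ l * (1 - τ) := mul_nonneg hl.1 (by linarith [hτ.2])
    have h3 : 0 ≤ l * τ := mul_nonneg hl.1 hτ.1
    have h4 : l * τ ≤ l := mul_le_of_le_one_right hl.1 hτ.2
    rw [h1]
    refine ⟨⟨_, _, h2, by linarith [hl.2], by linarith [hl.2], rfl⟩, ?_⟩
    rw [hψT, min_eq_left (by linarith [hl.2])]
    ring
  have hQsub : ∀ τ ∈ Icc (0 : ℝ) 1, Q τ ⊆ T ∪ R := by
    rintro τ hτ x (hx | hx | hx)
    · exact Or.inr hx
    · rw [segment_eq_image'] at hx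
      obtain ⟨l, hl, rfl⟩ := hx
      exact Or.inl (hleft τ hτ l hl).1
    · rw [segment_symm, segment_eq_image'] at hx
      obtain ⟨l, hl, rfl⟩ := hx
      exact Or.inl (hright τ hτ l hl).1
  have hbd : Bornology.IsBounded (T ∪ R) :=
    ((isCompact_triangle a b c).union hR.isCompact).isBounded
  have hstep : ∀ τ ∈ Icc (0 : ℝ) 1,
      AmbientIsotopic (inSphere (Q τ)) (inSphere (Q (τ + (n : ℝ)⁻¹))) := by
    intro τ hτ
    have main := ambientIsotopic_of_lipschitz (hbd.subset (hQsub τ hτ))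
      (hlip.mono (hQsub τ hτ)) (fun x hx => h01 x (hQsub τ hτ hx)) ((n : ℝ)⁻¹ • d) (by
        rw [norm_smul, Real.norm_of_nonneg (by positivity), ← mul_assoc, mul_comm (K : ℝ),
          mul_assoc, inv_mul_lt_iff₀ hn0, mul_one]
        exact hn)
    convert main using 2
    have hb : ∀ (e : E3) (l : ℝ), e + l • (bb τ - e) + l • ((n : ℝ)⁻¹ • d) =
        e + l • (bb (τ + (n : ℝ)⁻¹) - e) := by
      intro e l
      simp only [bb]; module
    simp only [Q]
    rw [image_union, image_union]
    congr 1
    · refine (image_id R).symm.trans (image_congr fun x hx => ?_)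
      simp [hφR x hx]
    · congr 1
      · rw [segment_eq_image', segment_eq_image', image_image]
        refine image_congr fun l hl => ?_
        rw [hφT _ (hleft τ hτ l hl).1, (hleft τ hτ l hl).2, hb]
      · rw [segment_symm, segment_symm ℝ _ c, segment_eq_image', segment_eq_image', image_image]
        refine image_congr fun l hl => ?_
        rw [hφT _ (hright τ hτ l hl).1, (hright τ hτ l hl).2, hb]
  have hall : ∀ k : ℕ, k ≤ n → AmbientIsotopic (inSphere (Q 0)) (inSphere (Q (k * (n : ℝ)⁻¹))) := by
    intro k
    induction k with
    | zero => intro _; simpa using AmbientIsotopic.refl _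
    | succ k ih =>
      intro hk
      have h1 : (k : ℝ) * (n : ℝ)⁻¹ ∈ Icc (0 : ℝ) 1 := by
        refine ⟨by positivity, ?_⟩
        rw [mul_inv_le_iff₀ hn0, one_mul]
        exact_mod_cast (Nat.le_succ k).trans hk
      have := (ih (by omega)).trans (hstep _ h1)
      have e : ((k + 1 : ℕ) : ℝ) * (n : ℝ)⁻¹ = k * (n : ℝ)⁻¹ + (n : ℝ)⁻¹ := by push_cast; ring
      rwa [e]
  have hfin := hall n le_rfl
  rw [mul_inv_cancel₀ hn0.ne'] at hfin
  have e0 : Q 0 = R ∪ (segment ℝ a b ∪ segment ℝ b c) := by simp [Q, bb]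
  have e1 : Q 1 = R ∪ segment ℝ a c := by
    have hb1 : bb 1 = (2⁻¹ : ℝ) • a + (2⁻¹ : ℝ) • c := by simp only [bb, d]; module
    have hmem : bb 1 ∈ segment ℝ a c := ⟨2⁻¹, 2⁻¹, by norm_num, by norm_num, by norm_num, hb1.symm⟩
    simp only [Q]
    congr 1
    refine Subset.antisymm (union_subset ?_ ?_) fun x hx => ?_
    · exact (convex_segment a c).segment_subset (left_mem_segment ℝ a c) hmem
    · exact (convex_segment a c).segment_subset hmem (right_mem_segment ℝ a c)
    · rw [segment_symm ℝ a]
      exact mem_segment_split hmem hx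
  rwa [e0, e1] at hfin

/-! ### A normal form of knots -/

/-- The direction in which bands over polygons are spread. -/
def bandDir : E3 := !₂[0, 1, 0]

/-- A polygonal arc `k 0, …, k m` in the upper half space with its two endpoints on the first
coordinate axis, such that the translates of the arc along `bandDir` locally form a band. -/
structure BandArc (m : ℕ) (k : ℕ → E3) : Prop where
  two_le : 2 ≤ m
  first : k 0 = !₂[2, 0, 0]
  last : k m = !₂[-1, 0, 0]
  pos : ∀ i, 0 < i → i < m → 0 < k i 2
  cone : ∀ i, i + 1 < m → ∀ a b w : ℝ, 0 ≤ a → 0 ≤ b →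
    a • (k (i + 1) - k i) + b • (k (i + 2) - k (i + 1)) + w • bandDir = 0 → a = 0 ∧ b = 0 ∧ w = 0
  disj : ∀ i j, i + 1 < j → j < m →
    Disjoint (segment ℝ (k i) (k (i + 1))) (segment ℝ (k j) (k (j + 1)))

/-- The union of the edges of a polygonal arc. -/
def arcSet (m : ℕ) (k : ℕ → E3) : Set E3 := ⋃ i : Fin m, segment ℝ (k i) (k (i + 1))

/-- A polygonal arc together with the segment joining its endpoints. -/
def closedArc (m : ℕ) (k : ℕ → E3) : Set E3 := arcSet m k ∪ segment ℝ (k m) (k 0)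

/-- A linear functional which is nonzero on a given finite family of nonzero vectors. -/
theorem exists_inner_ne_zero {ι : Type*} [Finite ι] (w : ι → E3) (hw : ∀ i, w i ≠ 0) :
    ∃ v : E3, ∀ i, inner ℝ v (w i) ≠ 0 := by
  obtain ⟨f, hf⟩ := Module.exists_dual_forall_apply_ne_zero (K := ℝ) w hw
  refine ⟨(InnerProductSpace.toDual ℝ E3).symm (LinearMap.toContinuousLinearMap f), fun i => ?_⟩
  rw [InnerProductSpace.toDual_symm_apply]
  exact hf i

/-- A simple closed polygon, traversed from the lowest vertex for a generic height function. -/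
theorem exists_traversal {n : ℕ} {p : Fin (n + 3) → E3} (hp : IsSimplePolygon p) :
    ∃ (q : ℕ → E3) (v : E3), closedPolygon p = ⋃ j : Fin (n + 3), segment ℝ (q j) (q (j + 1)) ∧
      (∀ j, q (n + 3 + j) = q j) ∧
      (∀ j, segment ℝ (q j) (q (j + 1)) ∩ segment ℝ (q (j + 1)) (q (j + 2)) = {q (j + 1)}) ∧
      (∀ i j, i + 1 < j → j < n + 3 → ¬ (i = 0 ∧ j = n + 2) →
        Disjoint (segment ℝ (q i) (q (i + 1))) (segment ℝ (q j) (q (j + 1)))) ∧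
      (∀ j, 0 < j → j < n + 3 → inner ℝ v (q 0) < inner ℝ v (q j)) ∧
      (∀ j, inner ℝ v (q j) ≠ inner ℝ v (q (j + 1))) := by
  obtain ⟨h1, h2, h3⟩ := hp
  have hinj : ∀ i j, i ≠ j → p i - p j ≠ 0 := by
    intro i j hij h0
    have h0 := sub_eq_zero.1 h0
    by_cases hj : j = i + 1
    · subst hj; exact h1 i h0
    by_cases hi : i = j + 1
    · subst hi; exact h1 j h0.symm
    · exact Set.disjoint_left.1 (h3 i j hij.symm hj hi) (left_mem_segment ℝ _ _)
        (h0 ▸ left_mem_segment ℝ _ _)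
  -- A generic height function takes different values at all vertices, so the lowest vertex is
  -- unique and no edge is horizontal.
  obtain ⟨v, hv⟩ := exists_inner_ne_zero (fun x : {x : Fin (n + 3) × Fin (n + 3) // x.1 ≠ x.2} =>
    p x.1.1 - p x.1.2) fun x => hinj _ _ x.2
  have hv' : ∀ i j, i ≠ j → inner ℝ v (p i) ≠ inner ℝ v (p j) := fun i j hij h => by
    have := hv ⟨(i, j), hij⟩
    rw [inner_sub_right, h, sub_self] at this
    exact this rfl
  obtain ⟨i₀, hi₀⟩ := Finite.exists_min fun i => inner ℝ v (p i)
  set c : ℕ → Fin (n + 3) := fun j => Fin.ofNat (n + 3) j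
  have hval : ∀ j, (c j).val = j % (n + 3) := fun j => rfl
  have hsucc : ∀ j, c (j + 1) = c j + 1 := fun j => by
    apply Fin.ext
    rw [Fin.val_add, hval, hval, Fin.val_one, Nat.mod_add_mod]
  have hcast : ∀ a b : ℕ, a < n + 3 → b < n + 3 → c a = c b → a = b := by
    intro a b ha hb hab
    have := congrArg Fin.val hab
    rwa [hval, hval, Nat.mod_eq_of_lt ha, Nat.mod_eq_of_lt hb] at this
  have hper : ∀ j, c (n + 3 + j) = c j := fun j => by
    apply Fin.ext
    rw [hval, hval, Nat.add_mod_left]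
  have hlast : c (n + 3) = c 0 := hper 0
  clear_value c
  have hsucc' : ∀ j, i₀ + c (j + 1) = i₀ + c j + 1 := fun j => by rw [hsucc, add_assoc]
  have hc0 : c 0 = 0 := by
    have h := hlast
    apply Fin.ext
    rw [hval, Nat.zero_mod, Fin.val_zero]
  refine ⟨fun j => p (i₀ + c j), v, ?_, ?_, fun j => ?_, fun i j hij hj hne => ?_,
    fun j hj hjn => ?_, fun j => ?_⟩
  · rw [closedPolygon]
    simp only [hsucc']
    refine Subset.antisymm (iUnion_subset fun i => ?_) (iUnion_subset fun j => ?_)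
    · refine subset_iUnion_of_subset (i - i₀) ?_
      have : i₀ + c (i - i₀ : Fin (n + 3)) = i := by
        have : c (i - i₀ : Fin (n + 3)) = i - i₀ := by
          apply Fin.ext
          rw [hval, Nat.mod_eq_of_lt (Fin.is_lt _)]
        rw [this, add_sub_cancel]
      rw [this]
    · exact subset_iUnion (fun i => segment ℝ (p i) (p (i + 1))) (i₀ + c j)
  · simp only [hper, implies_true]
  · simp only [hsucc']
    exact h2 _
  · simp only [hsucc']
    refine h3 _ _ (fun h => ?_) (fun h => ?_) (fun h => ?_)
    · have := hcast _ _ hj (by omega) (add_left_cancel h)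
      omega
    · rw [← hsucc'] at h
      have := hcast j (i + 1) hj (by omega) (add_left_cancel h)
      omega
    · rw [← hsucc'] at h
      have h := add_left_cancel h
      rcases Nat.lt_or_ge (j + 1) (n + 3) with hlt | hge
      · have := hcast i (j + 1) (by omega) hlt h
        omega
      · have hj' : j = n + 2 := by omega
        subst hj'
        rw [hlast] at h
        exact hne ⟨hcast i 0 (by omega) (by omega) h, rfl⟩
  · dsimp only
    rw [hc0, add_zero]
    refine lt_of_le_of_ne (hi₀ _) (hv' _ _ fun h => ?_)
    have h : c j = c 0 := by rw [hc0]; exact (left_eq_add.1 h)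
    have := hcast j 0 hjn (by omega) h
    omega
  · simp only [hsucc']
    refine hv' _ _ fun h => ?_
    exact h1 _ (congrArg p h)

/-- A nontrivial relation would make the two edges leave `y` in the same direction and so share
points other than `y`. Dividing by `a + b + 1` keeps the common point on both edges. -/
theorem no_backtrack {x y z : E3} (h : segment ℝ x y ∩ segment ℝ y z = {y}) (hxy : x ≠ y)
    (hyz : y ≠ z) {a b : ℝ} (ha : 0 ≤ a) (hb : 0 ≤ b) (h0 : a • (y - x) + b • (z - y) = 0) :
    a = 0 ∧ b = 0 := by
  have hpos : 0 < a + b + 1 := by positivity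
  have e1 : y + (a / (a + b + 1)) • (x - y) ∈ segment ℝ x y := by
    rw [segment_symm, segment_eq_image']
    exact ⟨_, ⟨by positivity, (div_le_one hpos).2 (by linarith)⟩, rfl⟩
  have e2 : y + (a / (a + b + 1)) • (x - y) = y + (b / (a + b + 1)) • (z - y) := by
    rw [div_eq_inv_mul, div_eq_inv_mul, mul_smul, mul_smul]
    congr 2
    rw [← sub_eq_zero, ← neg_eq_zero, ← h0]
    module
  have e3 : y + (a / (a + b + 1)) • (x - y) ∈ segment ℝ y z := by
    rw [e2, segment_eq_image']
    exact ⟨_, ⟨by positivity, (div_le_one hpos).2 (by linarith)⟩, rfl⟩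
  have e4 : y + (a / (a + b + 1)) • (x - y) = y := by
    have : y + (a / (a + b + 1)) • (x - y) ∈ ({y} : Set E3) := h ▸ ⟨e1, e3⟩
    exact this
  have e5 := e4
  rw [e2] at e5
  rw [add_eq_left, smul_eq_zero, div_eq_zero_iff, sub_eq_zero] at e4 e5
  constructor
  · rcases e4 with (h | h) | h
    · exact h
    · linarith
    · exact absurd h hxy
  · rcases e5 with (h | h) | h
    · exact h
    · linarith
    · exact absurd h.symm hyz

theorem inner_segment (v : E3) {x y z : E3} (h : z ∈ segment ℝ x y) :
    ∃ s ∈ Icc (0 : ℝ) 1, z = x + s • (y - x) ∧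
      inner ℝ v z = (1 - s) * inner ℝ v x + s * inner ℝ v y := by
  rw [segment_eq_image'] at h
  obtain ⟨s, hs, rfl⟩ := h
  refine ⟨s, hs, rfl, ?_⟩
  simp only [inner_add_right, inner_smul_right, inner_sub_right]
  ring

/-- An arc whose vertices lie above a level, its endpoints being on that level. -/
theorem arc_above {v : E3} {m : ℕ} {k : ℕ → E3} {c : ℝ} (h0 : inner ℝ v (k 0) = c)
    (hm : inner ℝ v (k m) = c) (hpos : ∀ i, 0 < i → i < m → c < inner ℝ v (k i)) (h2 : 2 ≤ m)
    {x : E3} (hx : x ∈ arcSet m k) :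
    c ≤ inner ℝ v x ∧ (inner ℝ v x = c → x = k 0 ∨ x = k m) := by
  obtain ⟨⟨i, hi⟩, hx⟩ := mem_iUnion.1 hx
  obtain ⟨s, hs, rfl, hv⟩ := inner_segment v hx
  dsimp only at hv ⊢
  rw [hv]
  rcases Nat.eq_zero_or_pos i with rfl | hi0
  · have h1 := hpos 1 one_pos (by omega)
    rw [h0]
    refine ⟨by nlinarith [hs.1, hs.2], fun h => Or.inl ?_⟩
    have : s = 0 := by nlinarith [hs.1, hs.2]
    simp [this]
  · have h1 := hpos i hi0 hi
    rcases Nat.lt_or_ge (i + 1) m with hlt | hge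
    · have h3 := hpos (i + 1) (by omega) hlt
      have : c < (1 - s) * inner ℝ v (k i) + s * inner ℝ v (k (i + 1)) := by
        nlinarith [hs.1, hs.2, mul_nonneg hs.1 (sub_nonneg.2 h3.le),
          mul_nonneg (sub_nonneg.2 hs.2) (sub_nonneg.2 h1.le)]
      exact ⟨this.le, fun h => absurd h this.ne'⟩
    · obtain rfl : m = i + 1 := by omega
      rw [hm]
      refine ⟨by nlinarith [hs.1, hs.2], fun h => Or.inr ?_⟩
      have : s = 1 := by nlinarith [hs.1, hs.2]
      simp [this]

theorem isSegmentUnion_arcSet (m : ℕ) (k : ℕ → E3) : IsSegmentUnion (arcSet m k) :=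
  .iUnion fun _ => isSegmentUnion_segment _ _

/-- Cutting off the lowest vertex of a polygon. -/
theorem exists_cut {n : ℕ} {p : Fin (n + 3) → E3} (hp : IsSimplePolygon p) :
    ∃ (m : ℕ) (k : ℕ → E3) (v : E3) (c : ℝ), 2 ≤ m ∧ inner ℝ v (k 0) = c ∧ inner ℝ v (k m) = c ∧
      (∀ i, 0 < i → i < m → c < inner ℝ v (k i)) ∧ k 0 ≠ k m ∧
      (∀ i, i < m → inner ℝ v (k i) ≠ inner ℝ v (k (i + 1))) ∧
      (∀ i, i + 1 < m → ∀ a b : ℝ, 0 ≤ a → 0 ≤ b →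
        a • (k (i + 1) - k i) + b • (k (i + 2) - k (i + 1)) = 0 → a = 0 ∧ b = 0) ∧
      (∀ i j, i + 1 < j → j < m →
        Disjoint (segment ℝ (k i) (k (i + 1))) (segment ℝ (k j) (k (j + 1)))) ∧
      AmbientIsotopic (inSphere (closedPolygon p)) (inSphere (closedArc m k)) := by
  obtain ⟨q, v, hset, hper, hadj, hdisj, hlow, hstep⟩ := exists_traversal hp
  have hqN : q (n + 3) = q 0 := hper 0
  have hqne : ∀ j, q j ≠ q (j + 1) := fun j h => hstep j (by rw [h])
  obtain ⟨gap, hgap, hgapq⟩ := exists_common_pos (ι := Fin (n + 3))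
    (P := fun j g => 0 < (j : ℕ) → g ≤ inner ℝ v (q j) - inner ℝ v (q 0))
    (fun j g g' _ hg h hj => hg.trans (h hj))
    (fun j => by
      rcases Nat.eq_zero_or_pos j with h | h
      · exact ⟨1, one_pos, fun h' => absurd h' (by omega)⟩
      · exact ⟨_, sub_pos.2 (hlow j h j.2), fun _ => le_rfl⟩)
  have hgapq : ∀ j, 0 < j → j < n + 3 → gap ≤ inner ℝ v (q j) - inner ℝ v (q 0) :=
    fun j h0 hj => hgapq ⟨j, hj⟩ h0
  -- The horizontal plane at height `η` above the lowest vertex passes below all the other vertices,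
  -- so it cuts exactly the two edges at `q 0`.
  set η := gap / 2
  have hη : 0 < η := by positivity
  have hηg : η < gap := half_lt_self hgap
  have hθ : ∀ j, 0 < j → j < n + 3 → ∃ θ : ℝ, 0 < θ ∧ θ < 1 ∧
      inner ℝ v (q 0 + θ • (q j - q 0)) = inner ℝ v (q 0) + η := by
    intro j h0 hj
    have h1 := hgapq j h0 hj
    have h2 : 0 < inner ℝ v (q j) - inner ℝ v (q 0) := by linarith
    refine ⟨η / (inner ℝ v (q j) - inner ℝ v (q 0)), by positivity,
      (div_lt_one h2).2 (by linarith), ?_⟩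
    rw [inner_add_right, inner_smul_right, inner_sub_right, div_mul_cancel₀ _ h2.ne']
  obtain ⟨θ₁, hθ₁, hθ₁', hv₁⟩ := hθ 1 one_pos (by omega)
  obtain ⟨θ₂, hθ₂, hθ₂', hv₂⟩ := hθ (n + 2) (by omega) (by omega)
  set c' := q 0 + θ₁ • (q 1 - q 0)
  set a' := q 0 + θ₂ • (q (n + 2) - q 0)
  set k : ℕ → E3 := fun i => if i = 0 then c' else if i = n + 3 then a' else q i
  have hk0 : k 0 = c' := if_pos rfl
  have hkm : k (n + 3) = a' := by simp [k]
  have hkq : ∀ i, 0 < i → i < n + 3 → k i = q i := fun i h0 hi => by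
    simp only [k]
    rw [if_neg (by omega), if_neg (by omega)]
  have hstep' : ∀ i, i < n + 3 → ∃ l : ℝ, 0 < l ∧ k (i + 1) - k i = l • (q (i + 1) - q i) := by
    intro i hi
    rcases Nat.eq_zero_or_pos i with rfl | hi0
    · refine ⟨1 - θ₁, by linarith, ?_⟩
      rw [hkq 1 one_pos (by omega), hk0]
      simp only [c']; module
    · rcases Nat.lt_or_ge (i + 1) (n + 3) with hlt | hge
      · exact ⟨1, one_pos, by rw [hkq _ hi0 hi, hkq _ (by omega) hlt, one_smul]⟩
      · obtain rfl : i = n + 2 := by omega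
        refine ⟨1 - θ₂, by linarith, ?_⟩
        rw [hkq _ hi0 hi, hkm, hqN]
        simp only [a']; module
  have hc'seg : c' ∈ segment ℝ (q 0) (q 1) := by
    rw [segment_eq_image']; exact ⟨θ₁, ⟨hθ₁.le, hθ₁'.le⟩, rfl⟩
  have ha'seg : a' ∈ segment ℝ (q (n + 2)) (q 0) := by
    rw [segment_symm, segment_eq_image']; exact ⟨θ₂, ⟨hθ₂.le, hθ₂'.le⟩, rfl⟩
  have hsub : ∀ i, i < n + 3 → segment ℝ (k i) (k (i + 1)) ⊆ segment ℝ (q i) (q (i + 1)) := by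
    intro i hi
    refine (convex_segment _ _).segment_subset ?_ ?_
    · rcases Nat.eq_zero_or_pos i with rfl | hi0
      · rw [hk0]; exact hc'seg
      · rw [hkq _ hi0 hi]; exact left_mem_segment ℝ _ _
    · rcases Nat.lt_or_ge (i + 1) (n + 3) with hlt | hge
      · rw [hkq _ (by omega) hlt]; exact right_mem_segment ℝ _ _
      · obtain rfl : i = n + 2 := by omega
        rw [hkm, hqN]; exact ha'seg
  have habove : ∀ i, 0 < i → i < n + 3 → inner ℝ v (q 0) + η < inner ℝ v (k i) := by
    intro i h0 hi
    rw [hkq i h0 hi]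
    linarith [hgapq i h0 hi]
  have harc : ∀ x ∈ arcSet (n + 3) k, _ := fun x hx =>
    arc_above (v := v) (c := inner ℝ v (q 0) + η) (by rw [hk0]; exact hv₁) (by rw [hkm]; exact hv₂)
      habove (by omega) hx
  have hq0 : ∀ i, i < n + 3 → q 0 ∉ segment ℝ (k i) (k (i + 1)) := by
    intro i hi h
    have := (harc (q 0) (mem_iUnion.2 ⟨⟨i, hi⟩, h⟩)).1
    linarith
  have hlastadj : segment ℝ (q (n + 2)) (q 0) ∩ segment ℝ (q 0) (q 1) ⊆ {q 0} := by
    have h := hadj (n + 2)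
    rw [show n + 2 + 2 = n + 3 + 1 by omega, show n + 2 + 1 = n + 3 by omega, hqN, hper] at h
    exact h.subset
  have hne : c' ≠ a' := by
    intro h
    have h1 : c' ∈ ({q 0} : Set E3) := hlastadj ⟨h ▸ ha'seg, hc'seg⟩
    rw [mem_singleton_iff] at h1
    rw [h1] at hv₁
    linarith
  refine ⟨n + 3, k, v, inner ℝ v (q 0) + η, by omega, by rw [hk0]; exact hv₁,
    by rw [hkm]; exact hv₂, habove, by rwa [hk0, hkm], fun i hi h => ?_,
    fun i hi a b ha hb h0 => ?_, fun i j hij hj => ?_, ?_⟩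
  · obtain ⟨l, hl, hkl⟩ := hstep' i hi
    have h1 := congrArg (inner ℝ v) hkl
    rw [inner_sub_right, h, sub_self, inner_smul_right, inner_sub_right] at h1
    rcases mul_eq_zero.1 h1.symm with h2 | h2
    · exact hl.ne' h2
    · exact hstep i (sub_eq_zero.1 h2).symm
  · obtain ⟨l, hl, hkl⟩ := hstep' i (by omega)
    obtain ⟨l', hl', hkl'⟩ := hstep' (i + 1) hi
    rw [hkl, hkl', smul_smul, smul_smul] at h0
    obtain ⟨h1, h2⟩ := no_backtrack (hadj i) (hqne i) (hqne (i + 1)) (by positivity)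
      (by positivity) h0
    exact ⟨(mul_eq_zero.1 h1).resolve_right hl.ne', (mul_eq_zero.1 h2).resolve_right hl'.ne'⟩
  · rw [Set.disjoint_left]
    intro x hx hx'
    have h1 := hsub i (by omega) hx
    have h2 := hsub j hj hx'
    by_cases h : i = 0 ∧ j = n + 2
    · obtain ⟨rfl, rfl⟩ := h
      rw [hqN] at h2
      have h3 : x ∈ ({q 0} : Set E3) := hlastadj ⟨h2, h1⟩
      rw [mem_singleton_iff] at h3
      subst h3
      exact hq0 0 (by omega) hx
    · exact Set.disjoint_left.1 (hdisj i j hij hj h) h1 h2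
  -- The triangle that is cut off lies on or below the plane and the remaining arc on or above it,
  -- so they meet only in `a'` and `c'`.
  · have hT : triangle a' (q 0) c' ∩ arcSet (n + 3) k ⊆ {a', c'} := by
      rintro x ⟨⟨s, t, hs, ht, hst, hx⟩, hxa⟩
      have h1 := harc x hxa
      have h2 : inner ℝ v x ≤ inner ℝ v (q 0) + η := by
        rw [hx, inner_add_right, inner_add_right, inner_smul_right, inner_smul_right,
          inner_sub_right, inner_sub_right, hv₁, hv₂]
        nlinarith
      rcases h1.2 (le_antisymm h2 h1.1) with h | h
      · right; rw [h, hk0]; rfl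
      · left; rw [h, hkm]
    have hLI : ∀ s t : ℝ, s • (q 0 - a') + t • (c' - a') = 0 → s = 0 ∧ t = 0 := by
      intro s t h
      have h1 := congrArg (inner ℝ v) h
      rw [inner_add_right, inner_smul_right, inner_smul_right, inner_sub_right, inner_sub_right,
        hv₁, hv₂, inner_zero_right] at h1
      have hs : s = 0 := by
        have : s * η = 0 := by linarith
        exact (mul_eq_zero.1 this).resolve_right hη.ne'
      subst hs
      rw [zero_smul, zero_add, smul_eq_zero, sub_eq_zero] at h
      exact ⟨rfl, h.resolve_right hne⟩
    have main := ambientIsotopic_triangle_move (isSegmentUnion_arcSet (n + 3) k) hLI hT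
    have e1 : arcSet (n + 3) k ∪ (segment ℝ a' (q 0) ∪ segment ℝ (q 0) c') = closedPolygon p := by
      rw [hset]
      refine Subset.antisymm (union_subset (iUnion_subset fun i => ?_)
        (union_subset ?_ ?_)) (iUnion_subset fun j => ?_)
      · exact subset_iUnion_of_subset i (hsub i i.2)
      · refine subset_iUnion_of_subset ⟨n + 2, by omega⟩ ?_
        dsimp only
        rw [hqN]
        exact (convex_segment _ _).segment_subset ha'seg (right_mem_segment ℝ _ _)
      · refine subset_iUnion_of_subset ⟨0, by omega⟩ ?_
        exact (convex_segment _ _).segment_subset (left_mem_segment ℝ _ _) hc'seg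
      · intro x hx
        obtain ⟨j, hj⟩ := j
        dsimp only at hx
        rcases Nat.eq_zero_or_pos j with rfl | hj0
        · rcases mem_segment_split hc'seg hx with h | h
          · exact Or.inr (Or.inr (by rwa [segment_symm]))
          · refine Or.inl (mem_iUnion.2 ⟨⟨0, hj⟩, ?_⟩)
            dsimp only
            rwa [hk0, hkq 1 one_pos (by omega)]
        · rcases Nat.lt_or_ge (j + 1) (n + 3) with hlt | hge
          · refine Or.inl (mem_iUnion.2 ⟨⟨j, hj⟩, ?_⟩)
            dsimp only
            rwa [hkq _ hj0 hj, hkq _ (by omega) hlt]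
          · obtain rfl : j = n + 2 := by omega
            rw [hqN] at hx
            rcases mem_segment_split ha'seg hx with h | h
            · refine Or.inl (mem_iUnion.2 ⟨⟨n + 2, hj⟩, ?_⟩)
              dsimp only
              rwa [hkm, hkq _ hj0 hj, segment_symm]
            · exact Or.inr (Or.inl h)
    have e2 : arcSet (n + 3) k ∪ segment ℝ a' c' = closedArc (n + 3) k := by
      rw [closedArc, hk0, hkm]
    rwa [e1, e2] at main

theorem affMap_sub (M : Matrix (Fin 3) (Fin 3) ℝ) (b x y : E3) :
    affMap M b x - affMap M b y = Matrix.toEuclideanLin M (x - y) := by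
  rw [map_sub]
  simp [affMap, Matrix.toLpLin_apply]

/-- `affMap` as an affine map. -/
def affMapₐ (M : Matrix (Fin 3) (Fin 3) ℝ) (b : E3) : E3 →ᵃ[ℝ] E3 where
  toFun := affMap M b
  linear := Matrix.toEuclideanLin M
  map_vadd' p v := by
    have := affMap_sub M b (v + p) p
    rw [add_sub_cancel_right] at this
    exact sub_eq_iff_eq_add.1 this

theorem affMap_image_segment (M : Matrix (Fin 3) (Fin 3) ℝ) (b x y : E3) :
    affMap M b '' segment ℝ x y = segment ℝ (affMap M b x) (affMap M b y) :=
  image_segment ℝ (affMapₐ M b) x y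

theorem affMap_image_closedArc (M : Matrix (Fin 3) (Fin 3) ℝ) (b : E3) (m : ℕ) (k : ℕ → E3) :
    affMap M b '' closedArc m k = closedArc m fun i => affMap M b (k i) := by
  simp only [closedArc, arcSet, image_union, image_iUnion, affMap_image_segment]

/-- Every knot is ambient isotopic to a closed polygonal arc in normal form. -/
theorem exists_bandArc {K : Set S3} (hK : IsKnot K) :
    ∃ (m : ℕ) (k : ℕ → E3), BandArc m k ∧ AmbientIsotopic (inSphere (closedArc m k)) K := by
  obtain ⟨n, p, hp, hpK⟩ := hK
  obtain ⟨m, k, v, c, hm, h0, hlast, habove, hne, hstep, hcone, hdisj, hiso⟩ := exists_cut hp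
  set g : E3 := k 0 - k m
  have hg0 : g ≠ 0 := sub_ne_zero.2 hne
  have hvg : inner ℝ v g = 0 := by simp only [g, inner_sub_right, h0, hlast, sub_self]
  have hv0 : v ≠ 0 := by
    rintro rfl
    exact hstep 0 (by omega) (by simp)
  have hinner : ∀ x y : E3, inner ℝ x y = x 0 * y 0 + x 1 * y 1 + x 2 * y 2 := fun x y => by
    simp [PiLp.inner_apply, Fin.sum_univ_three]; ring
  -- The cross product of `v` and `g`: with `g` it spans the horizontal plane in which the direction
  -- of the band is chosen.
  set b₁ : E3 := !₂[v 1 * g 2 - v 2 * g 1, v 2 * g 0 - v 0 * g 2, v 0 * g 1 - v 1 * g 0]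
  have hvb : inner ℝ v b₁ = 0 := by rw [hinner]; simp [b₁]; ring
  have hbg : inner ℝ b₁ g = 0 := by rw [hinner]; simp [b₁]; ring
  have hvg' := hvg
  rw [hinner] at hvg'
  have hvv : 0 < v 0 ^ 2 + v 1 ^ 2 + v 2 ^ 2 := by
    have : 0 < inner ℝ v v := real_inner_self_pos.2 hv0
    rw [hinner] at this
    linarith
  have hgg : 0 < g 0 ^ 2 + g 1 ^ 2 + g 2 ^ 2 := by
    have : 0 < inner ℝ g g := real_inner_self_pos.2 hg0
    rw [hinner] at this
    linarith
  have hlag : b₁ 0 ^ 2 + b₁ 1 ^ 2 + b₁ 2 ^ 2 =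
      (v 0 ^ 2 + v 1 ^ 2 + v 2 ^ 2) * (g 0 ^ 2 + g 1 ^ 2 + g 2 ^ 2) -
        (v 0 * g 0 + v 1 * g 1 + v 2 * g 2) ^ 2 := by
    simp [b₁]; ring
  have hb0 : 0 < inner ℝ b₁ b₁ := by
    rw [hinner]
    rw [hvg'] at hlag
    nlinarith [mul_pos hvv hgg]
  set e : ℕ → E3 := fun i => k (i + 1) - k i
  set w : ℕ → E3 := fun i => inner ℝ v (e (i + 1)) • e i - inner ℝ v (e i) • e (i + 1)
  -- When two consecutive edges are independent, `w i` spans the horizontal direction in their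
  -- plane. The direction of the band must avoid these lines, and each of them excludes at most one
  -- `s`, since the component along `b₁` is fixed.
  obtain ⟨s, hs⟩ : ∃ s : ℝ, ∀ i : Fin m, ∀ t : ℝ, b₁ + s • g ≠ t • w i := by
    have hfin : (⋃ i : Fin m, {s : ℝ | ∃ t : ℝ, b₁ + s • g = t • w i}).Finite := by
      refine finite_iUnion fun i => Set.Subsingleton.finite ?_
      rintro s ⟨t, ht⟩ s' ⟨t', ht'⟩
      have h1 : t' • (b₁ + s • g) = t • (b₁ + s' • g) := by rw [ht, ht', smul_comm]
      have h2 := congrArg (inner ℝ b₁) h1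
      simp only [inner_smul_right, inner_add_right, hbg, mul_zero, add_zero] at h2
      have h3 : t' = t := mul_right_cancel₀ hb0.ne' h2
      subst h3
      have ht0 : t' ≠ 0 := by
        rintro rfl
        rw [zero_smul] at ht
        have h4 := congrArg (inner ℝ b₁) ht
        rw [inner_add_right, inner_smul_right, hbg, mul_zero, add_zero, inner_zero_right] at h4
        exact hb0.ne' h4
      have h4 := smul_right_injective E3 ht0 h1
      have h5 := smul_left_injective ℝ hg0 (add_left_cancel h4)
      exact h5
    obtain ⟨s, hs⟩ := hfin.infinite_compl.nonempty
    refine ⟨s, fun i t h => hs (mem_iUnion.2 ⟨i, t, h⟩)⟩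
  set d : E3 := b₁ + s • g
  have hvd : inner ℝ v d = 0 := by
    simp only [d, inner_add_right, inner_smul_right, hvb, hvg, mul_zero, add_zero]
  -- The columns send the closing segment to a multiple of `g`, `bandDir` to `d` and the vertical
  -- direction to `v`. The factor `1 / 3` accounts for the closing segment having length `3`. The
  -- determinant is positive for every `s`, as `d` differs from `v × g` by a multiple of `g`.
  set N : Matrix (Fin 3) (Fin 3) ℝ :=
    !![g 0 / 3, d 0, v 0; g 1 / 3, d 1, v 1; g 2 / 3, d 2, v 2]
  have hdet : N.det = ((v 0 ^ 2 + v 1 ^ 2 + v 2 ^ 2) * (g 0 ^ 2 + g 1 ^ 2 + g 2 ^ 2) -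
        (v 0 * g 0 + v 1 * g 1 + v 2 * g 2) ^ 2) / 3 := by
    simp [N, d, b₁, Matrix.det_fin_three]; ring
  have hdpos : 0 < N.det := by
    rw [hdet, hvg']
    have := mul_pos hvv hgg
    simp only [ne_eq, OfNat.ofNat_ne_zero, not_false_eq_true, zero_pow, sub_zero]
    positivity
  have hNN : N * N⁻¹ = 1 := Matrix.mul_nonsing_inv _ (isUnit_iff_ne_zero.2 hdpos.ne')
  have hL : ∀ y : E3, Matrix.toEuclideanLin N y = (y 0 / 3) • g + y 1 • d + y 2 • v := by
    intro y
    ext i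
    fin_cases i <;>
      simp [N, Matrix.toLpLin_apply, dotProduct, Fin.sum_univ_three] <;> ring
  have hinj : Function.Injective (Matrix.toEuclideanLin N) := by
    rw [← LinearMap.ker_eq_bot, LinearMap.ker_eq_bot']
    intro y hy
    have h1 : N.mulVec y.ofLp = 0 := by
      have := congrArg WithLp.ofLp hy
      simpa [Matrix.toLpLin_apply] using this
    have h2 := Matrix.eq_zero_of_mulVec_eq_zero hdpos.ne' h1
    ext i
    exact congrFun h2 i
  set b : E3 := k 0 - (2 / 3 : ℝ) • g
  have haff : ∀ y, affMap N b y = Matrix.toEuclideanLin N y + b := fun y => by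
    simp [affMap, Matrix.toLpLin_apply]
  set k' : ℕ → E3 := fun i => WithLp.toLp 2 (N⁻¹.mulVec (k i - b).ofLp)
  have hk' : ∀ i, affMap N b (k' i) = k i := fun i => by
    have : N.mulVec (N⁻¹.mulVec (k i - b).ofLp) = (k i - b).ofLp := by
      rw [Matrix.mulVec_mulVec, hNN, Matrix.one_mulVec]
    simp only [affMap, k']
    rw [this]
    simp
  have hk'L : ∀ i, Matrix.toEuclideanLin N (k' i) = k i - b := fun i => by
    rw [← hk' i, haff, add_sub_cancel_right]
  have hLband : Matrix.toEuclideanLin N bandDir = d := by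
    rw [hL]; simp [bandDir]
  refine ⟨m, k', ⟨hm, hinj ?_, hinj ?_, fun i hi him => ?_, fun i hi a b' w' ha hb h => ?_,
    fun i j hij hj => ?_⟩, ?_⟩
  · rw [hk'L, hL]
    simp only [b]
    simp
  · rw [hk'L, hL]
    simp only [b, g]
    simp
    module
  · have h1 := habove i hi him
    have h2 : inner ℝ v (k i - b) = k' i 2 * inner ℝ v v := by
      rw [← hk'L, hL, inner_add_right, inner_add_right, inner_smul_right, inner_smul_right,
        inner_smul_right, hvg, hvd]
      ring
    have h3 : inner ℝ v b = c := by
      simp only [b]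
      rw [inner_sub_right, inner_smul_right, hvg, h0, mul_zero, sub_zero]
    rw [inner_sub_right, h3] at h2
    have h4 : 0 < inner ℝ v v := real_inner_self_pos.2 hv0
    exact pos_of_mul_pos_left (by linarith : 0 < k' i 2 * inner ℝ v v) h4.le
  · have h1 := congrArg (Matrix.toEuclideanLin N) h
    rw [map_add, map_add, map_smul, map_smul, map_smul, map_sub, map_sub, hk'L, hk'L, hk'L,
      hLband, map_zero, sub_sub_sub_cancel_right, sub_sub_sub_cancel_right] at h1
    have hf := congrArg (inner ℝ v) h1
    rw [inner_add_right, inner_add_right, inner_smul_right, inner_smul_right, inner_smul_right,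
      hvd, inner_zero_right, mul_zero, add_zero] at hf
    change a * inner ℝ v (e i) + b' * inner ℝ v (e (i + 1)) = 0 at hf
    have hfe : inner ℝ v (e i) ≠ 0 := by
      simp only [e, inner_sub_right]
      exact sub_ne_zero.2 (hstep i (by omega)).symm
    -- Pairing the relation with `v` fixes the ratio of `a` and `b'`. A nonzero `w'` would make `d`
    -- a multiple of `w i`, against the choice of `s`.
    have hw' : w' = 0 := by
      by_contra hw'
      refine hs ⟨i, by omega⟩ (b' / (inner ℝ v (e i) * w')) ?_
      have h2 : w' • d = -(a • e i + b' • e (i + 1)) := by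
        rw [eq_neg_iff_add_eq_zero, add_comm]; exact h1
      have h3 : d = w'⁻¹ • (w' • d) := by rw [smul_smul, inv_mul_cancel₀ hw', one_smul]
      rw [h3, h2]
      have ha' : a = -(b' * inner ℝ v (e (i + 1)) / inner ℝ v (e i)) := by
        field_simp
        linarith
      have key : ∀ (E E' : E3) (x y : ℝ), x ≠ 0 → w'⁻¹ • -(-(b' * y / x) • E + b' • E') =
          (b' / (x * w')) • (y • E - x • E') := fun E E' x y hx => by
        match_scalars <;> field_simp
      rw [ha']
      exact key _ _ _ _ hfe
    subst hw'
    rw [zero_smul, add_zero] at h1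
    obtain ⟨h2, h3⟩ := hcone i hi a b' ha hb h1
    exact ⟨h2, h3, rfl⟩
  · rw [← Set.disjoint_image_iff (f := affMap N b) (fun x y hxy => hinj (by
      rw [haff, haff] at hxy; exact add_right_cancel hxy)), affMap_image_segment,
      affMap_image_segment, hk', hk', hk', hk']
    exact hdisj i j hij hj
  · have h1 := ambientIsotopic_affMap hdpos b (closedArc m k')
    rw [affMap_image_closedArc] at h1
    simp only [hk'] at h1
    exact h1.trans (hiso.symm.trans hpK)

/-! ### Metric comparison of bands over closed polygons -/

/-- The vertices `k 0, …, k m` of a polygonal arc, followed by `k 0`. -/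
def cyc (m : ℕ) (k : ℕ → E3) (i : ℕ) : E3 := if i ≤ m then k i else k 0

/-- The parametrization of the edge `i ≤ m` of the closed polygon through `k 0, …, k m`. -/
def edgePt (m : ℕ) (k : ℕ → E3) (i : ℕ) (s : ℝ) : E3 :=
  cyc m k i + s • (cyc m k (i + 1) - cyc m k i)

theorem cyc_of_le {m i : ℕ} (k : ℕ → E3) (h : i ≤ m) : cyc m k i = k i := if_pos h

theorem cyc_succ_self (m : ℕ) (k : ℕ → E3) : cyc m k (m + 1) = k 0 := if_neg (by omega)

theorem edgePt_of_lt {m i : ℕ} (k : ℕ → E3) (h : i < m) (s : ℝ) :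
    edgePt m k i s = k i + s • (k (i + 1) - k i) := by
  rw [edgePt, cyc_of_le k h.le, cyc_of_le k h]

theorem edgePt_self (m : ℕ) (k : ℕ → E3) (s : ℝ) :
    edgePt m k m s = k m + s • (k 0 - k m) := by
  rw [edgePt, cyc_of_le k le_rfl, cyc_succ_self]

theorem edgePt_mem_segment {m i : ℕ} {k : ℕ → E3} (h : i < m) {s : ℝ} (hs : s ∈ Icc (0 : ℝ) 1) :
    edgePt m k i s ∈ segment ℝ (k i) (k (i + 1)) := by
  rw [edgePt_of_lt k h, segment_eq_image']
  exact ⟨s, hs, rfl⟩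

namespace BandArc

variable {m : ℕ} {k : ℕ → E3}

theorem nonneg (hk : BandArc m k) {i : ℕ} (hi : i ≤ m) : 0 ≤ k i 2 := by
  rcases Nat.eq_zero_or_pos i with rfl | h0
  · simp [hk.first]
  rcases hi.eq_or_lt with rfl | h1
  · simp [hk.last]
  · exact (hk.pos i h0 h1).le

theorem cyc_nonneg (hk : BandArc m k) (i : ℕ) : 0 ≤ cyc m k i 2 := by
  unfold cyc
  split_ifs with h
  · exact hk.nonneg h
  · exact hk.nonneg (Nat.zero_le _)

theorem edgePt_apply (i : ℕ) (s : ℝ) (c : Fin 3) :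
    edgePt m k i s c = (1 - s) * cyc m k i c + s * cyc m k (i + 1) c := by
  simp [edgePt]; ring

theorem edgePt_nonneg (hk : BandArc m k) (i : ℕ) {s : ℝ} (hs : s ∈ Icc (0 : ℝ) 1) :
    0 ≤ edgePt m k i s 2 := by
  rw [edgePt_apply]
  have := hk.cyc_nonneg i
  have := hk.cyc_nonneg (i + 1)
  have := hs.1
  have : 0 ≤ 1 - s := sub_nonneg.2 hs.2
  positivity

theorem edgePt_closing (hk : BandArc m k) (s : ℝ) : edgePt m k m s = !₂[3 * s - 1, 0, 0] := by
  rw [edgePt_self, hk.first, hk.last]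
  ext c
  fin_cases c <;> simp
  ring

theorem edgePt_pos (hk : BandArc m k) {i : ℕ} (h0 : 0 < i) (h1 : i + 1 < m) {s : ℝ}
    (hs : s ∈ Icc (0 : ℝ) 1) : 0 < edgePt m k i s 2 := by
  rw [edgePt_apply, cyc_of_le k (by omega), cyc_of_le k (by omega)]
  have h2 := hk.pos i h0 (by omega)
  have h3 := hk.pos (i + 1) (by omega) h1
  rcases hs.2.lt_or_eq with h | rfl
  · have : 0 < (1 - s) * k i 2 := mul_pos (sub_pos.2 h) h2
    have : 0 ≤ s * k (i + 1) 2 := mul_nonneg hs.1 h3.le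
    linarith
  · simpa using h3

/-- The cone condition at all vertices of the closed polygon, except that between the closing edge
and the first edge. -/
theorem cone_cyc (hk : BandArc m k) {i : ℕ} (hi : i + 1 ≤ m) {a b w : ℝ} (ha : 0 ≤ a) (hb : 0 ≤ b)
    (h : a • (cyc m k (i + 1) - cyc m k i) + b • (cyc m k (i + 2) - cyc m k (i + 1)) +
      w • bandDir = 0) : a = 0 ∧ b = 0 ∧ w = 0 := by
  rcases hi.lt_or_eq with h1 | rfl
  · rw [cyc_of_le k (by omega), cyc_of_le k (by omega), cyc_of_le k (by omega)] at h
    exact hk.cone i h1 a b w ha hb h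
  · rw [cyc_succ_self, cyc_of_le k le_rfl, cyc_of_le k (by omega), hk.first, hk.last] at h
    have h0 := congrArg (fun v : E3 => v 0) h
    have h1 := congrArg (fun v : E3 => v 1) h
    have h2 := congrArg (fun v : E3 => v 2) h
    simp [bandDir] at h0 h1 h2
    have hp := hk.pos i (by have := hk.two_le; omega) (by omega)
    have ha0 : a = 0 := by rcases h2 with h2 | h2 <;> linarith
    subst ha0
    simp at h0 h1
    exact ⟨rfl, h0.resolve_right (by norm_num), h1⟩

/-- No signs are needed here: the closing edge is horizontal and transverse to `bandDir`, and the
first edge leaves the horizontal plane. -/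
theorem cone_zero (hk : BandArc m k) {a b w : ℝ}
    (h : a • (cyc m k (m + 1) - cyc m k m) + b • (cyc m k 1 - cyc m k 0) +
      w • bandDir = 0) : a = 0 ∧ b = 0 ∧ w = 0 := by
  have := hk.two_le
  rw [cyc_succ_self, cyc_of_le k le_rfl, cyc_of_le k (by omega), cyc_of_le k (by omega), hk.first,
    hk.last] at h
  have h0 := congrArg (fun v : E3 => v 0) h
  have h1 := congrArg (fun v : E3 => v 1) h
  have h2 := congrArg (fun v : E3 => v 2) h
  simp [bandDir] at h0 h1 h2
  have hp := hk.pos 1 (by omega) (by omega)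
  have hb0 : b = 0 := by rcases h2 with h2 | h2 <;> linarith
  subst hb0
  simp at h0 h1
  exact ⟨h0.resolve_right (by norm_num), rfl, h1⟩

theorem edge_cone (hk : BandArc m k) {i : ℕ} (hi : i ≤ m) {a w : ℝ} (ha : 0 ≤ a)
    (h : a • (cyc m k (i + 1) - cyc m k i) + w • bandDir = 0) : a = 0 ∧ w = 0 := by
  rcases hi.lt_or_eq with h1 | rfl
  · have := hk.cone_cyc h1 (w := w) ha le_rfl (by rw [← h]; module)
    exact ⟨this.1, this.2.2⟩
  · have := hk.cone_zero (a := a) (b := 0) (w := w) (by rw [← h]; module)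
    exact ⟨this.1, this.2.2⟩

end BandArc

/-- The model for the distance of two points of the edges `i ≤ j` of a closed polygon. -/
def modelDist (m i j : ℕ) (s t : ℝ) : ℝ :=
  if i = j then |s - t| else if j = i + 1 then (1 - s) + t
  else if i = 0 ∧ j = m then s + (1 - t) else 1

theorem modelDist_nonneg {m i j : ℕ} {s t : ℝ} (hs : s ∈ Icc (0 : ℝ) 1) (ht : t ∈ Icc (0 : ℝ) 1) :
    0 ≤ modelDist m i j s t := by
  obtain ⟨h1, h2⟩ := hs
  obtain ⟨h3, h4⟩ := ht
  unfold modelDist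
  split_ifs
  · positivity
  · linarith
  · linarith
  · norm_num

theorem norm_bandDir : ‖bandDir‖ = 1 := by
  simp [bandDir, EuclideanSpace.norm_eq, Fin.sum_univ_three]

/-- A version of `exists_cone_bound` with a coefficient of arbitrary sign. -/
theorem exists_cone_bound_signed {p q n : E3}
    (h : ∀ a b w : ℝ, 0 ≤ a → 0 ≤ b → a • p + b • q + w • n = 0 → a = 0 ∧ b = 0 ∧ w = 0) :
    ∃ c : ℝ, 0 < c ∧ ∀ a b w : ℝ, 0 ≤ a → 0 ≤ b → c * (a + b + |w|) ≤ ‖a • p + b • q + w • n‖ := by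
  obtain ⟨c₁, hc₁, h₁⟩ := exists_cone_bound (p := p) (q := q) (r := n)
    fun a b c ha hb _ h0 => h a b c ha hb h0
  obtain ⟨c₂, hc₂, h₂⟩ := exists_cone_bound (p := p) (q := q) (r := -n)
    fun a b c ha hb _ h0 => by
      obtain ⟨h1, h2, h3⟩ := h a b (-c) ha hb (by rw [← h0]; module)
      exact ⟨h1, h2, neg_eq_zero.1 h3⟩
  refine ⟨min c₁ c₂, lt_min hc₁ hc₂, fun a b w ha hb => ?_⟩
  rcases le_total 0 w with hw | hw
  · rw [abs_of_nonneg hw]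
    refine le_trans ?_ (h₁ a b w ha hb hw)
    gcongr
    exact min_le_left _ _
  · rw [abs_of_nonpos hw]
    refine le_trans ?_ ((h₂ a b (-w) ha hb (by linarith)).trans_eq ?_)
    · have : 0 ≤ a + b + -w := by linarith
      gcongr
      exact min_le_right _ _
    · congr 1
      module

namespace BandArc

variable {m : ℕ} {k : ℕ → E3}

/-- Distinct points of the closed polygon have positive distance, in a form for two edges. -/
theorem exists_lower_bound (hk : BandArc m k) {i j : ℕ} (hij : i ≤ j) (hj : j ≤ m) :
    ∃ c : ℝ, 0 < c ∧ ∀ s ∈ Icc (0 : ℝ) 1, ∀ t ∈ Icc (0 : ℝ) 1, ∀ w : ℝ, |w| ≤ c →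
      c * (modelDist m i j s t + |w|) ≤ ‖edgePt m k i s - edgePt m k j t + w • bandDir‖ := by
  have hm := hk.two_le
  by_cases h1 : i = j
  · subst h1
    obtain ⟨c, hc, h⟩ := exists_cone_bound_signed
      (p := cyc m k (i + 1) - cyc m k i) (q := cyc m k (i + 1) - cyc m k i) (n := bandDir)
      fun a b w ha hb h0 => by
        have := hk.edge_cone hj (a := a + b) (w := w) (by linarith) (by rw [← h0]; module)
        exact ⟨by linarith, by linarith, this.2⟩
    refine ⟨c, hc, fun s _ t _ w _ => ?_⟩
    simp only [modelDist, if_true]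
    rcases le_total t s with hst | hst
    · rw [abs_of_nonneg (sub_nonneg.2 hst)]
      refine ((h (s - t) 0 w (by linarith) le_rfl).trans_eq' (by ring)).trans_eq ?_
      congr 1
      simp only [edgePt]
      module
    · rw [abs_of_nonpos (sub_nonpos.2 hst), ← abs_neg w]
      refine ((h (t - s) 0 (-w) (by linarith) le_rfl).trans_eq' (by ring)).trans_eq ?_
      rw [← norm_neg]
      congr 1
      simp only [edgePt]
      module
  by_cases h2 : j = i + 1
  · subst h2
    obtain ⟨c, hc, h⟩ := exists_cone_bound_signed fun a b w ha hb h0 =>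
      hk.cone_cyc hj (a := a) (b := b) (w := w) ha hb h0
    refine ⟨c, hc, fun s hs t ht w _ => ?_⟩
    simp only [modelDist, if_neg h1, if_true]
    rw [← abs_neg w]
    refine (h (1 - s) t (-w) (by linarith [hs.2]) ht.1).trans_eq ?_
    rw [← norm_neg]
    congr 1
    simp only [edgePt]
    module
  by_cases h3 : i = 0 ∧ j = m
  · obtain ⟨c, hc, h⟩ := exists_cone_bound_signed fun a b w _ _ h0 =>
      hk.cone_zero (a := a) (b := b) (w := w) h0
    refine ⟨c, hc, fun s hs t ht w _ => ?_⟩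
    simp only [modelDist, if_neg h1, if_neg h2, if_pos h3]
    obtain ⟨rfl, rfl⟩ := h3
    refine ((h (1 - t) s w (by linarith [ht.2]) hs.1).trans_eq' (by ring)).trans_eq ?_
    congr 1
    simp only [edgePt, zero_add, cyc_succ_self, cyc_of_le k (Nat.zero_le _)]
    module
  -- For edges without a common vertex the model distance is `1`. A compactness bound at `w = 0`
  -- suffices, provided that `w` is small compared with it; this is the reason for the hypothesis
  -- `|w| ≤ c`.
  · have hne : ∀ x ∈ Icc (0 : ℝ) 1 ×ˢ Icc (0 : ℝ) 1,
        0 < ‖edgePt m k i x.1 - edgePt m k j x.2‖ := by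
      rintro ⟨s, t⟩ ⟨hs, ht⟩
      rw [norm_pos_iff, sub_ne_zero]
      intro he
      dsimp only at he hs ht
      rcases hj.lt_or_eq with h4 | rfl
      · exact Set.disjoint_left.1 (hk.disj i j (by omega) h4)
          (edgePt_mem_segment (by omega) hs) (he ▸ edgePt_mem_segment h4 ht)
      · have h5 := hk.edgePt_pos (i := i) (by omega) (by omega) hs
        rw [he, hk.edgePt_closing] at h5
        simp at h5
    have hcont : Continuous fun x : ℝ × ℝ => ‖edgePt m k i x.1 - edgePt m k j x.2‖ := by
      unfold edgePt; fun_prop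
    obtain ⟨x₀, hx₀, hmin⟩ := (isCompact_Icc.prod isCompact_Icc).exists_isMinOn
      (s := Icc (0 : ℝ) 1 ×ˢ Icc (0 : ℝ) 1) ⟨(0, 0), by simp⟩ hcont.continuousOn
    set d := ‖edgePt m k i x₀.1 - edgePt m k j x₀.2‖
    have hd : 0 < d := hne x₀ hx₀
    refine ⟨min 1 (d / 4), by positivity, fun s hs t ht w hw => ?_⟩
    simp only [modelDist, if_neg h1, if_neg h2, if_neg h3]
    have hd' : d ≤ ‖edgePt m k i s - edgePt m k j t‖ := hmin (a := (s, t)) ⟨hs, ht⟩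
    have hw1 : |w| ≤ 1 := hw.trans (min_le_left _ _)
    have hw2 : |w| ≤ d / 4 := hw.trans (min_le_right _ _)
    have htri : ‖edgePt m k i s - edgePt m k j t‖ ≤
        ‖edgePt m k i s - edgePt m k j t + w • bandDir‖ + |w| := by
      have := norm_sub_le (edgePt m k i s - edgePt m k j t + w • bandDir) (w • bandDir)
      rwa [add_sub_cancel_right, norm_smul, norm_bandDir, mul_one, Real.norm_eq_abs] at this
    have : min 1 (d / 4) * (1 + |w|) ≤ d / 4 * (1 + 1) := by
      gcongr
      exact min_le_right _ _
    linarith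

theorem exists_upper_bound (k : ℕ → E3) {i j : ℕ} (hij : i ≤ j) (hj : j ≤ m) :
    ∃ c : ℝ, 0 < c ∧ ∀ s ∈ Icc (0 : ℝ) 1, ∀ t ∈ Icc (0 : ℝ) 1, ∀ w : ℝ,
      c * ‖edgePt m k i s - edgePt m k j t + w • bandDir‖ ≤ modelDist m i j s t + |w| := by
  set D : ℝ := 1 + ‖cyc m k (i + 1) - cyc m k i‖ + ‖cyc m k (j + 1) - cyc m k j‖ +
    ‖cyc m k i - cyc m k j‖
  have hD : 1 ≤ D := by
    have : 0 ≤ ‖cyc m k (i + 1) - cyc m k i‖ + ‖cyc m k (j + 1) - cyc m k j‖ +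
      ‖cyc m k i - cyc m k j‖ := by positivity
    simp only [D]; linarith
  suffices h : ∀ s ∈ Icc (0 : ℝ) 1, ∀ t ∈ Icc (0 : ℝ) 1,
      ‖edgePt m k i s - edgePt m k j t‖ ≤ D * modelDist m i j s t by
    refine ⟨D⁻¹, by positivity, fun s hs t ht w => ?_⟩
    rw [inv_mul_le_iff₀ (by positivity)]
    calc _ ≤ ‖edgePt m k i s - edgePt m k j t‖ + ‖w • bandDir‖ := norm_add_le _ _
      _ ≤ D * modelDist m i j s t + D * |w| := by
        rw [norm_smul, norm_bandDir, mul_one, Real.norm_eq_abs]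
        exact add_le_add (h s hs t ht) (le_mul_of_one_le_left (abs_nonneg _) hD)
      _ = _ := by ring
  intro s hs t ht
  have e1 : ‖cyc m k (i + 1) - cyc m k i‖ ≤ D := by
    simp only [D]
    linarith [norm_nonneg (cyc m k (j + 1) - cyc m k j),
      norm_nonneg (cyc m k i - cyc m k j)]
  have e2 : ‖cyc m k (j + 1) - cyc m k j‖ ≤ D := by
    simp only [D]
    linarith [norm_nonneg (cyc m k (i + 1) - cyc m k i),
      norm_nonneg (cyc m k i - cyc m k j)]
  have key : ∀ (x y : E3) (a b : ℝ), 0 ≤ a → 0 ≤ b → ‖x‖ ≤ D → ‖y‖ ≤ D →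
      ‖a • x + b • y‖ ≤ D * (a + b) := fun x y a b ha hb hx hy => by
    refine (norm_add_le _ _).trans ?_
    rw [norm_smul, norm_smul, Real.norm_of_nonneg ha, Real.norm_of_nonneg hb]
    nlinarith
  unfold modelDist
  split_ifs with h1 h2 h3
  · subst h1
    have : edgePt m k i s - edgePt m k i t = (s - t) • (cyc m k (i + 1) - cyc m k i) := by
      simp only [edgePt]; module
    rw [this, norm_smul, mul_comm, Real.norm_eq_abs]
    gcongr
  · subst h2
    rw [← norm_neg]
    refine (key _ _ (1 - s) t (by linarith [hs.2]) ht.1 e1 e2).trans_eq' ?_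
    congr 1
    simp only [edgePt]; module
  · obtain ⟨rfl, rfl⟩ := h3
    refine (key _ _ s (1 - t) hs.1 (by linarith [ht.2]) e1 e2).trans_eq' ?_
    congr 1
    simp only [edgePt, zero_add, cyc_succ_self, cyc_of_le k (Nat.zero_le _)]; module
  · have : edgePt m k i s - edgePt m k j t = (cyc m k i - cyc m k j) +
        s • (cyc m k (i + 1) - cyc m k i) - t • (cyc m k (j + 1) - cyc m k j) := by
      simp only [edgePt]; module
    rw [this, mul_one]
    refine (norm_sub_le _ _).trans ((add_le_add_left (norm_add_le _ _) _).trans ?_)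
    rw [norm_smul, norm_smul, Real.norm_of_nonneg hs.1, Real.norm_of_nonneg ht.1]
    have := mul_le_of_le_one_left (norm_nonneg (cyc m k (i + 1) - cyc m k i)) hs.2
    have := mul_le_of_le_one_left (norm_nonneg (cyc m k (j + 1) - cyc m k j)) ht.2
    simp only [D]; linarith

/-- The band over a closed polygon in the direction `bandDir` is embedded. -/
theorem exists_band_lower (hk : BandArc m k) :
    ∃ c : ℝ, 0 < c ∧ ∀ i j, i ≤ j → j ≤ m → ∀ s ∈ Icc (0 : ℝ) 1, ∀ t ∈ Icc (0 : ℝ) 1, ∀ w : ℝ,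
      |w| ≤ c →
      c * (modelDist m i j s t + |w|) ≤ ‖edgePt m k i s - edgePt m k j t + w • bandDir‖ := by
  obtain ⟨c, hc, h⟩ := exists_common_pos (ι := {x : Fin (m + 1) × Fin (m + 1) // x.1 ≤ x.2})
    (P := fun x c => ∀ s ∈ Icc (0 : ℝ) 1, ∀ t ∈ Icc (0 : ℝ) 1, ∀ w : ℝ, |w| ≤ c →
      c * (modelDist m x.1.1 x.1.2 s t + |w|) ≤
        ‖edgePt m k x.1.1 s - edgePt m k x.1.2 t + w • bandDir‖)
    (fun x c c' _ hcc h s hs t ht w hw => le_trans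
      (mul_le_mul_of_nonneg_right hcc (add_nonneg (modelDist_nonneg hs ht) (abs_nonneg _)))
      (h s hs t ht w (hw.trans hcc)))
    (fun x => hk.exists_lower_bound x.2 (Nat.lt_succ_iff.1 x.1.2.2))
  exact ⟨c, hc, fun i j hij hj => h ⟨(⟨i, by omega⟩, ⟨j, by omega⟩), hij⟩⟩

theorem exists_band_upper (m : ℕ) (k : ℕ → E3) :
    ∃ c : ℝ, 0 < c ∧ ∀ i j, i ≤ j → j ≤ m → ∀ s ∈ Icc (0 : ℝ) 1, ∀ t ∈ Icc (0 : ℝ) 1, ∀ w : ℝ,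
      c * ‖edgePt m k i s - edgePt m k j t + w • bandDir‖ ≤ modelDist m i j s t + |w| := by
  obtain ⟨c, hc, h⟩ := exists_common_pos (ι := {x : Fin (m + 1) × Fin (m + 1) // x.1 ≤ x.2})
    (P := fun x c => ∀ s ∈ Icc (0 : ℝ) 1, ∀ t ∈ Icc (0 : ℝ) 1, ∀ w : ℝ,
      c * ‖edgePt m k x.1.1 s - edgePt m k x.1.2 t + w • bandDir‖ ≤
        modelDist m x.1.1 x.1.2 s t + |w|)
    (fun x c c' _ hcc h s hs t ht w => le_trans
      (mul_le_mul_of_nonneg_right hcc (norm_nonneg _)) (h s hs t ht w))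
    (fun x => exists_upper_bound k x.2 (Nat.lt_succ_iff.1 x.1.2.2))
  exact ⟨c, hc, fun i j hij hj => h ⟨(⟨i, by omega⟩, ⟨j, by omega⟩), hij⟩⟩

/-- The bands over two closed polygons with the same number of edges are bi-Lipschitz
equivalent. -/
theorem exists_band_compare (hk : BandArc m k) (k' : ℕ → E3) :
    ∃ M c : ℝ, 0 < M ∧ 0 < c ∧ ∀ i j, i ≤ m → j ≤ m → ∀ s ∈ Icc (0 : ℝ) 1, ∀ t ∈ Icc (0 : ℝ) 1,
      ∀ w : ℝ, |w| ≤ c → ‖edgePt m k' i s - edgePt m k' j t + w • bandDir‖ ≤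
        M * ‖edgePt m k i s - edgePt m k j t + w • bandDir‖ := by
  obtain ⟨c, hc, h⟩ := hk.exists_band_lower
  obtain ⟨d, hd, h'⟩ := exists_band_upper m k'
  have key : ∀ i j, i ≤ j → j ≤ m → ∀ s ∈ Icc (0 : ℝ) 1, ∀ t ∈ Icc (0 : ℝ) 1,
      ∀ w : ℝ, |w| ≤ c → ‖edgePt m k' i s - edgePt m k' j t + w • bandDir‖ ≤
        (d * c)⁻¹ * ‖edgePt m k i s - edgePt m k j t + w • bandDir‖ := by
    intro i j hij hj s hs t ht w hw
    rw [inv_mul_eq_div, le_div_iff₀ (by positivity)]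
    have h1 := h i j hij hj s hs t ht w hw
    have h2 := mul_le_mul_of_nonneg_left (h' i j hij hj s hs t ht w) hc.le
    linarith
  refine ⟨(d * c)⁻¹, c, by positivity, hc, fun i j hi hj s hs t ht w hw => ?_⟩
  rcases le_total i j with hij | hij
  · exact key i j hij hj s hs t ht w hw
  · have := key j i hij hi t ht s hs (-w) (by rwa [abs_neg])
    rw [← norm_neg, ← norm_neg (edgePt m k j t - edgePt m k i s + -w • bandDir)] at this
    have e : ∀ x y : E3, -(y - x + -w • bandDir) = x - y + w • bandDir := fun x y => by module
    rwa [e, e] at this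

end BandArc

/-! ### The links of the construction -/

/-- The linear part of `flip`. -/
def flipMat : Matrix (Fin 3) (Fin 3) ℝ := !![-1 / 3, 0, 0; 0, 1, 0; 0, 0, -1]

/-- The affine map which takes a band arc to an arc in the lower half space that joins the origin
to `(1, 0, 0)`. -/
def flip (x : E3) : E3 := affMap flipMat !₂[2 / 3, 0, 0] x

theorem flip_eq (x : E3) : flip x = !₂[(2 - x 0) / 3, x 1, -x 2] := by
  ext c
  fin_cases c <;> simp [flip, affMap, flipMat, dotProduct, Fin.sum_univ_three]
  ring

theorem norm_E3_sq (x : E3) : ‖x‖ ^ 2 = x 0 ^ 2 + x 1 ^ 2 + x 2 ^ 2 := by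
  rw [EuclideanSpace.norm_sq_eq, Fin.sum_univ_three]
  simp

theorem norm_flip_sub_le (x y : E3) : ‖flip x - flip y‖ ≤ ‖x - y‖ := by
  rw [← pow_le_pow_iff_left₀ (norm_nonneg _) (norm_nonneg _) two_ne_zero, norm_E3_sq, norm_E3_sq,
    flip_eq, flip_eq]
  simp
  nlinarith [sq_nonneg (x 0 - y 0)]

theorem le_norm_flip_sub (x y : E3) : ‖x - y‖ ≤ 3 * ‖flip x - flip y‖ := by
  rw [← pow_le_pow_iff_left₀ (norm_nonneg _) (by positivity) two_ne_zero, mul_pow, norm_E3_sq,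
    norm_E3_sq, flip_eq, flip_eq]
  simp
  nlinarith [sq_nonneg (x 1 - y 1), sq_nonneg (x 2 - y 2)]

/-- The point of the band over a closed polygon with coordinate `w` in the direction of the
band. -/
def bandPt (m : ℕ) (k : ℕ → E3) (i : ℕ) (s w : ℝ) : E3 := edgePt m k i s + w • bandDir

/-- The image of an arc under `flip`, scaled by `ρ` and moved to the point `(1, ρ, 0)`. -/
def loopPt (r : ℕ) (l : ℕ → E3) (ρ : ℝ) (i : ℕ) (s : ℝ) : E3 :=
  !₂[1, ρ, 0] + ρ • flip (edgePt r l i s)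

theorem bandPt_apply_two (m : ℕ) (k : ℕ → E3) (i : ℕ) (s w : ℝ) :
    bandPt m k i s w 2 = edgePt m k i s 2 := by
  simp [bandPt, bandDir]

theorem loopPt_apply_two (r : ℕ) (l : ℕ → E3) (ρ : ℝ) (i : ℕ) (s : ℝ) :
    loopPt r l ρ i s 2 = -(ρ * edgePt r l i s 2) := by
  simp [loopPt, flip_eq]

theorem loopPt_sub (r : ℕ) (l : ℕ → E3) {ρ : ℝ} (hρ : 0 ≤ ρ) (i j : ℕ) (s t : ℝ) :
    ‖loopPt r l ρ i s - loopPt r l ρ j t‖ =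
      ρ * ‖flip (edgePt r l i s) - flip (edgePt r l j t)‖ := by
  rw [loopPt, loopPt, add_sub_add_left_eq_sub, ← smul_sub, norm_smul, Real.norm_of_nonneg hρ]

theorem bandPt_sub (m : ℕ) (k : ℕ → E3) (i j : ℕ) (s t v w : ℝ) :
    bandPt m k i s v - bandPt m k j t w =
      edgePt m k i s - edgePt m k j t + (v - w) • bandDir := by
  simp only [bandPt]; module

theorem apply_sub_le_norm (x y : E3) (c : Fin 3) : x c - y c ≤ ‖x - y‖ :=
  (le_abs_self _).trans (PiLp.norm_apply_le (x - y) c)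

namespace BandArc

variable {m r : ℕ} {k l k' l' : ℕ → E3}

theorem bandPt_closing (hk : BandArc m k) (s w : ℝ) :
    bandPt m k m s w = !₂[3 * s - 1, w, 0] := by
  rw [bandPt, hk.edgePt_closing]
  ext c
  fin_cases c <;> simp [bandDir]

theorem loopPt_zero (hl : BandArc r l) (ρ : ℝ) : loopPt r l ρ 0 0 = !₂[1, ρ, 0] := by
  rw [loopPt, edgePt_of_lt l (by have := hl.two_le; omega), hl.first, flip_eq]
  ext c
  fin_cases c <;> simp

theorem loopPt_last (hl : BandArc r l) (ρ : ℝ) :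
    loopPt r l ρ (r - 1) 1 = !₂[1 + ρ, ρ, 0] := by
  have := hl.two_le
  rw [loopPt, edgePt_of_lt l (by omega), Nat.sub_add_cancel (by omega), one_smul,
    add_sub_cancel, hl.last, flip_eq]
  ext c
  fin_cases c <;> simp
  norm_num

/-- The points of a band arc approach the first coordinate axis only at the ends of the arc. -/
theorem exists_height (hl : BandArc r l) :
    ∃ c : ℝ, 0 < c ∧ ∀ i, i < r → ∀ s ∈ Icc (0 : ℝ) 1,
      c * ‖edgePt r l i s - edgePt r l 0 0‖ ≤ edgePt r l i s 2 ∨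
      c * ‖edgePt r l i s - edgePt r l (r - 1) 1‖ ≤ edgePt r l i s 2 := by
  have hr := hl.two_le
  suffices h : ∀ i : Fin r, ∃ c : ℝ, 0 < c ∧ ∀ s ∈ Icc (0 : ℝ) 1,
      c * ‖edgePt r l i s - edgePt r l 0 0‖ ≤ edgePt r l i s 2 ∨
      c * ‖edgePt r l i s - edgePt r l (r - 1) 1‖ ≤ edgePt r l i s 2 by
    obtain ⟨c, hc, h⟩ := exists_common_pos (ι := Fin r)
      (fun i c c' _ hcc h s hs => (h s hs).imp
        (fun h => h.trans' (mul_le_mul_of_nonneg_right hcc (norm_nonneg _)))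
        (fun h => h.trans' (mul_le_mul_of_nonneg_right hcc (norm_nonneg _)))) h
    exact ⟨c, hc, fun i hi => h ⟨i, hi⟩⟩
  rintro ⟨i, hi⟩
  dsimp only
  rcases Nat.eq_zero_or_pos i with rfl | h0
  · have hz := hl.pos 1 one_pos (by omega)
    refine ⟨l 1 2 / (1 + ‖l 1 - l 0‖), by positivity, fun s hs => Or.inl ?_⟩
    rw [edgePt_of_lt l hi, edgePt_of_lt l hi]
    have e : l 0 + s • (l (0 + 1) - l 0) - (l 0 + (0 : ℝ) • (l (0 + 1) - l 0)) =
      s • (l 1 - l 0) := by simp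
    rw [e, norm_smul, Real.norm_of_nonneg hs.1, div_mul_eq_mul_div, div_le_iff₀ (by positivity)]
    have e2 : (l 0 + s • (l (0 + 1) - l 0)) 2 = s * l 1 2 := by simp [hl.first]
    rw [e2]
    nlinarith [mul_nonneg hz.le hs.1]
  rcases Nat.eq_or_lt_of_le (Nat.succ_le_of_lt hi) with h1 | h1
  · have hz := hl.pos i h0 hi
    obtain rfl : i = r - 1 := by omega
    refine ⟨l (r - 1) 2 / (1 + ‖l r - l (r - 1)‖), by positivity, fun s hs => Or.inr ?_⟩
    have hs' := hs.2
    rw [edgePt_of_lt l hi, edgePt_of_lt l hi, Nat.sub_add_cancel (by omega)]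
    have e : l (r - 1) + s • (l r - l (r - 1)) - (l (r - 1) + (1 : ℝ) • (l r - l (r - 1))) =
      -((1 - s) • (l r - l (r - 1))) := by module
    rw [e, norm_neg, norm_smul, Real.norm_of_nonneg (by linarith), div_mul_eq_mul_div,
      div_le_iff₀ (by positivity)]
    have e2 : (l (r - 1) + s • (l r - l (r - 1))) 2 = (1 - s) * l (r - 1) 2 := by
      simp [hl.last]; ring
    rw [e2]
    nlinarith [mul_nonneg hz.le (sub_nonneg.2 hs')]
  · have hcont : Continuous fun s : ℝ => edgePt r l i s 2 := by unfold edgePt; fun_prop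
    obtain ⟨x₀, hx₀, hmin⟩ := isCompact_Icc.exists_isMinOn
      (s := Icc (0 : ℝ) 1) ⟨0, by simp⟩ hcont.continuousOn
    have hd := hl.edgePt_pos h0 h1 hx₀
    set d := edgePt r l i x₀ 2
    have hcont' : Continuous fun s : ℝ => ‖edgePt r l i s - edgePt r l 0 0‖ := by
      unfold edgePt; fun_prop
    obtain ⟨x₁, _, hmax⟩ := isCompact_Icc.exists_isMaxOn
      (s := Icc (0 : ℝ) 1) ⟨0, by simp⟩ hcont'.continuousOn
    set D := ‖edgePt r l i x₁ - edgePt r l 0 0‖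
    refine ⟨d / (1 + D), by positivity, fun s hs => Or.inl ?_⟩
    have e1 : d ≤ edgePt r l i s 2 := hmin hs
    have e2 : ‖edgePt r l i s - edgePt r l 0 0‖ ≤ D := hmax hs
    rw [div_mul_eq_mul_div, div_le_iff₀ (by positivity)]
    have : 0 ≤ D := norm_nonneg _
    nlinarith [norm_nonneg (edgePt r l i s - edgePt r l 0 0)]

/-- The scale `ρ` cancels, which makes the constant independent of it. The factor `3` is the
distortion of `flip`. -/
theorem exists_loop_compare (hl : BandArc r l) (l' : ℕ → E3) :
    ∃ M : ℝ, 0 < M ∧ ∀ ρ, 0 ≤ ρ → ∀ i j, i < r → j < r → ∀ s ∈ Icc (0 : ℝ) 1,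
      ∀ t ∈ Icc (0 : ℝ) 1, ‖loopPt r l' ρ i s - loopPt r l' ρ j t‖ ≤
        M * ‖loopPt r l ρ i s - loopPt r l ρ j t‖ := by
  obtain ⟨M, c, hM, hc, h⟩ := hl.exists_band_compare l'
  refine ⟨M * 3, by positivity, fun ρ hρ i j hi hj s hs t ht => ?_⟩
  rw [loopPt_sub r l' hρ, loopPt_sub r l hρ]
  have h1 := h i j hi.le hj.le s hs t ht 0 (by simpa using hc.le)
  simp only [zero_smul, add_zero] at h1
  have h2 := (norm_flip_sub_le (edgePt r l' i s) (edgePt r l' j t)).trans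
    (h1.trans (mul_le_mul_of_nonneg_left (le_norm_flip_sub _ _) hM.le))
  calc _ ≤ ρ * _ := mul_le_mul_of_nonneg_left h2 hρ
    _ = _ := by ring

/-- The band is above the plane and the loop below, so the distance between their points is at least
the depth of the loop point, which by `exists_height` controls its distance to an end of the loop.
That end is also a point of the band, with the same parameters for both knots; the triangle
inequality through it reduces the claim to two band points and two loop points. -/
theorem exists_cross_compare (hk : BandArc m k) (hk' : BandArc m k') (hl : BandArc r l)
    (hl' : BandArc r l') :
    ∃ M c : ℝ, 0 < M ∧ 0 < c ∧ ∀ ρ, 0 < ρ → ρ ≤ c → ∀ i j, i ≤ m → j < r →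
      ∀ s ∈ Icc (0 : ℝ) 1, ∀ t ∈ Icc (0 : ℝ) 1, ∀ w : ℝ, |w| ≤ ρ →
        ‖bandPt m k' i s w - loopPt r l' ρ j t‖ ≤ M * ‖bandPt m k i s w - loopPt r l ρ j t‖ := by
  obtain ⟨M, c, hM, hc, h⟩ := hk.exists_band_compare k'
  obtain ⟨N, hN, h'⟩ := hl.exists_loop_compare l'
  obtain ⟨d, hd, hdz⟩ := hl.exists_height
  -- The bound `c / 2` is needed because transverse coordinates of size at most `ρ` can differ by `2
  -- * ρ`. The bound `1` keeps the end `(1 + ρ, ρ, 0)` of the loop on the closing edge.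
  refine ⟨M + (M + N) * d⁻¹, min (c / 2) 1, by positivity, by positivity,
    fun ρ hρ hρc i j hi hj s hs t ht w hw => ?_⟩
  have hρc' : ρ ≤ c / 2 := hρc.trans (min_le_left _ _)
  have hρ1 : ρ ≤ 1 := hρc.trans (min_le_right _ _)
  have hz : d * ‖loopPt r l ρ 0 0 - loopPt r l ρ j t‖ ≤ ‖bandPt m k i s w - loopPt r l ρ j t‖ ∨
      d * ‖loopPt r l ρ (r - 1) 1 - loopPt r l ρ j t‖ ≤
        ‖bandPt m k i s w - loopPt r l ρ j t‖ := by
    have h3 : ρ * edgePt r l j t 2 ≤ ‖bandPt m k i s w - loopPt r l ρ j t‖ := by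
      refine le_trans ?_ (apply_sub_le_norm _ _ 2)
      rw [bandPt_apply_two, loopPt_apply_two]
      have := hk.edgePt_nonneg i hs
      linarith
    refine (hdz j hj t ht).imp (fun h => ?_) (fun h => ?_)
    all_goals
      refine le_trans ?_ ((mul_le_mul_of_nonneg_left h hρ.le).trans h3)
      rw [loopPt_sub r l hρ.le, mul_left_comm, norm_sub_rev]
      gcongr
      exact norm_flip_sub_le _ _
  have key : ∀ (a : ℝ) (b : ℕ) (e : ℝ), a ∈ Icc (0 : ℝ) 1 → b < r → e ∈ Icc (0 : ℝ) 1 →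
      bandPt m k m a ρ = loopPt r l ρ b e → bandPt m k' m a ρ = loopPt r l' ρ b e →
      d * ‖loopPt r l ρ b e - loopPt r l ρ j t‖ ≤ ‖bandPt m k i s w - loopPt r l ρ j t‖ →
      ‖bandPt m k' i s w - loopPt r l' ρ j t‖ ≤
        (M + (M + N) * d⁻¹) * ‖bandPt m k i s w - loopPt r l ρ j t‖ := by
    intro a b e ha hb he h1 h2 h3
    have h4 := h i m hi le_rfl s hs a ha (w - ρ) (by
      rw [abs_le] at hw ⊢
      constructor <;> linarith)
    rw [← bandPt_sub, ← bandPt_sub, h1, h2] at h4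
    have h5 := h' ρ hρ.le b j hb hj e he t ht
    have h6 := norm_sub_le_norm_sub_add_norm_sub (bandPt m k' i s w) (loopPt r l' ρ b e)
      (loopPt r l' ρ j t)
    have h7 := norm_sub_le_norm_sub_add_norm_sub (bandPt m k i s w) (loopPt r l ρ j t)
      (loopPt r l ρ b e)
    rw [norm_sub_rev (loopPt r l ρ j t)] at h7
    rw [← le_inv_mul_iff₀ hd] at h3
    have h8 := mul_le_mul_of_nonneg_left h3 (add_pos hM hN).le
    have h9 := mul_le_mul_of_nonneg_left h7 hM.le
    calc _ ≤ _ := h6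
      _ ≤ M * ‖bandPt m k i s w - loopPt r l ρ b e‖ +
          N * ‖loopPt r l ρ b e - loopPt r l ρ j t‖ := add_le_add h4 h5
      _ ≤ _ := by linarith
  have hr := hl.two_le
  rcases hz with h3 | h3
  · refine key (2 / 3) 0 0 ⟨by norm_num, by norm_num⟩ (by omega) (by simp) ?_ ?_ h3
    · rw [hk.bandPt_closing, hl.loopPt_zero]; norm_num
    · rw [hk'.bandPt_closing, hl'.loopPt_zero]; norm_num
  · refine key ((2 + ρ) / 3) (r - 1) 1 ⟨by positivity, by linarith⟩ (by omega) (by simp) ?_ ?_ h3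
    · rw [hk.bandPt_closing, hl.loopPt_last]; congr 2; ring
    · rw [hk'.bandPt_closing, hl'.loopPt_last]; congr 2; ring

end BandArc

/-! ### The polygons of the construction and their comparison -/

/-- The indices of the segments of the construction: six segments in the plane of the wedge, the
edges of the two sides of the band, and the edges of the loop. -/
abbrev Piece (m r : ℕ) : Type := Fin 6 ⊕ (Fin m × Bool) ⊕ Fin r

/-- The sign of a side of the band. -/
def side (σ : Bool) : ℝ := bif σ then 1 else -1

theorem abs_side (σ : Bool) : |side σ| = 1 := by cases σ <;> simp [side]

/-- The first endpoint of a segment of the construction. -/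
def pieceStart {m r : ℕ} (k l : ℕ → E3) (ρ : ℝ) : Piece m r → E3
  | .inl j => ![!₂[-1, ρ, 0], !₂[-1, -ρ, 0], !₂[1, ρ, 0], !₂[1, -ρ, 0], !₂[1, -ρ, 0],
      !₂[1 + ρ, ρ, 0]] j
  | .inr (.inl (i, σ)) => k i + (side σ * ρ) • bandDir
  | .inr (.inr i) => !₂[1, ρ, 0] + ρ • flip (l i)

/-- The second endpoint of a segment of the construction. -/
def pieceEnd {m r : ℕ} (k l : ℕ → E3) (ρ g : ℝ) : Piece m r → E3
  | .inl j => ![!₂[-g, 0, 0], !₂[-g, 0, 0], !₂[g, 0, 0], !₂[g, 0, 0], !₂[2, -ρ, 0],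
      !₂[2, ρ, 0]] j
  | .inr (.inl (i, σ)) => k (i + 1) + (side σ * ρ) • bandDir
  | .inr (.inr i) => !₂[1, ρ, 0] + ρ • flip (l (i + 1))

/-- The parametrizations of the segments of the construction. -/
def piecePt {m r : ℕ} (k l : ℕ → E3) (ρ g : ℝ) (j : Piece m r) (s : ℝ) : E3 :=
  pieceStart k l ρ j + s • (pieceEnd k l ρ g j - pieceStart k l ρ j)

/-- A point of the construction lies in the band or in the loop. -/
theorem piecePt_cases {m r : ℕ} {ρ g : ℝ} (hρ : 0 ≤ ρ) (hρ1 : ρ ≤ 1) (hg : 0 ≤ g) (hg1 : g ≤ 1)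
    (j : Piece m r) {s : ℝ} (hs : s ∈ Icc (0 : ℝ) 1) :
    (∃ i t w, i ≤ m ∧ t ∈ Icc (0 : ℝ) 1 ∧ |w| ≤ ρ ∧
      ∀ k l, BandArc m k → piecePt k l ρ g j s = bandPt m k i t w) ∨
    (∃ i, i < r ∧ ∀ k l, BandArc r l → piecePt k l ρ g j s = loopPt r l ρ i s) := by
  obtain ⟨hs0, hs1⟩ := hs
  rcases j with j | ⟨i, σ⟩ | i
  · left
    have key : ∀ x₀ x₁ y₀ y₁ : ℝ, -1 ≤ x₀ → x₀ ≤ 2 → -1 ≤ x₁ → x₁ ≤ 2 → |y₀| ≤ ρ → |y₁| ≤ ρ →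
        (∀ k l, piecePt (r := r) (m := m) k l ρ g (.inl j) s =
          !₂[x₀, y₀, 0] + s • (!₂[x₁, y₁, 0] - !₂[x₀, y₀, 0])) →
        ∃ i t w, i ≤ m ∧ t ∈ Icc (0 : ℝ) 1 ∧ |w| ≤ ρ ∧
          ∀ k l, BandArc m k → piecePt (r := r) (m := m) k l ρ g (.inl j) s =
            bandPt m k i t w := by
      intro x₀ x₁ y₀ y₁ h1 h2 h3 h4 h5 h6 h
      rw [abs_le] at h5 h6
      -- The closing edge runs from `-1` to `2`, so abscissa `x` has parameter `(x + 1) / 3`. The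
      -- parameters are chosen before `k` and `l`, so corresponding points for different knots have
      -- the same ones.
      refine ⟨m, ((1 - s) * x₀ + s * x₁ + 1) / 3, (1 - s) * y₀ + s * y₁, le_rfl, ⟨?_, ?_⟩, ?_,
        fun k l hk => ?_⟩
      · nlinarith
      · nlinarith
      · rw [abs_le]; constructor <;> nlinarith
      · rw [h, hk.bandPt_closing]
        ext c
        fin_cases c <;> simp <;> ring
    have habs : |ρ| ≤ ρ := by rw [abs_of_nonneg hρ]
    have habs' : |-ρ| ≤ ρ := by rwa [abs_neg]
    have h0 : |(0 : ℝ)| ≤ ρ := by rwa [abs_zero]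
    fin_cases j
    · exact key (-1) (-g) ρ 0 (by linarith) (by linarith) (by linarith) (by linarith) habs h0
        fun k l => by simp [piecePt, pieceStart, pieceEnd]
    · exact key (-1) (-g) (-ρ) 0 (by linarith) (by linarith) (by linarith) (by linarith) habs' h0
        fun k l => by simp [piecePt, pieceStart, pieceEnd]
    · exact key 1 g ρ 0 (by linarith) (by linarith) (by linarith) (by linarith) habs h0
        fun k l => by simp [piecePt, pieceStart, pieceEnd]
    · exact key 1 g (-ρ) 0 (by linarith) (by linarith) (by linarith) (by linarith) habs' h0
        fun k l => by simp [piecePt, pieceStart, pieceEnd]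
    · exact key 1 2 (-ρ) (-ρ) (by linarith) (by linarith) (by linarith) (by linarith) habs' habs'
        fun k l => by simp [piecePt, pieceStart, pieceEnd]
    · exact key (1 + ρ) 2 ρ ρ (by linarith) (by linarith) (by linarith) (by linarith) habs habs
        fun k l => by simp [piecePt, pieceStart, pieceEnd]
  · refine Or.inl ⟨i, s, side σ * ρ, i.2.le, ⟨hs0, hs1⟩, ?_, fun k l hk => ?_⟩
    · rw [abs_mul, abs_side, one_mul, abs_of_nonneg hρ]
    · simp only [piecePt, pieceStart, pieceEnd, bandPt, edgePt_of_lt k i.2]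
      module
  · refine Or.inr ⟨i, i.2, fun k l hl => ?_⟩
    simp only [piecePt, pieceStart, pieceEnd, loopPt, edgePt_of_lt l i.2, flip_eq]
    ext c
    fin_cases c <;> simp <;> ring

/-- The construction for two pairs of knots: matching points have comparable distances. -/
theorem exists_piece_compare {m r : ℕ} {k l k' l' : ℕ → E3} (hk : BandArc m k)
    (hk' : BandArc m k') (hl : BandArc r l) (hl' : BandArc r l') :
    ∃ M c : ℝ, 0 < M ∧ 0 < c ∧ ∀ ρ g, 0 < ρ → ρ ≤ c → 0 ≤ g → g ≤ 1 → ∀ i j : Piece m r,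
      ∀ s ∈ Icc (0 : ℝ) 1, ∀ t ∈ Icc (0 : ℝ) 1,
        ‖piecePt k' l' ρ g i s - piecePt k' l' ρ g j t‖ ≤
          M * ‖piecePt k l ρ g i s - piecePt k l ρ g j t‖ := by
  obtain ⟨M₁, c₁, hM₁, hc₁, h₁⟩ := hk.exists_band_compare k'
  obtain ⟨M₂, hM₂, h₂⟩ := hl.exists_loop_compare l'
  obtain ⟨M₃, c₃, hM₃, hc₃, h₃⟩ := hk.exists_cross_compare hk' hl hl'
  refine ⟨max M₁ (max M₂ M₃), min 1 (min (c₁ / 2) c₃), lt_max_of_lt_left hM₁, by positivity,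
    fun ρ g hρ hρc hg hg1 i j s hs t ht => ?_⟩
  have hρ1 : ρ ≤ 1 := hρc.trans (min_le_left _ _)
  have hρ2 : ρ ≤ c₁ / 2 := hρc.trans ((min_le_right _ _).trans (min_le_left _ _))
  have hρ3 : ρ ≤ c₃ := hρc.trans ((min_le_right _ _).trans (min_le_right _ _))
  have l₁ : M₁ ≤ max M₁ (max M₂ M₃) := le_max_left _ _
  have l₂ : M₂ ≤ max M₁ (max M₂ M₃) := (le_max_left _ _).trans (le_max_right _ _)
  have l₃ : M₃ ≤ max M₁ (max M₂ M₃) := (le_max_right _ _).trans (le_max_right _ _)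
  rcases piecePt_cases (r := r) hρ.le hρ1 hg hg1 i hs with
    ⟨i', s', v, hi', hs', hv, hi⟩ | ⟨i', hi', hi⟩ <;>
  rcases piecePt_cases (r := r) hρ.le hρ1 hg hg1 j ht with
    ⟨j', t', w, hj', ht', hw, hj⟩ | ⟨j', hj', hj⟩
  · rw [hi k l hk, hi k' l' hk', hj k l hk, hj k' l' hk', bandPt_sub, bandPt_sub]
    refine (h₁ i' j' hi' hj' s' hs' t' ht' (v - w) ?_).trans
      (mul_le_mul_of_nonneg_right l₁ (norm_nonneg _))
    rw [abs_le] at *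
    constructor <;> linarith [hv.1, hv.2, hw.1, hw.2]
  · rw [hi k l hk, hi k' l' hk', hj k l hl, hj k' l' hl']
    exact (h₃ ρ hρ hρ3 i' j' hi' hj' s' hs' t ht v hv).trans
      (mul_le_mul_of_nonneg_right l₃ (norm_nonneg _))
  · rw [hi k l hl, hi k' l' hl', hj k l hk, hj k' l' hk', norm_sub_rev,
      norm_sub_rev (loopPt r l ρ i' s)]
    exact (h₃ ρ hρ hρ3 j' i' hj' hi' t' ht' s hs w hw).trans
      (mul_le_mul_of_nonneg_right l₃ (norm_nonneg _))
  · rw [hi k l hl, hi k' l' hl', hj k l hl, hj k' l' hl']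
    exact (h₂ ρ hρ.le i' j' hi' hj' s hs t ht).trans
      (mul_le_mul_of_nonneg_right l₂ (norm_nonneg _))

/-! ### Cones over families of subsets of a chart -/

theorem hemi_apply_three (y : E3) : (hemi y).1 3 = (√(1 + ‖y‖ ^ 2))⁻¹ := by
  simp [hemi]

/-- The central projection between the chart and the hemisphere, in terms of inner products. -/
theorem norm_hemi_sub_sq (x y : E3) :
    √(1 + ‖x‖ ^ 2) * √(1 + ‖y‖ ^ 2) * ‖(hemi x).1 - (hemi y).1‖ ^ 2 =
      ‖x - y‖ ^ 2 - (√(1 + ‖x‖ ^ 2) - √(1 + ‖y‖ ^ 2)) ^ 2 := by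
  have hx : 0 < 1 + ‖x‖ ^ 2 := by positivity
  have hy : 0 < 1 + ‖y‖ ^ 2 := by positivity
  have ha := Real.sq_sqrt hx.le
  have hb := Real.sq_sqrt hy.le
  have ha0 := (Real.sqrt_pos.2 hx).ne'
  have hb0 := (Real.sqrt_pos.2 hy).ne'
  have hh : ‖(hemi x).1 - (hemi y).1‖ ^ 2 =
      ((√(1 + ‖x‖ ^ 2))⁻¹ * x 0 - (√(1 + ‖y‖ ^ 2))⁻¹ * y 0) ^ 2 +
      ((√(1 + ‖x‖ ^ 2))⁻¹ * x 1 - (√(1 + ‖y‖ ^ 2))⁻¹ * y 1) ^ 2 +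
      ((√(1 + ‖x‖ ^ 2))⁻¹ * x 2 - (√(1 + ‖y‖ ^ 2))⁻¹ * y 2) ^ 2 +
      ((√(1 + ‖x‖ ^ 2))⁻¹ - (√(1 + ‖y‖ ^ 2))⁻¹) ^ 2 := by
    rw [EuclideanSpace.norm_sq_eq, Fin.sum_univ_four]
    simp [hemi]
  rw [hh, norm_E3_sq (x - y)]
  generalize √(1 + ‖x‖ ^ 2) = a at *
  generalize √(1 + ‖y‖ ^ 2) = b at *
  rw [norm_E3_sq] at ha hb
  simp only [PiLp.sub_apply]
  field_simp
  linear_combination (b ^ 2 - a * b) * (-ha) + (a ^ 2 - a * b) * (-hb)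

theorem norm_hemi_sub_le (x y : E3) : ‖(hemi x).1 - (hemi y).1‖ ≤ ‖x - y‖ := by
  have h := norm_hemi_sub_sq x y
  have ha : 1 ≤ √(1 + ‖x‖ ^ 2) := by rw [Real.one_le_sqrt]; nlinarith [norm_nonneg x]
  have hb : 1 ≤ √(1 + ‖y‖ ^ 2) := by rw [Real.one_le_sqrt]; nlinarith [norm_nonneg y]
  refine abs_le_of_sq_le_sq' ?_ (norm_nonneg _) |>.2
  have hab : 1 ≤ √(1 + ‖x‖ ^ 2) * √(1 + ‖y‖ ^ 2) := one_le_mul_of_one_le_of_one_le ha hb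
  nlinarith [sq_nonneg ‖(hemi x).1 - (hemi y).1‖, sq_nonneg (√(1 + ‖x‖ ^ 2) - √(1 + ‖y‖ ^ 2))]

/-- In `norm_hemi_sub_sq` the subtracted term is controlled by the fourth coordinates of the two
points of the sphere, and on bounded sets the weights are at most `1 + R ^ 2`. -/
theorem norm_sub_le_hemi {R : ℝ} {x y : E3} (hx : ‖x‖ ≤ R) (hy : ‖y‖ ≤ R) :
    ‖x - y‖ ≤ 2 * (1 + R ^ 2) * ‖(hemi x).1 - (hemi y).1‖ := by
  have h := norm_hemi_sub_sq x y
  set a := √(1 + ‖x‖ ^ 2) with ha_def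
  set b := √(1 + ‖y‖ ^ 2) with hb_def
  set d := ‖(hemi x).1 - (hemi y).1‖
  have hR : 0 ≤ R := (norm_nonneg x).trans hx
  have ha : 1 ≤ a := by rw [ha_def, Real.one_le_sqrt]; nlinarith [norm_nonneg x]
  have hb : 1 ≤ b := by rw [hb_def, Real.one_le_sqrt]; nlinarith [norm_nonneg y]
  have ha' : a ^ 2 ≤ 1 + R ^ 2 := by
    rw [ha_def, Real.sq_sqrt (by positivity)]; gcongr
  have hb' : b ^ 2 ≤ 1 + R ^ 2 := by
    rw [hb_def, Real.sq_sqrt (by positivity)]; gcongr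
  have hab : a * b ≤ 1 + R ^ 2 := by nlinarith [sq_nonneg (a - b)]
  have hab1 : 1 ≤ a * b := one_le_mul_of_one_le_of_one_le ha hb
  have h3 : |a - b| ≤ a * b * d := by
    have h4 := PiLp.norm_apply_le ((hemi x).1 - (hemi y).1) 3
    rw [PiLp.sub_apply, hemi_apply_three, hemi_apply_three, Real.norm_eq_abs] at h4
    have h5 : a - b = -(a * b * (a⁻¹ - b⁻¹)) := by field_simp; ring
    rw [h5, abs_neg, abs_mul, abs_of_pos (by positivity)]
    gcongr
  refine abs_le_of_sq_le_sq' ?_ (by positivity) |>.2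
  have h6 : (a - b) ^ 2 ≤ (a * b * d) ^ 2 := by
    rw [← sq_abs]; gcongr
  have h7 : ‖x - y‖ ^ 2 = a * b * d ^ 2 + (a - b) ^ 2 := by linarith
  have h8 : a * b * d ^ 2 ≤ (1 + R ^ 2) ^ 2 * d ^ 2 := by
    gcongr
    nlinarith
  have h9 : (a * b * d) ^ 2 ≤ ((1 + R ^ 2) * d) ^ 2 := by gcongr
  nlinarith [sq_nonneg ((1 + R ^ 2) * d)]

/-- The point of norm `t` on the ray through the point `y` of the chart. -/
def lift (t : ℝ) (y : E3) : E4 := t • (hemi y).1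

theorem norm_hemi (y : E3) : ‖(hemi y).1‖ = 1 := mem_sphere_zero_iff_norm.1 (hemi y).2

theorem norm_lift {t : ℝ} (ht : 0 ≤ t) (y : E3) : ‖lift t y‖ = t := by
  rw [lift, norm_smul, norm_hemi, mul_one, Real.norm_of_nonneg ht]

theorem lift_pos {t : ℝ} (ht : 0 < t) (y : E3) : 0 < lift t y 3 := mul_pos ht (hemi_pos y)

theorem chart_lift {t : ℝ} (ht : t ≠ 0) (y : E3) : chart (lift t y) = y := by
  rw [lift, chart_smul ht, chart_hemi]

theorem lift_chart {p : E4} (hp : 0 < p 3) : lift ‖p‖ (chart p) = p := smul_hemi_chart hp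

theorem norm_lift_sub_le {t u : ℝ} (ht : 0 ≤ t) (x y : E3) :
    ‖lift t x - lift u y‖ ≤ |t - u| + t * ‖x - y‖ := by
  have : lift t x - lift u y = t • ((hemi x).1 - (hemi y).1) + (t - u) • (hemi y).1 := by
    simp only [lift]; module
  rw [this]
  refine (norm_add_le _ _).trans ?_
  rw [norm_smul, norm_smul, norm_hemi, mul_one, Real.norm_of_nonneg ht, Real.norm_eq_abs,
    add_comm]
  gcongr
  exact norm_hemi_sub_le x y

/-- The radial difference `|t - u|` is at most the distance of the lifts. Subtracting the radial
part leaves a multiple of the chord between the directions, which bounds the distance in the chart.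
-/
theorem le_norm_lift_sub {R t u : ℝ} (ht : 0 ≤ t) (hu : 0 ≤ u) {x y : E3} (hx : ‖x‖ ≤ R)
    (hy : ‖y‖ ≤ R) : t * ‖x - y‖ ≤ 4 * (1 + R ^ 2) * ‖lift t x - lift u y‖ := by
  have h1 : |t - u| ≤ ‖lift t x - lift u y‖ := by
    have := abs_norm_sub_norm_le (lift t x) (lift u y)
    rwa [norm_lift ht, norm_lift hu] at this
  have h2 : t • ((hemi x).1 - (hemi y).1) =
      (lift t x - lift u y) - (t - u) • (hemi y).1 := by
    simp only [lift]; module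
  have h3 : t * ‖(hemi x).1 - (hemi y).1‖ ≤ 2 * ‖lift t x - lift u y‖ := by
    have := norm_sub_le (lift t x - lift u y) ((t - u) • (hemi y).1)
    rw [← h2, norm_smul, norm_smul, norm_hemi, mul_one, Real.norm_of_nonneg ht,
      Real.norm_eq_abs] at this
    linarith
  have h4 := mul_le_mul_of_nonneg_left (norm_sub_le_hemi hx hy) ht
  have h5 : 0 ≤ 2 * (1 + R ^ 2) := by positivity
  nlinarith [mul_le_mul_of_nonneg_left h3 h5]

/-- The cone with vertex at the origin whose section by the sphere of radius `t ≤ t₀` is the lift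
of `C t`. -/
def coneOver (t₀ : ℝ) (C : ℝ → Set E3) : Set E4 :=
  {p | p = 0 ∨ 0 < p 3 ∧ ‖p‖ ≤ t₀ ∧ chart p ∈ C ‖p‖}

theorem sphereSection_coneOver {t₀ ε : ℝ} (C : ℝ → Set E3) (h0 : 0 < ε) (h1 : ε ≤ t₀) :
    sphereSection (coneOver t₀ C) ε = inSphere (C ε) := by
  ext u
  have hn : ‖ε • u.1‖ = ε := by
    rw [norm_smul, mem_sphere_zero_iff_norm.1 u.2, mul_one, Real.norm_of_nonneg h0.le]
  have hne : ε • u.1 ≠ 0 := by rw [← norm_pos_iff, hn]; exact h0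
  change (_ = _ ∨ _) ↔ _
  rw [hn, mem_inSphere, chart_smul h0.ne', or_iff_right hne, PiLp.smul_apply, smul_eq_mul,
    mul_pos_iff_of_pos_left h0]
  exact ⟨fun h => ⟨h.1, h.2.2⟩, fun h => ⟨h.1, h1, h.2⟩⟩

/-- The correspondence between the cones over two families with matching parametrizations. -/
def matching {J : Type*} (t₀ : ℝ) (S S' : J → ℝ → ℝ → E3) : Set (E4 × E4) :=
  {x | x.1 = 0 ∧ x.2 = 0 ∨ 0 < x.1 3 ∧ 0 < x.2 3 ∧ ‖x.1‖ ≤ t₀ ∧ ‖x.2‖ = ‖x.1‖ ∧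
    ∃ j, ∃ s ∈ Icc (0 : ℝ) 1, chart x.1 = S j ‖x.1‖ s ∧ chart x.2 = S' j ‖x.1‖ s}

/-- The union of the curves of a parametrized family. -/
def famSet {J : Type*} (S : J → ℝ → ℝ → E3) (t : ℝ) : Set E3 := ⋃ j, S j t '' Icc 0 1

theorem matching_symm {J : Type*} {t₀ : ℝ} {S S' : J → ℝ → ℝ → E3} {p q : E4}
    (h : (p, q) ∈ matching t₀ S S') : (q, p) ∈ matching t₀ S' S := by
  rcases h with ⟨h1, h2⟩ | ⟨h1, h2, h3, h4, j, s, hs, h5, h6⟩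
  · exact Or.inl ⟨h2, h1⟩
  · dsimp only at *
    exact Or.inr ⟨h2, h1, h4 ▸ h3, h4.symm, j, s, hs, h4 ▸ h6, h4 ▸ h5⟩

theorem exists_matching {J : Type*} {t₀ : ℝ} (S S' : J → ℝ → ℝ → E3) {p : E4}
    (h : p ∈ coneOver t₀ (famSet S)) : ∃ q, (p, q) ∈ matching t₀ S S' := by
  rcases h with rfl | ⟨h1, h2, h3⟩
  · exact ⟨0, Or.inl ⟨rfl, rfl⟩⟩
  · obtain ⟨j, s, hs, h4⟩ := mem_iUnion.1 h3
    have hp : 0 < ‖p‖ := norm_pos_iff.2 (by rintro rfl; simp at h1)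
    refine ⟨lift ‖p‖ (S' j ‖p‖ s), Or.inr ⟨h1, lift_pos hp _, h2, norm_lift hp.le _, j, s, hs,
      h4.symm, chart_lift hp.ne' _⟩⟩

theorem mem_coneOver_of_matching {J : Type*} {t₀ : ℝ} {S S' : J → ℝ → ℝ → E3} {p q : E4}
    (h : (p, q) ∈ matching t₀ S S') : p ∈ coneOver t₀ (famSet S) := by
  rcases h with ⟨h1, _⟩ | ⟨h1, _, h3, _, j, s, hs, h5, _⟩
  · exact Or.inl h1
  · exact Or.inr ⟨h1, h3, mem_iUnion.2 ⟨j, s, hs, h5.symm⟩⟩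

/-- Bounds for a parametrized family of curves. -/
structure FamBound {J : Type*} (t₀ R M : ℝ) (S : J → ℝ → ℝ → E3) : Prop where
  norm_le : ∀ j t, 0 < t → t ≤ t₀ → ∀ s ∈ Icc (0 : ℝ) 1, ‖S j t s‖ ≤ R
  variation : ∀ j t u, 0 < t → t ≤ u → u ≤ t₀ → ∀ s ∈ Icc (0 : ℝ) 1,
    t * ‖S j t s - S j u s‖ ≤ M * (u - t)

/-- Both points are compared at the smaller of their two radii `t`: changing the radius costs a
multiple of `u - t` by `variation`, both in the source and in the target, and at a fixed radius the
comparison `h` applies. -/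
theorem matching_lipschitz {J : Type*} {t₀ R M : ℝ} (hM : 0 ≤ M) {S S' : J → ℝ → ℝ → E3}
    (hS : FamBound t₀ R M S) (hS' : FamBound t₀ R M S')
    (h : ∀ i j t, 0 < t → t ≤ t₀ → ∀ s ∈ Icc (0 : ℝ) 1, ∀ s' ∈ Icc (0 : ℝ) 1,
      ‖S' i t s - S' j t s'‖ ≤ M * ‖S i t s - S j t s'‖) {p q p' q' : E4}
    (hpq : (p, q) ∈ matching t₀ S S') (hpq' : (p', q') ∈ matching t₀ S S') :
    ‖q - q'‖ ≤ (1 + M + M ^ 2 + M * (4 * (1 + R ^ 2))) * ‖p - p'‖ := by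
  wlog hle : ‖p‖ ≤ ‖p'‖ generalizing p q p' q'
  · rw [norm_sub_rev q, norm_sub_rev p]
    exact this hpq' hpq (le_of_not_ge hle)
  have hK : 1 ≤ 1 + M + M ^ 2 + M * (4 * (1 + R ^ 2)) := by
    have : 0 ≤ M + M ^ 2 + M * (4 * (1 + R ^ 2)) := by positivity
    linarith
  rcases hpq with ⟨h1, h2⟩ | ⟨h1, h2, h3, h4, i, s, hs, h5, h6⟩
  · dsimp only at h1 h2
    subst h1 h2
    have hq : ‖q'‖ = ‖p'‖ := by
      rcases hpq' with ⟨h1, h2⟩ | h1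
      · dsimp only at h1 h2
        rw [h1, h2]
      · exact h1.2.2.2.1
    rw [zero_sub, zero_sub, norm_neg, norm_neg, hq]
    exact le_mul_of_one_le_left (norm_nonneg _) hK
  dsimp only at h1 h2 h3 h4 h5 h6
  have hp : 0 < ‖p‖ := norm_pos_iff.2 (by rintro rfl; simp at h1)
  rcases hpq' with ⟨h1', _⟩ | ⟨h1', h2', h3', h4', j, s', hs', h5', h6'⟩
  · dsimp only at h1'
    rw [h1', norm_zero] at hle
    exact absurd hle (not_le.2 hp)
  dsimp only at h1' h2' h3' h4' h5' h6'
  have hp' : 0 < ‖p'‖ := hp.trans_le hle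
  have e1 : p = lift ‖p‖ (S i ‖p‖ s) := by rw [← h5, lift_chart h1]
  have e2 : q = lift ‖p‖ (S' i ‖p‖ s) := by rw [← h6, ← h4, lift_chart h2]
  have e3 : p' = lift ‖p'‖ (S j ‖p'‖ s') := by rw [← h5', lift_chart h1']
  have e4 : q' = lift ‖p'‖ (S' j ‖p'‖ s') := by rw [← h6', ← h4', lift_chart h2']
  set t := ‖p‖
  set u := ‖p'‖
  have b1 : u - t ≤ ‖p - p'‖ := by
    rw [norm_sub_rev]; exact norm_sub_norm_le _ _
  have b2 : t * ‖S i t s - S j u s'‖ ≤ 4 * (1 + R ^ 2) * ‖p - p'‖ := by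
    rw [e1, e3]
    exact le_norm_lift_sub hp.le hp'.le (hS.norm_le i t hp h3 s hs) (hS.norm_le j u hp' h3' s' hs')
  have b3 : t * ‖S i t s - S j t s'‖ ≤ t * ‖S i t s - S j u s'‖ + M * (u - t) := by
    have := mul_le_mul_of_nonneg_left
      (norm_sub_le_norm_sub_add_norm_sub (S i t s) (S j u s') (S j t s')) hp.le
    rw [norm_sub_rev (S j u s')] at this
    linarith [hS.variation j t u hp hle h3' s' hs']
  have b4 : t * ‖S' i t s - S' j u s'‖ ≤ t * ‖S' i t s - S' j t s'‖ + M * (u - t) := by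
    have := mul_le_mul_of_nonneg_left
      (norm_sub_le_norm_sub_add_norm_sub (S' i t s) (S' j t s') (S' j u s')) hp.le
    linarith [hS'.variation j t u hp hle h3' s' hs']
  have b5 : t * ‖S' i t s - S' j t s'‖ ≤ M * (t * ‖S i t s - S j t s'‖) := by
    have := mul_le_mul_of_nonneg_left (h i j t hp h3 s hs s' hs') hp.le
    linarith
  have b6 := norm_lift_sub_le (u := u) hp.le (S' i t s) (S' j u s')
  rw [← e2, ← e4, abs_sub_comm, abs_of_nonneg (sub_nonneg.2 hle)] at b6
  have b7 := mul_le_mul_of_nonneg_left (b3.trans (add_le_add_left b2 _)) hM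
  have b8 : (1 + M + M ^ 2) * (u - t) ≤ (1 + M + M ^ 2) * ‖p - p'‖ := by gcongr
  linarith

/-- The cones over two families of curves are bi-Lipschitz equivalent if their parametrizations
have uniformly comparable distances. -/
theorem outerBiLipschitzEquiv_coneOver {J : Type*} {t₀ R M : ℝ} (hM : 0 ≤ M)
    {S S' : J → ℝ → ℝ → E3} (hS : FamBound t₀ R M S) (hS' : FamBound t₀ R M S')
    (h : ∀ i j t, 0 < t → t ≤ t₀ → ∀ s ∈ Icc (0 : ℝ) 1, ∀ s' ∈ Icc (0 : ℝ) 1,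
      ‖S' i t s - S' j t s'‖ ≤ M * ‖S i t s - S j t s'‖)
    (h' : ∀ i j t, 0 < t → t ≤ t₀ → ∀ s ∈ Icc (0 : ℝ) 1, ∀ s' ∈ Icc (0 : ℝ) 1,
      ‖S i t s - S j t s'‖ ≤ M * ‖S' i t s - S' j t s'‖)
    (hsa : IsSemialgebraic {z : EuclideanSpace ℝ (Fin 4 ⊕ Fin 4) |
      (WithLp.toLp 2 fun i => z (Sum.inl i), WithLp.toLp 2 fun i => z (Sum.inr i)) ∈
        matching t₀ S S'}) :
    OuterBiLipschitzEquiv (coneOver t₀ (famSet S)) (coneOver t₀ (famSet S')) := by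
  classical
  set K := 1 + M + M ^ 2 + M * (4 * (1 + R ^ 2))
  have hK : 0 < K := by positivity
  have hlip : ∀ {p q p' q' : E4}, (p, q) ∈ matching t₀ S S' → (p', q') ∈ matching t₀ S S' →
      ‖q - q'‖ ≤ K * ‖p - p'‖ := fun h1 h2 => matching_lipschitz hM hS hS' h h1 h2
  have hlip' : ∀ {p q p' q' : E4}, (p, q) ∈ matching t₀ S S' → (p', q') ∈ matching t₀ S S' →
      ‖p - p'‖ ≤ K * ‖q - q'‖ := fun h1 h2 =>
    matching_lipschitz hM hS' hS h' (matching_symm h1) (matching_symm h2)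
  have huniq : ∀ {p q q' : E4}, (p, q) ∈ matching t₀ S S' → (p, q') ∈ matching t₀ S S' →
      q = q' := fun h1 h2 => by
    have := hlip h1 h2
    rw [sub_self, norm_zero, mul_zero] at this
    exact sub_eq_zero.1 (norm_le_zero_iff.1 this)
  -- The Lipschitz bound makes `matching` single-valued even where several pieces or parameters
  -- describe the same point, so any choice defines the map.
  set H : E4 → E4 := fun p => if hp : ∃ q, (p, q) ∈ matching t₀ S S' then hp.choose else 0
  have hH : ∀ p ∈ coneOver t₀ (famSet S), (p, H p) ∈ matching t₀ S S' := fun p hp => by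
    have hp := exists_matching S S' hp
    simp only [H, dif_pos hp]
    exact hp.choose_spec
  refine ⟨univ, univ_mem, univ, univ_mem, H, ?_, ?_, ?_, ?_⟩
  · simp only [inter_univ]
    refine ⟨fun p hp => mem_coneOver_of_matching (matching_symm (hH p hp)),
      fun p hp p' hp' he => ?_, fun q hq => ?_⟩
    · have := hlip' (hH p hp) (hH p' hp')
      rw [he, sub_self, norm_zero, mul_zero] at this
      exact sub_eq_zero.1 (norm_le_zero_iff.1 this)
    · obtain ⟨p, hp⟩ := exists_matching S' S hq
      have hp := matching_symm hp
      have hpX := mem_coneOver_of_matching hp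
      exact ⟨p, hpX, huniq (hH p hpX) hp⟩
  · exact huniq (hH 0 (Or.inl rfl)) (Or.inl ⟨rfl, rfl⟩)
  · refine ⟨K, hK, fun p hp p' hp' => ?_⟩
    rw [inter_univ] at hp hp'
    rw [dist_eq_norm, dist_eq_norm]
    refine ⟨?_, hlip (hH p hp) (hH p' hp')⟩
    rw [inv_mul_le_iff₀ hK]
    exact hlip' (hH p hp) (hH p' hp')
  · unfold IsSemialgebraicMapOn
    convert hsa using 1
    ext z
    simp only [graphOver, inter_univ]
    constructor
    · rintro ⟨h1, h2⟩
      have := hH _ h1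
      rw [h2] at this
      exact this
    · intro hz
      have hz' := mem_coneOver_of_matching hz
      exact ⟨hz', huniq (hH _ hz') hz⟩

theorem mem_matching_self {J : Type*} {t₀ : ℝ} {S : J → ℝ → ℝ → E3} {p : E4} :
    (p, p) ∈ matching t₀ S S ↔ p ∈ coneOver t₀ (famSet S) := by
  refine ⟨mem_coneOver_of_matching, ?_⟩
  rintro (rfl | ⟨h1, h2, h3⟩)
  · exact Or.inl ⟨rfl, rfl⟩
  · obtain ⟨j, s, hs, h4⟩ := mem_iUnion.1 h3
    exact Or.inr ⟨h1, h1, h2, rfl, j, s, hs, h4.symm, h4.symm⟩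

theorem isSemialgebraic_coneOver {J : Type*} {t₀ : ℝ} {S : J → ℝ → ℝ → E3}
    (hsa : IsSemialgebraic {z : EuclideanSpace ℝ (Fin 4 ⊕ Fin 4) |
      (WithLp.toLp 2 fun i => z (Sum.inl i), WithLp.toLp 2 fun i => z (Sum.inr i)) ∈
        matching t₀ S S}) : IsSemialgebraic (coneOver t₀ (famSet S)) := by
  have := hsa.preimage (φ := fun p : E4 => WithLp.toLp 2 (Sum.elim (fun i => p i) fun i => p i))
    (by rintro (i | i) <;> exact IsPoly.coord i)
  convert this using 1
  ext p
  exact mem_matching_self.symm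

/-- A family of segments whose endpoints depend on a root of the parameter. -/
def segFam {J : Type*} (N : ℕ) (a b : J → ℝ → E3) (j : J) (t s : ℝ) : E3 :=
  a j (posRoot N t) + s • (b j (posRoot N t) - a j (posRoot N t))

theorem posRoot_two_norm_sq {E : Type*} [NormedAddCommGroup E] (p : E) :
    posRoot 2 (‖p‖ ^ 2) = ‖p‖ := by
  have h := posRoot_pow two_ne_zero (sq_nonneg ‖p‖)
  exact (pow_left_inj₀ (posRoot_nonneg _ _) (norm_nonneg _) two_ne_zero).1 h

theorem chart_eq_iff {p : E4} (hp : 0 < p 3) (y : E3) :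
    chart p = y ↔ ∀ c : Fin 3, p c.castSucc = p 3 * y c := by
  have hne := hp.ne'
  have : ∀ c : Fin 3, chart p c = p c.castSucc / p 3 := fun c => by
    fin_cases c <;> simp [chart]
  constructor
  · rintro rfl c
    rw [this, mul_div_cancel₀ _ hne]
  · intro h
    ext c
    rw [this, h, mul_div_cancel_left₀ _ hne]

/-- With the root of the norm as an extra coordinate and the denominators of `chart` cleared, the
matching condition is polynomial in the points and affine in the segment parameter. -/
theorem isSemialgebraic_matching {J : Type*} [Finite J] {N : ℕ} (hN : N ≠ 0) {t₀ : ℝ}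
    (ht₀ : 0 ≤ t₀) {a b a' b' : J → ℝ → E3}
    (ha : ∀ j c, IsPoly fun z : EuclideanSpace ℝ (Option (Fin 4 ⊕ Fin 4)) => a j (z none) c)
    (hb : ∀ j c, IsPoly fun z : EuclideanSpace ℝ (Option (Fin 4 ⊕ Fin 4)) => b j (z none) c)
    (ha' : ∀ j c, IsPoly fun z : EuclideanSpace ℝ (Option (Fin 4 ⊕ Fin 4)) => a' j (z none) c)
    (hb' : ∀ j c, IsPoly fun z : EuclideanSpace ℝ (Option (Fin 4 ⊕ Fin 4)) => b' j (z none) c) :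
    IsSemialgebraic {z : EuclideanSpace ℝ (Fin 4 ⊕ Fin 4) |
      (WithLp.toLp 2 fun i => z (Sum.inl i), WithLp.toLp 2 fun i => z (Sum.inr i)) ∈
        matching t₀ (segFam N a b) (segFam N a' b')} := by
  set F : J → Fin 3 ⊕ Fin 3 → EuclideanSpace ℝ (Option (Fin 4 ⊕ Fin 4)) → ℝ := fun j k z =>
    Sum.elim (fun c => z (some (.inl 3)) * a j (z none) c - z (some (.inl c.castSucc)))
      (fun c => z (some (.inr 3)) * a' j (z none) c - z (some (.inr c.castSucc))) k
  set G : J → Fin 3 ⊕ Fin 3 → EuclideanSpace ℝ (Option (Fin 4 ⊕ Fin 4)) → ℝ := fun j k z =>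
    Sum.elim (fun c => z (some (.inl 3)) * (b j (z none) c - a j (z none) c))
      (fun c => z (some (.inr 3)) * (b' j (z none) c - a' j (z none) c)) k
  have hF : ∀ j k, IsPoly (F j k) := by
    rintro j (c | c) <;> simp only [F, Sum.elim_inl, Sum.elim_inr] <;> fun_prop
  have hG : ∀ j k, IsPoly (G j k) := by
    rintro j (c | c) <;> simp only [G, Sum.elim_inl, Sum.elim_inr] <;> fun_prop
  have hp2 : IsPoly fun z : EuclideanSpace ℝ (Option (Fin 4 ⊕ Fin 4)) =>
      ∑ i, z (some (.inl i)) ^ 2 := IsPoly.sum _ fun i => by fun_prop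
  have hq2 : IsPoly fun z : EuclideanSpace ℝ (Option (Fin 4 ⊕ Fin 4)) =>
      ∑ i, z (some (.inr i)) ^ 2 := IsPoly.sum _ fun i => by fun_prop
  have hg : IsPoly fun z : EuclideanSpace ℝ (Fin 4 ⊕ Fin 4) => ∑ i, z (.inl i) ^ 2 :=
    IsPoly.sum _ fun i => by fun_prop
  have hS : IsSemialgebraic {z : EuclideanSpace ℝ (Option (Fin 4 ⊕ Fin 4)) |
      (∀ i, z (some i) = 0) ∨ (0 < z (some (.inl 3)) ∧ 0 < z (some (.inr 3)) ∧
        ∑ i, z (some (.inl i)) ^ 2 ≤ t₀ ^ 2 ∧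
        ∑ i, z (some (.inr i)) ^ 2 = ∑ i, z (some (.inl i)) ^ 2 ∧
        ∃ j, ∃ s ∈ Icc (0 : ℝ) 1, ∀ k, F j k z + s * G j k z = 0)} := by
    refine .or (.forall_finite fun i => .eq (by fun_prop) (by fun_prop))
      (.and (.lt (by fun_prop) (by fun_prop)) (.and (.lt (by fun_prop) (by fun_prop))
        (.and (.le hp2 (by fun_prop)) (.and (.eq hq2 hp2) (.exists_finite fun j => ?_)))))
    exact .exists_Icc (hF j) (hG j)
  -- The norm is not polynomial but its square is; the `N`-th root of `‖p‖` is the `2 * N`-th root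
  -- of `‖p‖ ^ 2`.
  convert hS.root (N := 2 * N) (by omega) hg using 1
  ext z
  set p : E4 := WithLp.toLp 2 fun i => z (Sum.inl i) with hp
  set q : E4 := WithLp.toLp 2 fun i => z (Sum.inr i) with hq
  have hpi : ∀ i, z (.inl i) = p i := fun i => rfl
  have hqi : ∀ i, z (.inr i) = q i := fun i => rfl
  have hpn : ∑ i, p i ^ 2 = ‖p‖ ^ 2 := by rw [EuclideanSpace.norm_sq_eq]; simp
  have hqn : ∑ i, q i ^ 2 = ‖q‖ ^ 2 := by rw [EuclideanSpace.norm_sq_eq]; simp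
  simp only [mem_ofPred_eq, optExt_some, optExt_none, hpi, hqi, hpn, hqn, posRoot_mul,
    posRoot_two_norm_sq, Sum.forall, matching, F, G, Sum.elim_inl, Sum.elim_inr]
  rw [pow_le_pow_iff_left₀ (norm_nonneg _) ht₀ two_ne_zero,
    pow_left_inj₀ (norm_nonneg _) (norm_nonneg _) two_ne_zero]
  refine or_congr ?_ (and_congr_right fun h1 => and_congr_right fun h2 => and_congr_right fun _ =>
    and_congr_right fun _ => exists_congr fun j => exists_congr fun s =>
    and_congr_right fun _ => ?_)
  · refine and_congr ⟨fun h i => ?_, fun h => ?_⟩ ⟨fun h i => ?_, fun h => ?_⟩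
    · exact congrArg (fun v : E4 => v i) h
    · ext i; exact h i
    · exact congrArg (fun v : E4 => v i) h
    · ext i; exact h i
  · rw [chart_eq_iff h1, chart_eq_iff h2]
    refine and_congr (forall_congr' fun c => ?_) (forall_congr' fun c => ?_) <;>
    · simp only [segFam, PiLp.add_apply, PiLp.smul_apply, PiLp.sub_apply, smul_eq_mul]
      constructor <;> intro h <;> linarith

/-- The tangent cone of the cone over a family which converges to a closed set. -/
theorem sphereSection_tangentCone {t₀ R : ℝ} (ht₀ : 0 < t₀) {C : ℝ → Set E3} {P : Set E3}
    (hP : IsClosed P) (hR : ∀ t, 0 < t → t ≤ t₀ → ∀ y ∈ C t, ‖y‖ ≤ R)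
    (h1 : ∀ e > 0, ∀ᶠ t in 𝓝[>] (0 : ℝ), ∀ y ∈ C t, ∃ x ∈ P, ‖y - x‖ ≤ e)
    (h2 : ∀ x ∈ P, ∃ y : ℝ → E3, (∀ t, 0 < t → t ≤ t₀ → y t ∈ C t) ∧
      Tendsto y (𝓝[>] 0) (𝓝 x)) {ε : ℝ} (hε : 0 < ε) :
    sphereSection (tangentCone (coneOver t₀ C)) ε = inSphere P := by
  ext u
  rw [mem_inSphere]
  constructor
  · rintro ⟨x, c, hx, hc, hx0, hcx⟩
    have hn : Tendsto (fun n => ‖c n • x n‖) atTop (𝓝 ε) := by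
      have := hcx.norm
      rwa [norm_smul, mem_sphere_zero_iff_norm.1 u.2, mul_one, Real.norm_of_nonneg hε.le] at this
    -- The limit has norm `ε > 0`, so the vertex of the cone occurs only finitely often in the
    -- sequence.
    have hev : ∀ᶠ n in atTop, 0 < ‖x n‖ ∧ 0 < x n 3 ∧ ‖x n‖ ≤ t₀ ∧ chart (x n) ∈ C ‖x n‖ := by
      filter_upwards [hn.eventually (lt_mem_nhds hε)] with n h
      have h0 : x n ≠ 0 := by
        rintro h0
        rw [h0, smul_zero, norm_zero] at h
        exact lt_irrefl _ h
      exact ⟨norm_pos_iff.2 h0, (hx n).resolve_left h0⟩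
    have hu : Tendsto (fun n => ‖c n • x n‖⁻¹ • c n • x n) atTop (𝓝 u.1) := by
      have := (hn.inv₀ hε.ne').smul hcx
      rwa [smul_smul, inv_mul_cancel₀ hε.ne', one_smul] at this
    have hu' : Tendsto (fun n => ((hemi (chart (x n))).1 : E4)) atTop (𝓝 u.1) := by
      refine hu.congr' ?_
      filter_upwards [hev] with n ⟨h, h3, _⟩
      rw [norm_smul, Real.norm_of_nonneg (hc n).le, mul_inv, smul_smul, mul_right_comm,
        inv_mul_cancel₀ (hc n).ne', one_mul]
      nth_rewrite 2 [← smul_hemi_chart h3]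
      rw [smul_smul, inv_mul_cancel₀ h.ne', one_smul]
    -- The sections stay in a fixed ball of the chart, so their directions stay away from the
    -- equator and the limit direction has a chart.
    have hu3 : 0 < u.1 3 := by
      have hlim : Tendsto (fun n => (hemi (chart (x n))).1 3) atTop (𝓝 (u.1 3)) :=
        ((PiLp.continuous_apply 2 _ 3).tendsto _).comp hu'
      refine lt_of_lt_of_le (b := (√(1 + R ^ 2))⁻¹) (by positivity)
        (ge_of_tendsto hlim ?_)
      filter_upwards [hev] with n ⟨h, h3, h4, h5⟩
      rw [hemi_apply_three]
      have := hR _ h h4 _ h5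
      gcongr
    refine ⟨hu3, ?_⟩
    have hch : Tendsto (fun n => chart (x n)) atTop (𝓝 (chart u.1)) := by
      have := (continuousAt_chart hu3).tendsto.comp hu'
      simpa [Function.comp_def] using this
    refine hP.closure_subset (Metric.mem_closure_iff.2 fun e he => ?_)
    have hx0' : Tendsto (fun n => ‖x n‖) atTop (𝓝[>] 0) := by
      refine tendsto_nhdsWithin_iff.2 ⟨by simpa using hx0.norm, ?_⟩
      filter_upwards [hev] with n h using h.1
    obtain ⟨n, hn1, hn2, hn3⟩ := ((hx0'.eventually (h1 (e / 2) (half_pos he))).and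
      (hev.and (hch.eventually (Metric.ball_mem_nhds _ (half_pos he))))).exists
    obtain ⟨y, hy, hxy⟩ := hn1 _ hn2.2.2.2
    refine ⟨y, hy, ?_⟩
    rw [dist_comm] at hn3
    rw [← dist_eq_norm] at hxy
    linarith [dist_triangle (chart u.1) (chart (x n)) y]
  · rintro ⟨h3, hx⟩
    obtain ⟨y, hy, hyx⟩ := h2 _ hx
    set t : ℕ → ℝ := fun n => t₀ / (n + 1)
    have ht : ∀ n, 0 < t n := fun n => by positivity
    have ht' : ∀ n, t n ≤ t₀ := fun n => div_le_self ht₀.le (by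
      have : (0 : ℝ) ≤ n := n.cast_nonneg
      linarith)
    have htl : Tendsto t atTop (𝓝 0) := by
      have := (tendsto_one_div_add_atTop_nhds_zero_nat (𝕜 := ℝ)).const_mul t₀
      simpa [t, div_eq_mul_inv] using this
    have hcontains : ∀ n, lift (t n) (y (t n)) ∈ coneOver t₀ C := fun n => by
      refine Or.inr ⟨lift_pos (ht n) _, ?_, ?_⟩
      · rw [norm_lift (ht n).le]; exact ht' n
      · rw [chart_lift (ht n).ne', norm_lift (ht n).le]; exact hy _ (ht n) (ht' n)
    refine ⟨fun n => lift (t n) (y (t n)), fun n => ε / t n, hcontains,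
      fun n => div_pos hε (ht n), ?_, ?_⟩
    · rw [tendsto_zero_iff_norm_tendsto_zero]
      simpa only [fun n => norm_lift (ht n).le (y (t n))] using htl
    · have h4 : Tendsto (fun n => y (t n)) atTop (𝓝 (chart u.1)) :=
        hyx.comp (tendsto_nhdsWithin_iff.2 ⟨htl, Eventually.of_forall ht⟩)
      have h5 : Tendsto (fun n => ε • (hemi (y (t n))).1) atTop (𝓝 (ε • (hemi (chart u.1)).1)) :=
        (((continuous_subtype_val.comp continuous_hemi).tendsto _).comp h4).const_smul ε
      rw [hemi_chart h3] at h5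
      refine h5.congr fun n => ?_
      change _ = (ε / t n) • (t n • _)
      rw [smul_smul, div_mul_cancel₀ _ (ht n).ne']

/-! ### The dimension of the cones -/

theorem dimH_coneOver_le {J : Type*} [Finite J] {t₀ R M : ℝ} (ht₀ : 0 ≤ t₀) (hM : 0 ≤ M)
    {S : J → ℝ → ℝ → E3} (hS : FamBound t₀ R M S)
    (hs : ∀ j t, 0 < t → t ≤ t₀ → ∀ s ∈ Icc (0 : ℝ) 1, ∀ s' ∈ Icc (0 : ℝ) 1,
      ‖S j t s - S j t s'‖ ≤ M * |s - s'|) :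
    dimH (coneOver t₀ (famSet S)) ≤ 2 := by
  have : Countable J := Finite.to_countable
  have hsub : coneOver t₀ (famSet S) ⊆
      {0} ∪ ⋃ j, (fun x : ℝ × ℝ => lift x.1 (S j x.1 x.2)) '' (Ioc 0 t₀ ×ˢ Icc 0 1) := by
    rintro p (rfl | ⟨h1, h2, h3⟩)
    · exact Or.inl rfl
    · obtain ⟨j, s, hs, h4⟩ := mem_iUnion.1 h3
      have hp : 0 < ‖p‖ := norm_pos_iff.2 (by rintro rfl; simp at h1)
      refine Or.inr (mem_iUnion.2 ⟨j, (‖p‖, s), ⟨⟨hp, h2⟩, hs⟩, ?_⟩)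
      dsimp only
      rw [h4, lift_chart h1]
  refine (dimH_mono hsub).trans ?_
  rw [dimH_union, dimH_singleton, dimH_iUnion]
  refine max_le zero_le (iSup_le fun j => ?_)
  -- Each piece is the image of a planar rectangle under the map of radius and segment parameter.
  -- The factor `t` of the lift absorbs the unbounded derivative of the roots.
  have hlip : LipschitzOnWith (Real.toNNReal (1 + M + t₀ * M))
      (fun x : ℝ × ℝ => lift x.1 (S j x.1 x.2)) (Ioc 0 t₀ ×ˢ Icc 0 1) := by
    refine LipschitzOnWith.of_dist_le_mul ?_
    rintro ⟨t, s⟩ ⟨ht, hs1⟩ ⟨u, s'⟩ ⟨hu, hs2⟩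
    dsimp only at ht hs1 hu hs2 ⊢
    rw [Real.coe_toNNReal _ (by positivity)]
    wlog hle : t ≤ u generalizing t u s s'
    · rw [dist_comm, dist_comm (t, s)]
      exact this u s' hu hs2 t s ht hs1 (le_of_not_ge hle)
    have b1 := norm_lift_sub_le (u := u) ht.1.le (S j t s) (S j u s')
    have b2 := hS.variation j t u ht.1 hle hu.2 s' hs2
    have b3 := mul_le_mul_of_nonneg_left
      (norm_sub_le_norm_sub_add_norm_sub (S j t s) (S j t s') (S j u s')) ht.1.le
    have b4 := mul_le_mul_of_nonneg_left (hs j t ht.1 ht.2 s hs1 s' hs2) ht.1.le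
    have d1 : |t - u| ≤ dist (t, s) (u, s') := le_max_left _ _
    have d2 : |s - s'| ≤ dist (t, s) (u, s') := le_max_right _ _
    have b5 : t * (M * |s - s'|) ≤ t₀ * (M * dist (t, s) (u, s')) := by
      gcongr
      exact ht.2
    have b6 : u - t = |t - u| := by rw [abs_sub_comm, abs_of_nonneg (sub_nonneg.2 hle)]
    rw [b6] at b2
    have b7 : (1 + M) * |t - u| ≤ (1 + M) * dist (t, s) (u, s') := by gcongr
    rw [dist_eq_norm (lift t _)]
    linarith
  refine hlip.dimH_image_le.trans ((dimH_mono (subset_univ _)).trans ?_)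
  rw [Real.dimH_univ_eq_finrank]
  simp

theorem le_dimH_coneOver {t₀ r : ℝ} (ht₀ : 0 < t₀) (hr : 0 < r) {C : ℝ → Set E3}
    (h : ∀ t, 0 < t → t ≤ t₀ → ∀ x ∈ Icc (1 : ℝ) 2, ∃ y ∈ C t, y 0 = x) :
    2 ≤ dimH (coneOver t₀ C ∩ ball 0 r) := by
  -- A `C¹` map does not raise the Hausdorff dimension, and this one covers an open rectangle. The
  -- norm is squared to make it polynomial.
  set f : E4 → ℝ × ℝ := fun p => (‖p‖ ^ 2, p 0 / p 3)
  have hf : ContDiffOn ℝ 1 f {p | 0 < p 3} := by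
    have h0 : ContDiff ℝ 1 fun p : E4 => p 0 := contDiff_piLp_apply (p := 2)
    have h3 : ContDiff ℝ 1 fun p : E4 => p 3 := contDiff_piLp_apply (p := 2)
    exact (contDiff_norm_sq ℝ).contDiffOn.prodMk
      (h0.contDiffOn.div h3.contDiffOn fun p hp => (ne_of_gt hp))
  have hconv : Convex ℝ {p : E4 | 0 < p 3} := by
    intro x hx y hy a b ha hb hab
    simp only [mem_ofPred_eq, PiLp.add_apply, PiLp.smul_apply, smul_eq_mul] at *
    rcases ha.eq_or_lt with rfl | ha
    · rw [zero_add] at hab; subst hab; simpa using hy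
    · have := mul_pos ha hx
      have := mul_nonneg hb hy.le
      linarith
  have himg : Ioo (0 : ℝ) (min r t₀ ^ 2) ×ˢ Ioo (1 : ℝ) 2 ⊆
      f '' (coneOver t₀ C ∩ ball 0 r ∩ {p | 0 < p 3}) := by
    rintro ⟨v, x⟩ ⟨⟨hv0, hv1⟩, hx⟩
    dsimp only at hv0 hv1 hx
    have hm : 0 < min r t₀ := lt_min hr ht₀
    have ht : 0 < √v := Real.sqrt_pos.2 hv0
    have ht1 : √v < min r t₀ := (Real.sqrt_lt' hm).2 hv1
    obtain ⟨y, hy, rfl⟩ := h (√v) ht (ht1.le.trans (min_le_right _ _)) x ⟨hx.1.le, hx.2.le⟩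
    refine ⟨lift √v y, ⟨⟨Or.inr ⟨lift_pos ht y, ?_, ?_⟩, ?_⟩, lift_pos ht y⟩, ?_⟩
    · rw [norm_lift ht.le]; exact ht1.le.trans (min_le_right _ _)
    · rwa [norm_lift ht.le, chart_lift ht.ne']
    · rw [mem_ball_zero_iff, norm_lift ht.le]; exact ht1.trans_le (min_le_left _ _)
    · simp only [f]
      rw [norm_lift ht.le, Real.sq_sqrt hv0.le]
      congr 1
      exact congrArg (fun z : E3 => z 0) (chart_lift ht.ne' y)
  calc (2 : ENNReal) = Module.finrank ℝ (ℝ × ℝ) := by simp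
    _ = dimH (Ioo (0 : ℝ) (min r t₀ ^ 2) ×ˢ Ioo (1 : ℝ) 2) := by
      refine (Real.dimH_of_nonempty_interior ?_).symm
      rw [(isOpen_Ioo.prod isOpen_Ioo).interior_eq]
      have hm : 0 < min r t₀ := lt_min hr ht₀
      exact (nonempty_Ioo.2 (by positivity)).prod (nonempty_Ioo.2 one_lt_two)
    _ ≤ _ := dimH_mono himg
    _ ≤ _ := hf.dimH_image_le hconv inter_subset_right
    _ ≤ _ := dimH_mono inter_subset_left

/-! ### The isotopy type of the links of the construction -/

/-- The loop of the construction. -/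
def loopSet (r : ℕ) (l : ℕ → E3) (ρ : ℝ) : Set E3 :=
  ⋃ i : Fin r, segment ℝ (!₂[1, ρ, 0] + ρ • flip (l i)) (!₂[1, ρ, 0] + ρ • flip (l (i + 1)))

/-- The part of the construction outside the band over the arc and the left half of the wedge. -/
def coreSet (r : ℕ) (l : ℕ → E3) (ρ g : ℝ) : Set E3 :=
  segment ℝ !₂[1, ρ, 0] !₂[g, 0, 0] ∪ segment ℝ !₂[g, 0, 0] !₂[1, -ρ, 0] ∪
    segment ℝ !₂[1, -ρ, 0] !₂[2, -ρ, 0] ∪ segment ℝ !₂[2, ρ, 0] !₂[1 + ρ, ρ, 0] ∪ loopSet r l ρ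

/-- The edges before the vertex `i` of the two sides of the band. -/
def sidesSet (k : ℕ → E3) (ρ : ℝ) (i : ℕ) : Set E3 :=
  ⋃ j : Fin i, (segment ℝ (k j + ρ • bandDir) (k (j + 1) + ρ • bandDir) ∪
    segment ℝ (k j - ρ • bandDir) (k (j + 1) - ρ • bandDir))

/-- The links of the construction. -/
def linkSet (m r : ℕ) (k l : ℕ → E3) (ρ g : ℝ) : Set E3 :=
  ⋃ j : Piece m r, segment ℝ (pieceStart k l ρ j) (pieceEnd k l ρ g j)

theorem linkSet_eq (m r : ℕ) (k l : ℕ → E3) (ρ g : ℝ) :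
    linkSet m r k l ρ g = coreSet r l ρ g ∪ sidesSet k ρ m ∪
      (segment ℝ !₂[-1, ρ, 0] !₂[-g, 0, 0] ∪ segment ℝ !₂[-g, 0, 0] !₂[-1, -ρ, 0]) := by
  have hneg : ∀ x : E3, x + (-1 * ρ) • bandDir = x - ρ • bandDir := fun x => by module
  ext x
  simp only [linkSet, coreSet, sidesSet, loopSet, mem_union, mem_iUnion, Sum.exists, Prod.exists,
    Bool.exists_bool, pieceStart, pieceEnd, side, cond_true, cond_false, one_mul, hneg,
    Fin.exists_fin_succ, IsEmpty.exists_iff, or_false]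
  simp
  rw [segment_symm ℝ !₂[g, 0, 0], segment_symm ℝ !₂[-g, 0, 0], segment_symm ℝ !₂[2, ρ, 0]]
  have hor : ∀ {ι : Type} (p q : ι → Prop), (∃ i, p i ∨ q i) ↔ ∃ i, q i ∨ p i := fun p q => by
    simp only [or_comm]
  rw [hor]
  have key : ∀ a b c d e f s t : Prop, (a ∨ b ∨ c ∨ d ∨ e ∨ f) ∨ s ∨ t ↔
      (((((c ∨ d) ∨ e) ∨ f) ∨ t) ∨ s) ∨ a ∨ b := by tauto
  exact key _ _ _ _ _ _ _ _

theorem isSegmentUnion_loopSet (r : ℕ) (l : ℕ → E3) (ρ : ℝ) : IsSegmentUnion (loopSet r l ρ) :=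
  .iUnion fun _ => isSegmentUnion_segment _ _

theorem isSegmentUnion_coreSet (r : ℕ) (l : ℕ → E3) (ρ g : ℝ) :
    IsSegmentUnion (coreSet r l ρ g) :=
  ((((isSegmentUnion_segment _ _).union (isSegmentUnion_segment _ _)).union
    (isSegmentUnion_segment _ _)).union (isSegmentUnion_segment _ _)).union
    (isSegmentUnion_loopSet r l ρ)

theorem isSegmentUnion_sidesSet (k : ℕ → E3) (ρ : ℝ) (i : ℕ) :
    IsSegmentUnion (sidesSet k ρ i) :=
  .iUnion fun _ => (isSegmentUnion_segment _ _).union (isSegmentUnion_segment _ _)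

theorem sidesSet_succ (k : ℕ → E3) (ρ : ℝ) (i : ℕ) :
    sidesSet k ρ (i + 1) = sidesSet k ρ i ∪
      (segment ℝ (k i + ρ • bandDir) (k (i + 1) + ρ • bandDir) ∪
        segment ℝ (k i - ρ • bandDir) (k (i + 1) - ρ • bandDir)) := by
  ext x
  simp only [sidesSet, mem_iUnion, Fin.exists_fin_succ', mem_union, Fin.val_castSucc, Fin.val_last]

theorem mem_segment_coord {x y u v : ℝ} {z : E3}
    (h : z ∈ segment ℝ (!₂[x, y, 0] : E3) !₂[u, v, 0]) :
    ∃ s ∈ Icc (0 : ℝ) 1, z 0 = x + s * (u - x) ∧ z 1 = y + s * (v - y) ∧ z 2 = 0 := by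
  rw [segment_eq_image'] at h
  obtain ⟨s, hs, rfl⟩ := h
  exact ⟨s, hs, by simp⟩

theorem mem_sidesSet {k : ℕ → E3} {ρ : ℝ} {i m : ℕ} (hi : i ≤ m) {x : E3} (h : x ∈ sidesSet k ρ i) :
    ∃ j, j < i ∧ ∃ s ∈ Icc (0 : ℝ) 1, ∃ v, (v = ρ ∨ v = -ρ) ∧ x = edgePt m k j s + v • bandDir := by
  obtain ⟨j, h⟩ := mem_iUnion.1 h
  rcases h with h | h <;> rw [segment_eq_image'] at h <;> obtain ⟨s, hs, rfl⟩ := h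
  · refine ⟨j, j.2, s, hs, ρ, Or.inl rfl, ?_⟩
    rw [edgePt_of_lt k (by omega)]
    module
  · refine ⟨j, j.2, s, hs, -ρ, Or.inr rfl, ?_⟩
    rw [edgePt_of_lt k (by omega)]
    module

theorem E3_ext {x y : E3} (h0 : x 0 = y 0) (h1 : x 1 = y 1) (h2 : x 2 = y 2) : x = y := by
  ext c
  fin_cases c
  exacts [h0, h1, h2]

namespace BandArc

variable {m r : ℕ} {k l : ℕ → E3}

/-- By `exists_height` the arc of `l` touches the plane only at its ends, and `flip` turns it below
the plane. -/
theorem loopSet_cases (hl : BandArc r l) {ρ : ℝ} (hρ : 0 < ρ) {x : E3} (h : x ∈ loopSet r l ρ) :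
    x 2 < 0 ∨ x = !₂[1, ρ, 0] ∨ x = !₂[1 + ρ, ρ, 0] := by
  obtain ⟨i, h⟩ := mem_iUnion.1 h
  rw [segment_eq_image'] at h
  obtain ⟨s, hs, rfl⟩ := h
  have hr := hl.two_le
  have e : !₂[1, ρ, 0] + ρ • flip (l i) + s • (!₂[1, ρ, 0] + ρ • flip (l (i + 1)) -
      (!₂[1, ρ, 0] + ρ • flip (l i))) = loopPt r l ρ i s := by
    rw [loopPt, edgePt_of_lt l i.2]
    simp only [flip_eq]
    ext c
    fin_cases c <;> simp <;> ring
  simp only [e]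
  obtain ⟨c, hc, hz⟩ := hl.exists_height
  rcases (hl.edgePt_nonneg i hs).eq_or_lt with h0 | h0
  · right
    refine (hz i i.2 s hs).imp (fun h => ?_) (fun h => ?_)
    all_goals
      rw [← h0] at h
      have h := sub_eq_zero.1 (norm_le_zero_iff.1 ((mul_nonpos_iff_pos_imp_nonpos.1 h).1 hc))
    · rw [← hl.loopPt_zero ρ, loopPt, loopPt, h]
    · rw [← hl.loopPt_last ρ, loopPt, loopPt, h]
  · left
    rw [loopPt_apply_two]
    exact neg_lt_zero.2 (mul_pos hρ h0)

theorem coreSet_cases (hl : BandArc r l) {ρ g : ℝ} (hρ : 0 < ρ) (hρ1 : ρ < 1) (hg : 0 < g)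
    (hg1 : g < 1) {x : E3} (h : x ∈ coreSet r l ρ g) :
    x 2 < 0 ∨ x 2 = 0 ∧ 0 < x 0 ∧ x 0 ≤ 2 ∧ (x 0 = 2 → |x 1| = ρ) := by
  rcases h with (((h | h) | h) | h) | h
  · obtain ⟨s, ⟨h0, h1⟩, e0, e1, e2⟩ := mem_segment_coord h
    exact Or.inr ⟨e2, by nlinarith, by nlinarith, fun h => by nlinarith⟩
  · obtain ⟨s, ⟨h0, h1⟩, e0, e1, e2⟩ := mem_segment_coord h
    exact Or.inr ⟨e2, by nlinarith, by nlinarith, fun h => by nlinarith⟩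
  · obtain ⟨s, ⟨h0, h1⟩, e0, e1, e2⟩ := mem_segment_coord h
    refine Or.inr ⟨e2, by nlinarith, by nlinarith, fun h => ?_⟩
    rw [e1, sub_self, mul_zero, add_zero, abs_neg, abs_of_pos hρ]
  · obtain ⟨s, ⟨h0, h1⟩, e0, e1, e2⟩ := mem_segment_coord h
    refine Or.inr ⟨e2, by nlinarith, by nlinarith, fun h => ?_⟩
    rw [e1, sub_self, mul_zero, add_zero, abs_of_pos hρ]
  · refine (hl.loopSet_cases hρ h).imp_right fun h => ?_
    rcases h with rfl | rfl
    · simp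
    · simp
      exact ⟨by linarith, by linarith, fun h => by linarith⟩

/-- The points of the band over an edge which lie on preceding edges of the sides of the band. -/
theorem eq_of_mem_sidesSet {c : ℝ} (hc : 0 < c)
    (hband : ∀ i j, i ≤ j → j ≤ m → ∀ s ∈ Icc (0 : ℝ) 1, ∀ t ∈ Icc (0 : ℝ) 1, ∀ w : ℝ, |w| ≤ c →
      c * (modelDist m i j s t + |w|) ≤ ‖edgePt m k i s - edgePt m k j t + w • bandDir‖)
    {ρ : ℝ} (hρ : 0 < ρ) (hρc : 2 * ρ ≤ c)
    {i : ℕ} (hi : i ≤ m) {s w : ℝ} (hs : s ∈ Icc (0 : ℝ) 1) (hw : |w| ≤ ρ)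
    (him : i = m → s < 1) (h : edgePt m k i s + w • bandDir ∈ sidesSet k ρ i) :
    s = 0 ∧ |w| = ρ := by
  obtain ⟨j, hj, t, ht, v, hv, e⟩ := mem_sidesSet hi h
  have hv' : |v| = ρ := by rcases hv with rfl | rfl <;> simp [abs_of_pos hρ]
  have h1 := hband j i hj.le hi t ht s hs (v - w) (by
    -- Two points of the band have transverse coordinates at most `2 * ρ` apart, which explains the
    -- hypothesis `hρc`.
    refine (abs_sub _ _).trans ?_
    linarith)
  have h2 : edgePt m k j t - edgePt m k i s + (v - w) • bandDir = 0 := by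
    have : edgePt m k j t - edgePt m k i s + (v - w) • bandDir =
      (edgePt m k j t + v • bandDir) - (edgePt m k i s + w • bandDir) := by module
    rw [this, e, sub_self]
  rw [h2, norm_zero] at h1
  replace h1 := (mul_nonpos_iff_pos_imp_nonpos.1 h1).1 hc
  have h3 := modelDist_nonneg (m := m) (i := j) (j := i) ht hs
  have h4 := abs_nonneg (v - w)
  have h5 : |v - w| = 0 := by linarith
  have h6 : modelDist m j i t s = 0 := by linarith
  have h7 := sub_eq_zero.1 (abs_eq_zero.1 h5)
  refine ⟨?_, by rw [← h7, hv']⟩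
  obtain ⟨ht0, ht1⟩ := ht
  obtain ⟨hs0, hs1⟩ := hs
  unfold modelDist at h6
  split_ifs at h6 with c1 c2 c3
  · omega
  · linarith
  · have := him c3.2
    linarith
  · norm_num at h6

/-- The points over an edge of the arc which lie on preceding edges or in the core. -/
theorem eq_of_mem (hk : BandArc m k) (hl : BandArc r l) {c : ℝ} (hc : 0 < c)
    (hband : ∀ i j, i ≤ j → j ≤ m → ∀ s ∈ Icc (0 : ℝ) 1, ∀ t ∈ Icc (0 : ℝ) 1, ∀ w : ℝ, |w| ≤ c →
      c * (modelDist m i j s t + |w|) ≤ ‖edgePt m k i s - edgePt m k j t + w • bandDir‖)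
    {ρ g : ℝ} (hρ : 0 < ρ) (hρ1 : ρ < 1) (hρc : 2 * ρ ≤ c) (hg : 0 < g) (hg1 : g < 1)
    {i : ℕ} (hi : i ≤ m) {s w : ℝ} (hs : s ∈ Icc (0 : ℝ) 1) (hw : |w| ≤ ρ)
    (him : i = m → 3 * s - 1 < 0)
    (h : edgePt m k i s + w • bandDir ∈ coreSet r l ρ g ∪ sidesSet k ρ i) :
    s = 0 ∧ |w| = ρ := by
  have hm := hk.two_le
  rcases h with h | h
  · have hz : (edgePt m k i s + w • bandDir) 2 = edgePt m k i s 2 :=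
      bandPt_apply_two m k i s w
    have hx : (edgePt m k i s + w • bandDir) 0 = edgePt m k i s 0 := by simp [bandDir]
    have hy : (edgePt m k i s + w • bandDir) 1 = edgePt m k i s 1 + w := by simp [bandDir]
    have hnn := hk.edgePt_nonneg i hs
    -- The core lies on or below the plane, in the part with positive first coordinate, and the arc
    -- lies on or above it. They can meet only over the first vertex; the hypothesis `him` keeps
    -- points over the closing edge in its left part.
    rcases hl.coreSet_cases hρ hρ1 hg hg1 h with h | ⟨h1, h2, h3, h4⟩
    · rw [hz] at h; linarith
    rw [hz] at h1
    rw [hx] at h2 h3 h4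
    rw [hy] at h4
    rcases hi.eq_or_lt with rfl | him''
    · rw [hk.edgePt_closing] at h2
      have := him rfl
      simp at h2
      linarith
    have him' : i + 1 ≤ m := him''
    rw [edgePt_apply, cyc_of_le k hi, cyc_of_le k him'] at h1 h2
    rw [edgePt_apply, edgePt_apply, cyc_of_le k hi, cyc_of_le k him'] at h4
    rcases Nat.eq_zero_or_pos i with rfl | h0
    · have hp := hk.pos 1 one_pos (by omega)
      rw [hk.first] at h1 h4
      have hs0 : s = 0 := by
        simp at h1
        rcases h1 with h1 | h1
        · exact h1
        · linarith
      subst hs0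
      simp at h4
      exact ⟨rfl, h4⟩
    · have hp := hk.pos i h0 him'
      have hp' := hk.nonneg him'
      exfalso
      have hs1 : s = 1 := by
        have e1 : 0 ≤ (1 - s) * k i 2 := mul_nonneg (sub_nonneg.2 hs.2) hp.le
        have e2 : 0 ≤ s * k (i + 1) 2 := mul_nonneg hs.1 hp'
        have e3 : (1 - s) * k i 2 = 0 := by linarith
        rcases mul_eq_zero.1 e3 with e | e <;> linarith
      subst hs1
      rw [sub_self, zero_mul, one_mul, zero_add] at h1 h2
      rcases him'.eq_or_lt with h5 | h5
      · rw [h5, hk.last] at h2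
        simp at h2
        linarith
      · have := hk.pos (i + 1) (by omega) h5
        linarith
  · exact eq_of_mem_sidesSet hc hband hρ hρc hi hs hw (fun h => by linarith [him h]) h

theorem edge_indep (hk : BandArc m k) {i : ℕ} (hi : i ≤ m) {a w : ℝ}
    (h : a • (cyc m k (i + 1) - cyc m k i) + w • bandDir = 0) : a = 0 ∧ w = 0 := by
  rcases le_total 0 a with ha | ha
  · exact hk.edge_cone hi ha h
  · have := hk.edge_cone hi (a := -a) (w := -w) (by linarith) (by
      rw [← neg_eq_zero, ← h]; module)
    exact ⟨neg_eq_zero.1 this.1, neg_eq_zero.1 this.2⟩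

end BandArc

namespace BandArc

variable {m r : ℕ} {k l : ℕ → E3}

/-- The two sides of the band can be pulled back over an edge of the arc. -/
theorem ambientIsotopic_band_step (hk : BandArc m k) (hl : BandArc r l) {c : ℝ} (hc : 0 < c)
    (hband : ∀ i j, i ≤ j → j ≤ m → ∀ s ∈ Icc (0 : ℝ) 1, ∀ t ∈ Icc (0 : ℝ) 1, ∀ w : ℝ, |w| ≤ c →
      c * (modelDist m i j s t + |w|) ≤ ‖edgePt m k i s - edgePt m k j t + w • bandDir‖)
    {ρ g : ℝ} (hρ : 0 < ρ) (hρ1 : ρ < 1) (hρc : 2 * ρ ≤ c) (hg : 0 < g) (hg1 : g < 1)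
    {i : ℕ} (hi : i < m) :
    AmbientIsotopic
      (inSphere (coreSet r l ρ g ∪ sidesSet k ρ (i + 1) ∪
        segment ℝ (k (i + 1) + ρ • bandDir) (k (i + 1) - ρ • bandDir)))
      (inSphere (coreSet r l ρ g ∪ sidesSet k ρ i ∪
        segment ℝ (k i + ρ • bandDir) (k i - ρ • bandDir))) := by
  set e := k (i + 1) - k i with he
  have hcyc : cyc m k (i + 1) - cyc m k i = e := by
    rw [cyc_of_le k hi, cyc_of_le k hi.le]
  have hedge : ∀ s, edgePt m k i s = k i + s • e := fun s => edgePt_of_lt k hi s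
  have hk1 : k (i + 1) = k i + e := by rw [he]; abel
  have hR : IsSegmentUnion (coreSet r l ρ g ∪ sidesSet k ρ i) :=
    (isSegmentUnion_coreSet r l ρ g).union (isSegmentUnion_sidesSet k ρ i)
  have hmem : ∀ s w, s ∈ Icc (0 : ℝ) 1 → |w| ≤ ρ →
      k i + s • e + w • bandDir ∈ coreSet r l ρ g ∪ sidesSet k ρ i → s = 0 ∧ |w| = ρ :=
    fun s w hs hw h => hk.eq_of_mem hl hc hband hρ hρ1 hρc hg hg1 hi.le hs hw
      (fun h => absurd h hi.ne) (by rwa [hedge])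
  -- The rectangle over the edge is divided by a diagonal. The first move crosses the triangle at
  -- the far end of the edge while the lower side stays in place; the second crosses the other
  -- triangle.
  have h1 : AmbientIsotopic
      (inSphere (coreSet r l ρ g ∪ sidesSet k ρ i ∪
        segment ℝ (k i - ρ • bandDir) (k (i + 1) - ρ • bandDir) ∪
        (segment ℝ (k i + ρ • bandDir) (k (i + 1) + ρ • bandDir) ∪
          segment ℝ (k (i + 1) + ρ • bandDir) (k (i + 1) - ρ • bandDir))))
      (inSphere (coreSet r l ρ g ∪ sidesSet k ρ i ∪
        segment ℝ (k i - ρ • bandDir) (k (i + 1) - ρ • bandDir) ∪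
        segment ℝ (k i + ρ • bandDir) (k (i + 1) - ρ • bandDir))) := by
    refine ambientIsotopic_triangle_move (hR.union (isSegmentUnion_segment _ _)) ?_ ?_
    · intro s t h
      have := hk.edge_indep hi.le (a := s + t) (w := -(2 * ρ * t)) (by
        rw [hcyc, ← h, hk1]; module)
      have ht : t = 0 := by
        have := this.2
        rw [neg_eq_zero, mul_eq_zero] at this
        exact this.resolve_left (by positivity)
      exact ⟨by linarith [this.1], ht⟩
    · rintro x ⟨⟨s, t, hs, ht, hst, rfl⟩, h⟩
      have ex : k i + ρ • bandDir + s • (k (i + 1) + ρ • bandDir - (k i + ρ • bandDir)) +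
          t • (k (i + 1) - ρ • bandDir - (k i + ρ • bandDir)) =
          k i + (s + t) • e + (ρ - 2 * ρ * t) • bandDir := by rw [hk1]; module
      rw [ex] at h ⊢
      have hw : |ρ - 2 * ρ * t| ≤ ρ := by
        rw [abs_le]; constructor <;> nlinarith
      rcases h with h | h
      · obtain ⟨h1, h2⟩ := hmem _ _ ⟨by linarith, hst⟩ hw h
        have ht0 : t = 0 := by linarith
        left
        rw [h1, ht0]
        module
      · right
        rw [segment_eq_image'] at h
        obtain ⟨u, hu, h⟩ := h
        have := hk.edge_indep hi.le (a := u - (s + t)) (w := -ρ - (ρ - 2 * ρ * t)) (by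
          have h3 := sub_eq_zero.2 h
          rw [hcyc, ← h3, hk1]; module)
        have ht1 : t = 1 := by
          have := this.2
          nlinarith
        have hs0 : s = 0 := by linarith
        rw [mem_singleton_iff, ht1, hs0, hk1]
        module
  have h2 : AmbientIsotopic
      (inSphere (coreSet r l ρ g ∪ sidesSet k ρ i ∪
        (segment ℝ (k i + ρ • bandDir) (k (i + 1) - ρ • bandDir) ∪
          segment ℝ (k (i + 1) - ρ • bandDir) (k i - ρ • bandDir))))
      (inSphere (coreSet r l ρ g ∪ sidesSet k ρ i ∪
        segment ℝ (k i + ρ • bandDir) (k i - ρ • bandDir))) := by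
    refine ambientIsotopic_triangle_move hR ?_ ?_
    · intro s t h
      have := hk.edge_indep hi.le (a := s) (w := -(2 * ρ * (s + t))) (by
        rw [hcyc, ← h, hk1]; module)
      have ht : s + t = 0 := by
        have := this.2
        rw [neg_eq_zero, mul_eq_zero] at this
        exact this.resolve_left (by positivity)
      exact ⟨this.1, by linarith [this.1]⟩
    · rintro x ⟨⟨s, t, hs, ht, hst, rfl⟩, h⟩
      have ex : k i + ρ • bandDir + s • (k (i + 1) - ρ • bandDir - (k i + ρ • bandDir)) +
          t • (k i - ρ • bandDir - (k i + ρ • bandDir)) =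
          k i + s • e + (ρ - 2 * ρ * (s + t)) • bandDir := by rw [hk1]; module
      rw [ex] at h ⊢
      have hw : |ρ - 2 * ρ * (s + t)| ≤ ρ := by
        rw [abs_le]; constructor <;> nlinarith
      obtain ⟨h1, h2⟩ := hmem _ _ ⟨hs, by linarith⟩ hw h
      subst h1
      rcases (abs_eq hρ.le).1 h2 with h3 | h3
      · left
        rw [h3]
        module
      · right
        rw [mem_singleton_iff, h3]
        module
  have e1 : ∀ A S P Q T : Set E3, A ∪ (S ∪ (P ∪ Q)) ∪ T = A ∪ S ∪ Q ∪ (P ∪ T) := by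
    intros; ac_rfl
  have e2 : ∀ A S P Q : Set E3, A ∪ S ∪ P ∪ Q = A ∪ S ∪ (Q ∪ P) := by
    intros; ac_rfl
  rw [sidesSet_succ, e1]
  refine h1.trans ?_
  rw [e2, segment_symm ℝ (k i - ρ • bandDir)]
  exact h2

/-- The band together with the left half of the wedge can be collapsed. -/
theorem ambientIsotopic_collapse (hk : BandArc m k) (hl : BandArc r l) {c : ℝ} (hc : 0 < c)
    (hband : ∀ i j, i ≤ j → j ≤ m → ∀ s ∈ Icc (0 : ℝ) 1, ∀ t ∈ Icc (0 : ℝ) 1, ∀ w : ℝ, |w| ≤ c →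
      c * (modelDist m i j s t + |w|) ≤ ‖edgePt m k i s - edgePt m k j t + w • bandDir‖)
    {ρ g : ℝ} (hρ : 0 < ρ) (hρ1 : ρ < 1) (hρc : 2 * ρ ≤ c) (hg : 0 < g) (hg1 : g < 1) :
    AmbientIsotopic (inSphere (linkSet m r k l ρ g))
      (inSphere (coreSet r l ρ g ∪ segment ℝ !₂[2, ρ, 0] !₂[2, -ρ, 0])) := by
  have hadd : ∀ x : ℝ, (!₂[x, 0, 0] : E3) + ρ • bandDir = !₂[x, ρ, 0] := fun x => by
    apply E3_ext <;> simp [bandDir]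
  have hsub : ∀ x : ℝ, (!₂[x, 0, 0] : E3) - ρ • bandDir = !₂[x, -ρ, 0] := fun x => by
    apply E3_ext <;> simp [bandDir]
  -- Once the left V has been straightened, the edges of the arc are removed from the last to the
  -- first; the end of the band then moves from abscissa `-1` to abscissa `2`.
  have key : ∀ i, i ≤ m → AmbientIsotopic
      (inSphere (coreSet r l ρ g ∪ sidesSet k ρ i ∪
        segment ℝ (k i + ρ • bandDir) (k i - ρ • bandDir)))
      (inSphere (coreSet r l ρ g ∪ segment ℝ !₂[2, ρ, 0] !₂[2, -ρ, 0])) := by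
    intro i
    induction i with
    | zero =>
      intro _
      have : sidesSet k ρ 0 = ∅ := iUnion_of_empty _
      rw [this, union_empty, hk.first, hadd, hsub]
      exact .refl _
    | succ i ih =>
      intro hi
      exact (hk.ambientIsotopic_band_step hl hc hband hρ hρ1 hρc hg hg1 hi).trans
        (ih (Nat.le_of_succ_le hi))
  refine AmbientIsotopic.trans ?_ (key m le_rfl)
  rw [linkSet_eq, hk.last, hadd, hsub]
  refine ambientIsotopic_triangle_move
    ((isSegmentUnion_coreSet r l ρ g).union (isSegmentUnion_sidesSet k ρ m)) ?_ ?_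
  · intro s t h
    have h0 := congrArg (fun v : E3 => v 0) h
    have h1 := congrArg (fun v : E3 => v 1) h
    simp at h0 h1
    have hs : s = 0 := h0.resolve_right (by linarith)
    subst hs
    simp at h1
    exact ⟨rfl, h1.resolve_right (by linarith)⟩
  · rintro x ⟨⟨s, t, hs, ht, hst, rfl⟩, h⟩
    have ex : (!₂[-1, ρ, 0] : E3) + s • (!₂[-g, 0, 0] - !₂[-1, ρ, 0]) +
        t • (!₂[-1, -ρ, 0] - !₂[-1, ρ, 0]) =
        edgePt m k m (s * (1 - g) / 3) + (ρ - ρ * s - 2 * ρ * t) • bandDir := by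
      rw [hk.edgePt_closing]
      apply E3_ext <;> simp [bandDir] <;> ring
    rw [ex] at h
    have hs1 : s ≤ 1 := by linarith
    have hsg : s * (1 - g) ≤ 1 * (1 - g) := by
      apply mul_le_mul_of_nonneg_right hs1; linarith
    obtain ⟨h1, h2⟩ := hk.eq_of_mem hl hc hband hρ hρ1 hρc hg hg1 le_rfl
      ⟨div_nonneg (mul_nonneg hs (by linarith)) (by norm_num), by linarith⟩
      (by rw [abs_le]; constructor <;> nlinarith) (fun _ => by linarith) h
    have hs0 : s = 0 := by
      have : s * (1 - g) = 0 := by linarith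
      exact (mul_eq_zero.1 this).resolve_right (by linarith)
    subst hs0
    rcases (abs_eq hρ.le).1 h2 with h3 | h3
    · left
      have : t = 0 := by
        have : ρ * t = 0 := by linarith
        exact (mul_eq_zero.1 this).resolve_left hρ.ne'
      rw [this]
      simp
    · right
      have : t = 1 := by
        have : ρ * (t - 1) = 0 := by linarith
        linarith [(mul_eq_zero.1 this).resolve_left hρ.ne']
      rw [mem_singleton_iff, this]
      simp

theorem mem_triangle_coord {a₀ a₁ b₀ b₁ c₀ c₁ : ℝ} {x : E3}
    (h : x ∈ triangle (!₂[a₀, a₁, 0] : E3) !₂[b₀, b₁, 0] !₂[c₀, c₁, 0]) :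
    ∃ s t : ℝ, 0 ≤ s ∧ 0 ≤ t ∧ s + t ≤ 1 ∧ x 0 = a₀ + s * (b₀ - a₀) + t * (c₀ - a₀) ∧
      x 1 = a₁ + s * (b₁ - a₁) + t * (c₁ - a₁) ∧ x 2 = 0 := by
  obtain ⟨s, t, hs, ht, hst, rfl⟩ := h
  exact ⟨s, t, hs, ht, hst, by simp⟩

theorem triangle_indep {a₀ a₁ b₀ b₁ c₀ c₁ : ℝ}
    (hd : (b₀ - a₀) * (c₁ - a₁) - (b₁ - a₁) * (c₀ - a₀) ≠ 0) (s t : ℝ)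
    (h : s • ((!₂[b₀, b₁, 0] : E3) - !₂[a₀, a₁, 0]) + t • (!₂[c₀, c₁, 0] - !₂[a₀, a₁, 0]) = 0) :
    s = 0 ∧ t = 0 := by
  have h0 := congrArg (fun v : E3 => v 0) h
  have h1 := congrArg (fun v : E3 => v 1) h
  simp at h0 h1
  constructor
  · refine (mul_eq_zero.1 ?_).resolve_right hd
    linear_combination (c₁ - a₁) * h0 - (c₀ - a₀) * h1
  · refine (mul_eq_zero.1 ?_).resolve_right hd
    linear_combination (b₀ - a₀) * h1 - (b₁ - a₁) * h0

/-- The core, closed up by a segment, is isotopic to the closed loop. -/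
theorem ambientIsotopic_core (hl : BandArc r l) {ρ g : ℝ} (hρ : 0 < ρ) (hρ1 : ρ < 1)
    (hg1 : g < 1) :
    AmbientIsotopic (inSphere (coreSet r l ρ g ∪ segment ℝ !₂[2, ρ, 0] !₂[2, -ρ, 0]))
      (inSphere (loopSet r l ρ ∪ segment ℝ !₂[1, ρ, 0] !₂[1 + ρ, ρ, 0])) := by
  set p₁ : E3 := !₂[g, 0, 0] with hp₁
  set p₂ : E3 := !₂[1, ρ, 0] with hp₂
  set p₃ : E3 := !₂[1, -ρ, 0] with hp₃
  set p₄ : E3 := !₂[2, -ρ, 0] with hp₄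
  set p₅ : E3 := !₂[2, ρ, 0] with hp₅
  set p₆ : E3 := !₂[1 + ρ, ρ, 0] with hp₆
  have hloop := isSegmentUnion_loopSet r l ρ
  -- The remaining moves take place in the plane of the wedge, which the loop meets only in `p₂` and
  -- `p₆`. They remove the vertices `p₄`, `p₃`, `p₅` and `p₁` one after the other.
  have hloopz : ∀ x ∈ loopSet r l ρ, x 2 = 0 → x 1 = ρ ∧ (x 0 = 1 ∨ x 0 = 1 + ρ ∧ x = p₆) :=
    fun x hx hz => by
      rcases hl.loopSet_cases hρ hx with h | rfl | rfl
      · linarith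
      · simp
      · simp [hp₆]
  have s1 : AmbientIsotopic
      (inSphere (segment ℝ p₂ p₁ ∪ segment ℝ p₁ p₃ ∪ segment ℝ p₅ p₆ ∪ loopSet r l ρ ∪
        (segment ℝ p₃ p₄ ∪ segment ℝ p₄ p₅)))
      (inSphere (segment ℝ p₂ p₁ ∪ segment ℝ p₁ p₃ ∪ segment ℝ p₅ p₆ ∪ loopSet r l ρ ∪
        segment ℝ p₃ p₅)) := by
    refine ambientIsotopic_triangle_move ((((isSegmentUnion_segment _ _).union
      (isSegmentUnion_segment _ _)).union (isSegmentUnion_segment _ _)).union hloop)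
      (triangle_indep (by nlinarith)) ?_
    rintro x ⟨hT, h⟩
    obtain ⟨s, t, hs, ht, hst, e0, e1, e2⟩ := mem_triangle_coord hT
    have hleft : x 0 ≤ 1 → x = p₃ := fun h => by
      have h1 : s = 0 := by linarith
      have h2 : t = 0 := by linarith
      subst h1 h2
      apply E3_ext <;> simp [hp₃, e0, e1, e2]
    have htop : x 1 = ρ → x = p₅ := fun h => by
      have h1 : t = 1 := by nlinarith
      have h2 : s = 0 := by linarith
      subst h1 h2
      apply E3_ext <;> simp [hp₅, e0, e1, e2]
    rcases h with ((h | h) | h) | h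
    · obtain ⟨u, ⟨u0, u1⟩, f0, -, -⟩ := mem_segment_coord h
      exact Or.inl (hleft (by nlinarith))
    · obtain ⟨u, ⟨u0, u1⟩, f0, -, -⟩ := mem_segment_coord h
      exact Or.inl (hleft (by nlinarith))
    · obtain ⟨u, -, -, f1, -⟩ := mem_segment_coord h
      exact Or.inr (htop (by rw [f1]; ring))
    · exact Or.inr (htop (hloopz x h e2).1)
  have s2 : AmbientIsotopic
      (inSphere (segment ℝ p₂ p₁ ∪ segment ℝ p₅ p₆ ∪ loopSet r l ρ ∪
        (segment ℝ p₁ p₃ ∪ segment ℝ p₃ p₅)))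
      (inSphere (segment ℝ p₂ p₁ ∪ segment ℝ p₅ p₆ ∪ loopSet r l ρ ∪ segment ℝ p₁ p₅)) := by
    refine ambientIsotopic_triangle_move (((isSegmentUnion_segment _ _).union
      (isSegmentUnion_segment _ _)).union hloop) (triangle_indep (by nlinarith)) ?_
    rintro x ⟨hT, h⟩
    obtain ⟨s, t, hs, ht, hst, e0, e1, e2⟩ := mem_triangle_coord hT
    have htop : x 1 = ρ → x = p₅ := fun h => by
      have h1 : t = 1 := by nlinarith
      have h2 : s = 0 := by linarith
      subst h1 h2
      apply E3_ext <;> simp [hp₅, e0, e1, e2]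
    rcases h with (h | h) | h
    · obtain ⟨u, ⟨u0, u1⟩, f0, f1, -⟩ := mem_segment_coord h
      have h1 : u = 1 + s - t := by
        have : ρ * u = ρ * (1 + s - t) := by linarith
        exact mul_left_cancel₀ hρ.ne' this
      have h2 : t + 2 * (s * (1 - g)) = 0 := by
        rw [h1] at f0; linarith
      have h3 : 0 ≤ s * (1 - g) := mul_nonneg hs (by linarith)
      have h4 : t = 0 := by linarith
      have h5 : s = 0 := by
        have : s * (1 - g) = 0 := by linarith
        exact (mul_eq_zero.1 this).resolve_right (by linarith)
      subst h4 h5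
      left
      apply E3_ext <;> simp [hp₁, e0, e1, e2]
    · obtain ⟨u, -, -, f1, -⟩ := mem_segment_coord h
      exact Or.inr (htop (by rw [f1]; ring))
    · exact Or.inr (htop (hloopz x h e2).1)
  have s3 : AmbientIsotopic
      (inSphere (segment ℝ p₂ p₁ ∪ loopSet r l ρ ∪ (segment ℝ p₁ p₅ ∪ segment ℝ p₅ p₆)))
      (inSphere (segment ℝ p₂ p₁ ∪ loopSet r l ρ ∪ segment ℝ p₁ p₆)) := by
    refine ambientIsotopic_triangle_move ((isSegmentUnion_segment _ _).union hloop)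
      (triangle_indep (by nlinarith)) ?_
    rintro x ⟨hT, h⟩
    obtain ⟨s, t, hs, ht, hst, e0, e1, e2⟩ := mem_triangle_coord hT
    rcases h with h | h
    · obtain ⟨u, ⟨u0, u1⟩, f0, f1, -⟩ := mem_segment_coord h
      have h1 : u = 1 - s - t := by
        have : ρ * u = ρ * (1 - s - t) := by linarith
        exact mul_left_cancel₀ hρ.ne' this
      have h2 : s + ρ * t = 0 := by
        rw [h1] at f0; linarith
      have h3 : 0 ≤ ρ * t := mul_nonneg hρ.le ht
      have h4 : s = 0 := by linarith
      have h5 : t = 0 := by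
        have : ρ * t = 0 := by linarith
        exact (mul_eq_zero.1 this).resolve_left hρ.ne'
      subst h4 h5
      left
      apply E3_ext <;> simp [hp₁, e0, e1, e2]
    · obtain ⟨f1, f0 | ⟨-, f0⟩⟩ := hloopz x h e2
      · exfalso
        have h1 : s + t = 1 := by
          have : ρ * (s + t) = ρ * 1 := by linarith
          exact mul_left_cancel₀ hρ.ne' this
        have h2 : s = 1 - t := by linarith
        subst h2
        nlinarith
      · exact Or.inr f0
  have s4 : AmbientIsotopic
      (inSphere (loopSet r l ρ ∪ (segment ℝ p₂ p₁ ∪ segment ℝ p₁ p₆)))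
      (inSphere (loopSet r l ρ ∪ segment ℝ p₂ p₆)) := by
    refine ambientIsotopic_triangle_move hloop (triangle_indep (by nlinarith)) ?_
    rintro x ⟨hT, h⟩
    obtain ⟨s, t, hs, ht, hst, e0, e1, e2⟩ := mem_triangle_coord hT
    obtain ⟨f1, f0 | ⟨-, f0⟩⟩ := hloopz x h e2
    · left
      apply E3_ext <;> simp [hp₂, f0, f1, e2]
    · exact Or.inr f0
  have e1 : ∀ A B D E F G : Set E3, A ∪ B ∪ D ∪ E ∪ F ∪ G = A ∪ B ∪ E ∪ F ∪ (D ∪ G) := by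
    intros; ac_rfl
  have e2 : ∀ A B D E F : Set E3, A ∪ B ∪ D ∪ E ∪ F = A ∪ D ∪ E ∪ (B ∪ F) := by
    intros; ac_rfl
  have e3 : ∀ A D E F : Set E3, A ∪ D ∪ E ∪ F = A ∪ E ∪ (F ∪ D) := by
    intros; ac_rfl
  have e4 : ∀ A E F : Set E3, A ∪ E ∪ F = E ∪ (A ∪ F) := by
    intros; ac_rfl
  rw [coreSet, segment_symm ℝ p₅ p₄, e1]
  refine s1.trans ?_
  rw [e2]
  refine s2.trans ?_
  rw [e3]
  refine s3.trans ?_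
  rw [e4]
  exact s4

/-- The map reverses two coordinates, hence preserves orientation, so the loop closed by a segment
is `L` and not its mirror image. -/
theorem closedArc_flip (hl : BandArc r l) {ρ : ℝ} :
    loopSet r l ρ ∪ segment ℝ !₂[1, ρ, 0] !₂[1 + ρ, ρ, 0] =
      affMap (ρ • flipMat) (!₂[1, ρ, 0] + ρ • !₂[2 / 3, 0, 0]) '' closedArc r l := by
  have hf : ∀ x, affMap (ρ • flipMat) (!₂[1, ρ, 0] + ρ • !₂[2 / 3, 0, 0]) x =
      !₂[1, ρ, 0] + ρ • flip x := fun x => by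
    simp only [affMap, flip, Matrix.smul_mulVec, WithLp.toLp_smul]
    module
  rw [affMap_image_closedArc]
  simp only [hf, closedArc, arcSet, loopSet]
  congr 1
  rw [hl.first, hl.last, segment_symm]
  congr 1 <;> rw [flip_eq] <;> apply E3_ext <;> simp
  norm_num

/-- The links of the construction are isotopic to the given knot. -/
theorem exists_link (hk : BandArc m k) (hl : BandArc r l) :
    ∃ c : ℝ, 0 < c ∧ ∀ ρ g, 0 < ρ → ρ ≤ c → 0 < g → g ≤ c →
      AmbientIsotopic (inSphere (linkSet m r k l ρ g)) (inSphere (closedArc r l)) := by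
  obtain ⟨c, hc, hband⟩ := hk.exists_band_lower
  refine ⟨min (c / 2) (1 / 2), by positivity, fun ρ g hρ hρc hg hgc => ?_⟩
  have h1 : ρ ≤ c / 2 := hρc.trans (min_le_left _ _)
  have h2 : ρ ≤ 1 / 2 := hρc.trans (min_le_right _ _)
  have h3 : g ≤ 1 / 2 := hgc.trans (min_le_right _ _)
  refine (hk.ambientIsotopic_collapse hl hc hband hρ (by linarith) (by linarith) hg
    (by linarith)).trans ((hl.ambientIsotopic_core hρ (by linarith) (by linarith)).trans ?_)
  rw [hl.closedArc_flip]
  refine (ambientIsotopic_affMap ?_ _ _).symm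
  rw [Matrix.det_smul]
  have : flipMat.det = 1 / 3 := by
    rw [flipMat, Matrix.det_fin_three]; simp; norm_num
  rw [this]
  positivity

end BandArc

/-! ### The germs of the construction -/

theorem posRoot_one {N : ℕ} : posRoot N 1 = 1 := by simp [posRoot]

theorem posRoot_mono (N : ℕ) {x y : ℝ} (h : x ≤ y) : posRoot N x ≤ posRoot N y :=
  Real.rpow_le_rpow (le_max_right _ _) (max_le_max_right 0 h) (by positivity)

theorem posRoot_pow_self {N : ℕ} (hN : N ≠ 0) {x : ℝ} (hx : 0 ≤ x) : posRoot N (x ^ N) = x :=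
  (pow_left_inj₀ (posRoot_nonneg _ _) hx hN).1 (posRoot_pow hN (pow_nonneg hx N))

theorem posRoot_pos {N : ℕ} {x : ℝ} (hx : 0 < x) : 0 < posRoot N x := by
  rw [posRoot, max_eq_left hx.le]
  positivity

theorem tendsto_posRoot {N : ℕ} (hN : N ≠ 0) : Tendsto (posRoot N) (𝓝[>] 0) (𝓝 0) := by
  have h : Continuous (posRoot N) :=
    (continuous_id.max continuous_const).rpow_const fun x => Or.inr (by positivity)
  have := h.tendsto 0
  rw [posRoot_of_nonpos hN le_rfl] at this
  exact this.mono_left nhdsWithin_le_nhds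

theorem pow_sub_pow_le_mul {x y : ℝ} (hx : 0 ≤ x) (hxy : x ≤ y) (hy : y ≤ 1) (p : ℕ) :
    y ^ p - x ^ p ≤ p * (y - x) := by
  induction p with
  | zero => simp
  | succ p ih =>
    have h1 : x ^ p ≤ 1 := pow_le_one₀ hx (hxy.trans hy)
    have h2 : y * (y ^ p - x ^ p) ≤ 1 * (y ^ p - x ^ p) :=
      mul_le_mul_of_nonneg_right hy (sub_nonneg.2 (pow_le_pow_left₀ hx hxy p))
    have h3 : (y - x) * x ^ p ≤ (y - x) * 1 := mul_le_mul_of_nonneg_left h1 (sub_nonneg.2 hxy)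
    push_cast
    calc y ^ (p + 1) - x ^ (p + 1) = y * (y ^ p - x ^ p) + (y - x) * x ^ p := by ring
      _ ≤ _ := by linarith

/-- The powers of a root of `t` are Lipschitz when multiplied by `t`. -/
theorem mul_posRoot_pow_sub_le {N : ℕ} (hN : N ≠ 0) (p : ℕ) {t u : ℝ} (ht : 0 ≤ t) (htu : t ≤ u)
    (hu : u ≤ 1) : t * |posRoot N t ^ p - posRoot N u ^ p| ≤ p * (u - t) := by
  have e1 := posRoot_pow hN ht
  have e2 := posRoot_pow hN (ht.trans htu)
  have h0 := posRoot_nonneg N t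
  have h1 := posRoot_mono N htu
  have h2 := posRoot_mono N hu
  rw [posRoot_one] at h2
  set x := posRoot N t
  set y := posRoot N u
  obtain ⟨n, rfl⟩ := Nat.exists_eq_succ_of_ne_zero hN
  have h3 := pow_sub_pow_le_mul h0 h1 h2 p
  rw [abs_sub_comm, abs_of_nonneg (sub_nonneg.2 (pow_le_pow_left₀ h0 h1 p))]
  -- Since `t = x ^ N` and `x ≤ y ≤ 1`, the left side is at most `x ^ (N - 1) * (y - x)`, hence at
  -- most `y ^ N - x ^ N`.
  have h4 : t * (y - x) ≤ u - t := by
    rw [← e1, ← e2, pow_succ, pow_succ]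
    have h5 : x ^ n ≤ y ^ n := pow_le_pow_left₀ h0 h1 n
    have h6 : x ^ n * x * (y - x) ≤ x ^ n * 1 * (y - x) := by
      have : 0 ≤ y - x := sub_nonneg.2 h1
      gcongr
      exact h1.trans h2
    have h7 : x ^ n * y ≤ y ^ n * y := mul_le_mul_of_nonneg_right h5 (h0.trans h1)
    linarith
  calc t * (y ^ p - x ^ p) ≤ t * (p * (y - x)) := mul_le_mul_of_nonneg_left h3 ht
    _ = p * (t * (y - x)) := by ring
    _ ≤ _ := by gcongr

section PowerFamily

variable {J : Type*} [Finite J] {N p q : ℕ}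

/-- Uniform bounds for a family of segments whose endpoints are affine in two powers. -/
theorem exists_bound_powers (a : J → ℝ → E3) (B U V : J → E3)
    (ha : ∀ j τ, a j τ = B j + τ ^ p • U j + τ ^ q • V j) :
    ∃ D, 0 ≤ D ∧ ∀ j, (∀ τ, 0 ≤ τ → τ ≤ 1 → ‖a j τ‖ ≤ D) ∧
      ∀ σ τ, ‖a j σ - a j τ‖ ≤ D * (|σ ^ p - τ ^ p| + |σ ^ q - τ ^ q|) := by
  have := Fintype.ofFinite J
  have hb : ∀ j, ‖B j‖ + ‖U j‖ + ‖V j‖ ≤ ∑ j, (‖B j‖ + ‖U j‖ + ‖V j‖) := fun j =>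
    Finset.single_le_sum (f := fun j => ‖B j‖ + ‖U j‖ + ‖V j‖) (fun j _ => by positivity)
      (Finset.mem_univ j)
  refine ⟨∑ j, (‖B j‖ + ‖U j‖ + ‖V j‖), Finset.sum_nonneg fun j _ => by positivity, fun j =>
    ⟨fun τ h0 h1 => ?_, fun σ τ => ?_⟩⟩
  · rw [ha]
    refine (norm_add₃_le.trans ?_).trans (hb j)
    rw [norm_smul, norm_smul, Real.norm_of_nonneg (by positivity),
      Real.norm_of_nonneg (by positivity)]
    have h2 := mul_le_of_le_one_left (norm_nonneg (U j)) (pow_le_one₀ h0 h1 (n := p))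
    have h3 := mul_le_of_le_one_left (norm_nonneg (V j)) (pow_le_one₀ h0 h1 (n := q))
    linarith
  · have : a j σ - a j τ = (σ ^ p - τ ^ p) • U j + (σ ^ q - τ ^ q) • V j := by
      rw [ha, ha]; module
    rw [this]
    refine (norm_add_le _ _).trans ?_
    rw [norm_smul, norm_smul, Real.norm_eq_abs, Real.norm_eq_abs, mul_add]
    have h1 := norm_nonneg (B j)
    have h2 := norm_nonneg (U j)
    have h3 := norm_nonneg (V j)
    have := hb j
    rw [mul_comm, mul_comm (|σ ^ q - τ ^ q|)]
    gcongr <;> linarith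

/-- A segment with endpoints affine in two powers of the root inherits all estimates from these
powers. The last clause gives the rate of convergence to the section at `t = 0`. -/
theorem exists_famBound (hN : N ≠ 0) (hp : p ≠ 0) (hq : q ≠ 0) (a b : J → ℝ → E3)
    (B U V B' U' V' : J → E3)
    (ha : ∀ j τ, a j τ = B j + τ ^ p • U j + τ ^ q • V j)
    (hb : ∀ j τ, b j τ = B' j + τ ^ p • U' j + τ ^ q • V' j) :
    ∃ M, 0 ≤ M ∧ ∀ t₀ ≤ (1 : ℝ), FamBound t₀ M M (segFam N a b) ∧
      (∀ j t, 0 < t → t ≤ t₀ → ∀ s ∈ Icc (0 : ℝ) 1, ∀ s' ∈ Icc (0 : ℝ) 1,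
        ‖segFam N a b j t s - segFam N a b j t s'‖ ≤ M * |s - s'|) ∧
      ∀ j t, 0 < t → t ≤ t₀ → ∀ s ∈ Icc (0 : ℝ) 1,
        ‖segFam N a b j t s - segFam N a b j 0 s‖ ≤ M * posRoot N t := by
  obtain ⟨D₁, hD₁, h₁⟩ := exists_bound_powers a B U V ha
  obtain ⟨D₂, hD₂, h₂⟩ := exists_bound_powers b B' U' V' hb
  set D := D₁ + D₂
  have hD : 0 ≤ D := add_nonneg hD₁ hD₂
  have hroot : ∀ t : ℝ, t ≤ 1 → posRoot N t ≤ 1 := fun t ht => by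
    have := posRoot_mono N ht
    rwa [posRoot_one] at this
  have hdiff : ∀ j t u, ∀ s ∈ Icc (0 : ℝ) 1, ‖segFam N a b j t s - segFam N a b j u s‖ ≤
      D * (|posRoot N t ^ p - posRoot N u ^ p| + |posRoot N t ^ q - posRoot N u ^ q|) := by
    intro j t u s hs
    have e : segFam N a b j t s - segFam N a b j u s =
        (1 - s) • (a j (posRoot N t) - a j (posRoot N u)) +
          s • (b j (posRoot N t) - b j (posRoot N u)) := by
      simp only [segFam]; module
    rw [e]
    refine (norm_add_le _ _).trans ?_
    rw [norm_smul, norm_smul, Real.norm_of_nonneg (sub_nonneg.2 hs.2), Real.norm_of_nonneg hs.1]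
    have h3 := (h₁ j).2 (posRoot N t) (posRoot N u)
    have h4 := (h₂ j).2 (posRoot N t) (posRoot N u)
    have h5 := mul_le_of_le_one_left (norm_nonneg (a j (posRoot N t) - a j (posRoot N u)))
      (sub_le_self 1 hs.1)
    have h6 := mul_le_of_le_one_left (norm_nonneg (b j (posRoot N t) - b j (posRoot N u))) hs.2
    simp only [D]
    linarith
  have hab : ∀ j t, t ≤ 1 → ‖b j (posRoot N t) - a j (posRoot N t)‖ ≤ D := fun j t ht => by
    have h3 := (h₁ j).1 _ (posRoot_nonneg N t) (hroot t ht)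
    have h4 := (h₂ j).1 _ (posRoot_nonneg N t) (hroot t ht)
    have := norm_sub_le (b j (posRoot N t)) (a j (posRoot N t))
    simp only [D]
    linarith
  refine ⟨D * (p + q + 2), by positivity, fun t₀ ht₀ => ⟨⟨fun j t h0 ht s hs => ?_,
    fun j t u h0 htu hu s hs => ?_⟩, fun j t h0 ht s hs s' hs' => ?_, fun j t h0 ht s hs => ?_⟩⟩
  · have h3 := (h₁ j).1 _ (posRoot_nonneg N t) (hroot t (ht.trans ht₀))
    have h4 : ‖s • (b j (posRoot N t) - a j (posRoot N t))‖ ≤ D := by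
      rw [norm_smul, Real.norm_of_nonneg hs.1]
      exact (mul_le_of_le_one_left (norm_nonneg _) hs.2).trans (hab j t (ht.trans ht₀))
    have h5 := norm_add_le (a j (posRoot N t)) (s • (b j (posRoot N t) - a j (posRoot N t)))
    have h6 : 0 ≤ D * (p + q) := by positivity
    simp only [segFam]
    linarith
  · have h3 := mul_posRoot_pow_sub_le hN p h0.le htu (hu.trans ht₀)
    have h4 := mul_posRoot_pow_sub_le hN q h0.le htu (hu.trans ht₀)
    calc t * ‖segFam N a b j t s - segFam N a b j u s‖
        ≤ t * (D * (|posRoot N t ^ p - posRoot N u ^ p| +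
          |posRoot N t ^ q - posRoot N u ^ q|)) :=
          mul_le_mul_of_nonneg_left (hdiff j t u s hs) h0.le
      _ = D * (t * |posRoot N t ^ p - posRoot N u ^ p| +
          t * |posRoot N t ^ q - posRoot N u ^ q|) := by ring
      _ ≤ D * (p * (u - t) + q * (u - t)) := by gcongr
      _ ≤ D * (p + q + 2) * (u - t) := by
        have : 0 ≤ D * (u - t) := mul_nonneg hD (sub_nonneg.2 htu)
        linarith
  · have e : segFam N a b j t s - segFam N a b j t s' =
        (s - s') • (b j (posRoot N t) - a j (posRoot N t)) := by
      simp only [segFam]; module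
    rw [e, norm_smul, Real.norm_eq_abs, mul_comm]
    refine mul_le_mul_of_nonneg_right ((hab j t (ht.trans ht₀)).trans ?_) (abs_nonneg _)
    have h6 : 0 ≤ D * (p + q + 1) := by positivity
    linarith
  · refine (hdiff j t 0 s hs).trans ?_
    have h0' := posRoot_nonneg N t
    have h1' := hroot t (ht.trans ht₀)
    rw [posRoot_of_nonpos hN le_rfl, zero_pow hp, zero_pow hq, sub_zero, sub_zero,
      abs_of_nonneg (pow_nonneg h0' p), abs_of_nonneg (pow_nonneg h0' q), mul_assoc]
    refine mul_le_mul_of_nonneg_left ?_ hD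
    have h3 := pow_le_of_le_one h0' h1' hp
    have h4 := pow_le_of_le_one h0' h1' hq
    have h5 : 0 ≤ ((p : ℝ) + q) * posRoot N t := by positivity
    linarith

end PowerFamily

/-- The parametrizations of the segments of the construction, in terms of the norm. -/
def germFam (N p q m r : ℕ) (k l : ℕ → E3) : Piece m r → ℝ → ℝ → E3 :=
  segFam N (fun j τ => pieceStart k l (τ ^ p) j) (fun j τ => pieceEnd k l (τ ^ p) (τ ^ q) j)

theorem famSet_germFam (N p q m r : ℕ) (k l : ℕ → E3) (t : ℝ) :
    famSet (germFam N p q m r k l) t =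
      linkSet m r k l (posRoot N t ^ p) (posRoot N t ^ q) := by
  simp only [famSet, linkSet, segment_eq_image']
  rfl

/-- The germ of the construction. -/
def germ (N p q : ℕ) (t₀ : ℝ) (m r : ℕ) (k l : ℕ → E3) : Set E4 :=
  coneOver t₀ (famSet (germFam N p q m r k l))

theorem exists_pieceStart (m r : ℕ) (k l : ℕ → E3) :
    ∃ B U : Piece m r → E3, ∀ ρ j, pieceStart k l ρ j = B j + ρ • U j := by
  refine ⟨pieceStart k l 0, fun j => pieceStart k l 1 j - pieceStart k l 0 j, fun ρ j => ?_⟩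
  rcases j with j | ⟨i, σ⟩ | i
  · fin_cases j <;> apply E3_ext <;> simp [pieceStart]
  · simp only [pieceStart]
    module
  · apply E3_ext <;> simp [pieceStart]
    ring

theorem exists_pieceEnd (m r : ℕ) (k l : ℕ → E3) :
    ∃ B U V : Piece m r → E3, ∀ ρ g j, pieceEnd k l ρ g j = B j + ρ • U j + g • V j := by
  refine ⟨pieceEnd k l 0 0, fun j => pieceEnd k l 1 0 j - pieceEnd k l 0 0 j,
    fun j => pieceEnd k l 0 1 j - pieceEnd k l 0 0 j, fun ρ g j => ?_⟩
  rcases j with j | ⟨i, σ⟩ | i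
  · fin_cases j <;> apply E3_ext <;> simp [pieceEnd]
  · simp only [pieceEnd]
    module
  · apply E3_ext <;> simp [pieceEnd]
    ring

theorem isSemialgebraic_matching_germFam {N : ℕ} (hN : N ≠ 0) (p q m r : ℕ) (k l k' l' : ℕ → E3)
    {t₀ : ℝ} (ht₀ : 0 ≤ t₀) :
    IsSemialgebraic {z : EuclideanSpace ℝ (Fin 4 ⊕ Fin 4) |
      (WithLp.toLp 2 fun i => z (Sum.inl i), WithLp.toLp 2 fun i => z (Sum.inr i)) ∈
        matching t₀ (germFam N p q m r k l) (germFam N p q m r k' l')} := by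
  have hS : ∀ k l : ℕ → E3, ∀ (j : Piece m r) c,
      IsPoly fun z : EuclideanSpace ℝ (Option (Fin 4 ⊕ Fin 4)) =>
        pieceStart k l (z none ^ p) j c := fun k l j c => by
    obtain ⟨B, U, h⟩ := exists_pieceStart m r k l
    simp only [h, PiLp.add_apply, PiLp.smul_apply, smul_eq_mul]
    fun_prop
  have hE : ∀ k l : ℕ → E3, ∀ (j : Piece m r) c,
      IsPoly fun z : EuclideanSpace ℝ (Option (Fin 4 ⊕ Fin 4)) =>
        pieceEnd k l (z none ^ p) (z none ^ q) j c := fun k l j c => by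
    obtain ⟨B, U, V, h⟩ := exists_pieceEnd m r k l
    simp only [h, PiLp.add_apply, PiLp.smul_apply, smul_eq_mul]
    fun_prop
  exact isSemialgebraic_matching hN ht₀ (hS k l) (hE k l) (hS k' l') (hE k' l')

theorem exists_famBound_germFam {N p q : ℕ} (hN : N ≠ 0) (hp : p ≠ 0) (hq : q ≠ 0) (m r : ℕ)
    (k l : ℕ → E3) :
    ∃ M, 0 ≤ M ∧ ∀ t₀ ≤ (1 : ℝ), FamBound t₀ M M (germFam N p q m r k l) ∧
      (∀ j t, 0 < t → t ≤ t₀ → ∀ s ∈ Icc (0 : ℝ) 1, ∀ s' ∈ Icc (0 : ℝ) 1,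
        ‖germFam N p q m r k l j t s - germFam N p q m r k l j t s'‖ ≤ M * |s - s'|) ∧
      ∀ j t, 0 < t → t ≤ t₀ → ∀ s ∈ Icc (0 : ℝ) 1,
        ‖germFam N p q m r k l j t s - germFam N p q m r k l j 0 s‖ ≤ M * posRoot N t := by
  obtain ⟨B, U, h⟩ := exists_pieceStart m r k l
  obtain ⟨B', U', V', h'⟩ := exists_pieceEnd m r k l
  exact exists_famBound hN hp hq _ _ B U (fun _ => 0) B' U' V' (fun j τ => by simp [h])
    fun j τ => h' _ _ j

theorem isSurfaceGerm_germ {N p q : ℕ} (hN : N ≠ 0) (hp : p ≠ 0) (hq : q ≠ 0) {t₀ : ℝ}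
    (ht₀ : 0 < t₀) (ht₁ : t₀ ≤ 1) (m r : ℕ) (k l : ℕ → E3) :
    IsSurfaceGerm (germ N p q t₀ m r k l) := by
  obtain ⟨M, hM, h⟩ := exists_famBound_germFam hN hp hq m r k l
  refine ⟨isSemialgebraic_coneOver (isSemialgebraic_matching_germFam hN p q m r k l k l ht₀.le),
    Or.inl rfl, fun ε hε => le_antisymm ?_ ?_⟩
  · exact (dimH_mono inter_subset_left).trans
      (dimH_coneOver_le ht₀.le hM (h t₀ ht₁).1 (h t₀ ht₁).2.1)
  · refine le_dimH_coneOver ht₀ hε fun t _ _ x hx => ?_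
    -- The segment from `(1, -ρ, 0)` to `(2, -ρ, 0)` realizes all abscissas between `1` and `2`,
    -- whatever the value of `ρ`.
    refine ⟨_, mem_iUnion.2 ⟨.inl 4, x - 1, ⟨by linarith [hx.1], by linarith [hx.2]⟩, rfl⟩, ?_⟩
    simp [germFam, segFam, pieceStart, pieceEnd]
    ring

/-- At width zero the two sides of the band coincide, the loop shrinks to a point and the V's become
parts of the closing segment. This limit is the section of the tangent cone. -/
theorem linkSet_zero {m r : ℕ} {k l : ℕ → E3} (hk : BandArc m k) :
    linkSet m r k l 0 0 = closedArc m k := by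
  have hm := hk.two_le
  have hseg : ∀ x y : ℝ, -1 ≤ x → x ≤ 2 → -1 ≤ y → y ≤ 2 →
      segment ℝ (!₂[x, 0, 0] : E3) !₂[y, 0, 0] ⊆ segment ℝ (k m) (k 0) := by
    intro x y hx hx' hy hy'
    have : ∀ x : ℝ, -1 ≤ x → x ≤ 2 → (!₂[x, 0, 0] : E3) ∈ segment ℝ (k m) (k 0) := by
      intro x h1 h2
      rw [segment_eq_image', hk.first, hk.last]
      refine ⟨(x + 1) / 3, ⟨by linarith, by linarith⟩, ?_⟩
      apply E3_ext <;> simp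
      ring
    exact (convex_segment _ _).segment_subset (this x hx hx') (this y hy hy')
  have hsub : ∀ x y z : ℝ, x ≤ y → y ≤ z → segment ℝ (!₂[x, 0, 0] : E3) !₂[z, 0, 0] ⊆
      segment ℝ !₂[x, 0, 0] !₂[y, 0, 0] ∪ segment ℝ !₂[y, 0, 0] !₂[z, 0, 0] := by
    intro x y z h1 h2 v hv
    have hy : (!₂[y, 0, 0] : E3) ∈ segment ℝ (!₂[x, 0, 0] : E3) !₂[z, 0, 0] := by
      rcases h1.eq_or_lt with rfl | h1
      · exact left_mem_segment _ _ _
      rw [segment_eq_image']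
      have h3 : 0 < z - x := by linarith
      refine ⟨(y - x) / (z - x), ⟨div_nonneg (by linarith) h3.le,
        (div_le_one h3).2 (by linarith)⟩, ?_⟩
      apply E3_ext <;> simp
      field_simp
      ring
    refine (mem_segment_split hy hv).imp (fun h => ?_) id
    rwa [segment_symm]
  refine Subset.antisymm (iUnion_subset ?_) (union_subset ?_ ?_)
  · rintro (j | ⟨i, σ⟩ | i)
    · refine Subset.trans ?_ subset_union_right
      fin_cases j <;> simp [pieceStart, pieceEnd] <;> apply hseg <;> norm_num
    · refine Subset.trans ?_ subset_union_left
      simp only [pieceStart, pieceEnd, mul_zero, zero_smul, add_zero]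
      exact subset_iUnion (fun i : Fin m => segment ℝ (k i) (k (i + 1))) i
    · refine Subset.trans ?_ subset_union_right
      simp only [pieceStart, pieceEnd, zero_smul, add_zero]
      apply hseg <;> norm_num
  · refine iUnion_subset fun i => ?_
    refine Subset.trans ?_ (subset_iUnion _ (.inr (.inl (i, true))))
    simp only [pieceStart, pieceEnd, mul_zero, zero_smul, add_zero]
    exact Subset.rfl
  · rw [hk.first, hk.last]
    refine (hsub (-1) 0 2 (by norm_num) (by norm_num)).trans (union_subset ?_
      ((hsub 0 1 2 (by norm_num) (by norm_num)).trans (union_subset ?_ ?_)))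
    · refine Subset.trans ?_ (subset_iUnion _ (.inl 0))
      simp [pieceStart, pieceEnd]
    · refine Subset.trans ?_ (subset_iUnion _ (.inl 2))
      rw [segment_symm]
      simp [pieceStart, pieceEnd]
    · refine Subset.trans ?_ (subset_iUnion _ (.inl 4))
      simp [pieceStart, pieceEnd]

theorem tangentLink_germ {N p q : ℕ} (hN : N ≠ 0) (hp : p ≠ 0) (hq : q ≠ 0) {t₀ : ℝ}
    (ht₀ : 0 < t₀) (ht₁ : t₀ ≤ 1) {m r : ℕ} {k l : ℕ → E3} (hk : BandArc m k) {ε : ℝ}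
    (hε : 0 < ε) :
    sphereSection (tangentCone (germ N p q t₀ m r k l)) ε = inSphere (closedArc m k) := by
  obtain ⟨M, hM, h⟩ := exists_famBound_germFam hN hp hq m r k l
  obtain ⟨h1, -, h3⟩ := h t₀ ht₁
  have h0 : famSet (germFam N p q m r k l) 0 = closedArc m k := by
    rw [famSet_germFam, posRoot_of_nonpos hN le_rfl, zero_pow hp, zero_pow hq, linkSet_zero hk]
  have hlim : Tendsto (fun t => M * posRoot N t) (𝓝[>] 0) (𝓝 0) := by
    simpa using (tendsto_posRoot hN).const_mul M
  have hsmall : ∀ᶠ t in 𝓝[>] (0 : ℝ), 0 < t ∧ t ≤ t₀ :=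
    mem_of_superset (Ioc_mem_nhdsGT ht₀) fun t ht => ht
  refine sphereSection_tangentCone (R := M) ht₀ ?_ ?_ ?_ ?_ hε
  · exact ((isSegmentUnion_arcSet m k).union (isSegmentUnion_segment _ _)).isCompact.isClosed
  · intro t ht0 ht y hy
    obtain ⟨j, s, hs, rfl⟩ := mem_iUnion.1 hy
    exact h1.norm_le j t ht0 ht s hs
  · intro e he
    filter_upwards [hsmall, hlim.eventually (gt_mem_nhds he)] with t ht hte y hy
    obtain ⟨j, s, hs, rfl⟩ := mem_iUnion.1 hy
    refine ⟨germFam N p q m r k l j 0 s, ?_, (h3 j t ht.1 ht.2 s hs).trans hte.le⟩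
    rw [← h0]
    exact mem_iUnion.2 ⟨j, s, hs, rfl⟩
  · intro x hx
    rw [← h0] at hx
    obtain ⟨j, s, hs, rfl⟩ := mem_iUnion.1 hx
    refine ⟨fun t => germFam N p q m r k l j t s, fun t _ _ => mem_iUnion.2 ⟨j, s, hs, rfl⟩, ?_⟩
    rw [tendsto_iff_norm_sub_tendsto_zero]
    refine squeeze_zero' (Eventually.of_forall fun t => norm_nonneg _) ?_ hlim
    filter_upwards [hsmall] with t ht using h3 j t ht.1 ht.2 s hs

theorem outerBiLipschitzEquiv_germ {N p q : ℕ} (hN : N ≠ 0) (hp : p ≠ 0) (hq : q ≠ 0) {m r : ℕ}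
    {k l k' l' : ℕ → E3} (hk : BandArc m k) (hk' : BandArc m k') (hl : BandArc r l)
    (hl' : BandArc r l') :
    ∃ c, 0 < c ∧ ∀ t₀, 0 < t₀ → t₀ ≤ c →
      OuterBiLipschitzEquiv (germ N p q t₀ m r k l) (germ N p q t₀ m r k' l') := by
  obtain ⟨M, hM, h⟩ := exists_famBound_germFam hN hp hq m r k l
  obtain ⟨M', hM', h'⟩ := exists_famBound_germFam hN hp hq m r k' l'
  obtain ⟨D, c, hD, hc, hcmp⟩ := exists_piece_compare hk hk' hl hl'
  obtain ⟨D', c', hD', hc', hcmp'⟩ := exists_piece_compare hk' hk hl' hl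
  set e := min 1 (min c c')
  have he : 0 < e := by positivity
  have hmono : ∀ {t₀ A B : ℝ} {S : Piece m r → ℝ → ℝ → E3}, t₀ ≤ 1 → A ≤ B → FamBound t₀ A A S →
      FamBound t₀ B B S := fun _ hAB h =>
    ⟨fun j t h0 ht s hs => (h.norm_le j t h0 ht s hs).trans hAB, fun j t u h0 htu hu s hs =>
      (h.variation j t u h0 htu hu s hs).trans
        (mul_le_mul_of_nonneg_right hAB (sub_nonneg.2 htu))⟩
  -- For `t ≤ e ^ N` the root of `t` is at most `e ≤ 1`, so its positive powers, among them the
  -- width `ρ`, are in the range of the comparison.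
  refine ⟨e ^ N, by positivity, fun t₀ h0 ht => ?_⟩
  have ht₁ : t₀ ≤ 1 := ht.trans (pow_le_one₀ he.le (min_le_left _ _))
  have hroot : ∀ t, t ≤ t₀ → posRoot N t ≤ e := fun t h => by
    have := posRoot_mono N (h.trans ht)
    rwa [posRoot_pow_self hN he.le] at this
  have hpow : ∀ t, 0 < t → t ≤ t₀ → 0 < posRoot N t ^ p ∧ posRoot N t ^ p ≤ c ∧
      posRoot N t ^ p ≤ c' ∧ 0 ≤ posRoot N t ^ q ∧ posRoot N t ^ q ≤ 1 := fun t h0 ht => by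
    have h1 := posRoot_pos (N := N) h0
    have h2 := hroot t ht
    have h3 : posRoot N t ≤ 1 := h2.trans (min_le_left _ _)
    have h4 := pow_le_of_le_one h1.le h3 hp
    exact ⟨by positivity, h4.trans (h2.trans ((min_le_right _ _).trans (min_le_left _ _))),
      h4.trans (h2.trans ((min_le_right _ _).trans (min_le_right _ _))), by positivity,
      pow_le_one₀ h1.le h3⟩
  refine outerBiLipschitzEquiv_coneOver (R := max (max M M') (max D D'))
    (M := max (max M M') (max D D')) (le_max_of_le_left (le_max_of_le_left hM))
    (hmono ht₁ ((le_max_left _ _).trans (le_max_left _ _)) (h t₀ ht₁).1)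
    (hmono ht₁ ((le_max_right _ _).trans (le_max_left _ _)) (h' t₀ ht₁).1) ?_ ?_
    (isSemialgebraic_matching_germFam hN p q m r k l k' l' h0.le)
  · intro i j t ht0 htt s hs s' hs'
    obtain ⟨a1, a2, a3, a4, a5⟩ := hpow t ht0 htt
    exact (hcmp _ _ a1 a2 a4 a5 i j s hs s' hs').trans
      (mul_le_mul_of_nonneg_right ((le_max_left _ _).trans (le_max_right _ _)) (norm_nonneg _))
  · intro i j t ht0 htt s hs s' hs'
    obtain ⟨a1, a2, a3, a4, a5⟩ := hpow t ht0 htt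
    exact (hcmp' _ _ a1 a3 a4 a5 i j s hs s' hs').trans
      (mul_le_mul_of_nonneg_right ((le_max_right _ _).trans (le_max_right _ _)) (norm_nonneg _))

theorem coneOver_inter_closedBall {t₀ t₁ : ℝ} (h1 : 0 ≤ t₁) (h : t₁ ≤ t₀) (C : ℝ → Set E3) :
    coneOver t₀ C ∩ closedBall 0 t₁ = coneOver t₁ C := by
  ext p
  rw [mem_inter_iff, mem_closedBall_zero_iff]
  constructor
  · rintro ⟨rfl | ⟨a, b, c⟩, h2⟩
    · exact Or.inl rfl
    · exact Or.inr ⟨a, h2, c⟩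
  · rintro (rfl | ⟨a, b, c⟩)
    · exact ⟨Or.inl rfl, by simpa using h1⟩
    · exact ⟨Or.inr ⟨a, b.trans h, c⟩, b⟩

/-- Equivalence of germs may be tested after intersecting with balls. -/
theorem OuterBiLipschitzEquiv.of_inter_closedBall {X Y : Set E4} {t : ℝ} (ht : 0 < t)
    (h : OuterBiLipschitzEquiv (X ∩ closedBall 0 t) (Y ∩ closedBall 0 t)) :
    OuterBiLipschitzEquiv X Y := by
  obtain ⟨U, hU, V, hV, H, h1, h2, h3, h4⟩ := h
  rw [inter_assoc] at h1 h3 h4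
  rw [inter_assoc] at h1
  exact ⟨closedBall 0 t ∩ U, inter_mem (closedBall_mem_nhds _ ht) hU, closedBall 0 t ∩ V,
    inter_mem (closedBall_mem_nhds _ ht) hV, H, h1, h2, h3, h4⟩

/-! ### Subdivision of arcs -/

/-- The vertices of an arc with the midpoint of the first edge inserted. -/
def subdiv (k : ℕ → E3) : ℕ → E3
  | 0 => k 0
  | 1 => k 0 + (1 / 2 : ℝ) • (k 1 - k 0)
  | i + 2 => k (i + 1)

theorem segment_midpoint (x y : E3) :
    segment ℝ x (x + (1 / 2 : ℝ) • (y - x)) ∪ segment ℝ (x + (1 / 2 : ℝ) • (y - x)) y =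
      segment ℝ x y := by
  have hm : x + (1 / 2 : ℝ) • (y - x) ∈ segment ℝ x y := by
    rw [segment_eq_image']
    exact ⟨1 / 2, by norm_num, rfl⟩
  refine Subset.antisymm (union_subset ?_ ?_) fun z hz => ?_
  · exact (convex_segment _ _).segment_subset (left_mem_segment _ _ _) hm
  · exact (convex_segment _ _).segment_subset hm (right_mem_segment _ _ _)
  · exact (mem_segment_split hm hz).imp (fun h => by rwa [segment_symm]) id

/-- At the inserted vertex the two edges are parallel and point in the same direction. The cone
condition permits this, because it concerns only nonnegative coefficients of the edges. -/
theorem BandArc.subdiv {m : ℕ} {k : ℕ → E3} (hk : BandArc m k) :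
    BandArc (m + 1) (KnottedGerm.subdiv k) := by
  have hm := hk.two_le
  have hseg : ∀ i, 0 < i → segment ℝ (KnottedGerm.subdiv k i) (KnottedGerm.subdiv k (i + 1)) ⊆
      segment ℝ (k (i - 1)) (k (i - 1 + 1)) := by
    intro i hi
    obtain ⟨i, rfl⟩ := Nat.exists_eq_succ_of_ne_zero hi.ne'
    rcases i with _ | i
    · exact subset_union_right.trans (segment_midpoint _ _).subset
    · exact Subset.rfl
  refine ⟨by omega, hk.first, ?_, ?_, ?_, ?_⟩
  · obtain ⟨n, rfl⟩ := Nat.exists_eq_succ_of_ne_zero (n := m) (by omega)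
    exact hk.last
  · intro i hi him
    rcases i with _ | _ | i
    · omega
    · have := hk.pos 1 one_pos (by omega)
      simp [KnottedGerm.subdiv, hk.first]
      linarith
    · exact hk.pos (i + 1) (by omega) (by omega)
  · intro i hi a b w ha hb h
    rcases i with _ | _ | i
    · have := hk.edge_indep (i := 0) (by omega) (a := (a + b) / 2) (w := w) (by
        rw [cyc_of_le k (by omega), cyc_of_le k (by omega), ← h]
        simp only [KnottedGerm.subdiv]
        module)
      exact ⟨by linarith, by linarith, this.2⟩
    · have := hk.cone 0 (by omega) (a / 2) b w (by linarith) hb (by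
        rw [← h]
        simp only [KnottedGerm.subdiv]
        module)
      exact ⟨by linarith, this.2.1, this.2.2⟩
    · exact hk.cone (i + 1) (by omega) a b w ha hb h
  · intro i j hij hj
    rcases i with _ | i
    · obtain ⟨j, rfl⟩ : ∃ j', j = j' + 2 := ⟨j - 2, by omega⟩
      rcases j with _ | j
      · rw [Set.disjoint_left]
        intro x hx hx'
        rw [segment_eq_image'] at hx hx'
        obtain ⟨s, hs, rfl⟩ := hx
        obtain ⟨t, ht, h⟩ := hx'
        have := hk.cone 0 (by omega) (1 - s / 2) t 0 (by linarith [hs.2]) ht.1 (by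
          simp only [KnottedGerm.subdiv] at h
          rw [← sub_eq_zero.2 h]
          module)
        linarith [hs.2]
      · exact (hk.disj 0 (j + 2) (by omega) (by omega)).mono
          (subset_union_left.trans (segment_midpoint _ _).subset) Subset.rfl
    · have h1 := hseg (i + 1) (by omega)
      have h2 := hseg j (by omega)
      exact (hk.disj (i + 1 - 1) (j - 1) (by omega) (by omega)).mono h1 h2

theorem iUnion_fin_succ' {n : ℕ} (f : ℕ → Set E3) :
    ⋃ i : Fin (n + 1), f i = f 0 ∪ ⋃ i : Fin n, f (i + 1) := by
  ext x
  simp only [mem_iUnion, mem_union, Fin.exists_fin_succ, Fin.val_zero, Fin.val_succ]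

theorem iUnion_subdiv {m : ℕ} (hm : m ≠ 0) (k : ℕ → E3) (f : E3 → E3)
    (hf : ∀ x y, f (x + (1 / 2 : ℝ) • (y - x)) = f x + (1 / 2 : ℝ) • (f y - f x)) :
    ⋃ i : Fin (m + 1), segment ℝ (f (subdiv k i)) (f (subdiv k (i + 1))) =
      ⋃ i : Fin m, segment ℝ (f (k i)) (f (k (i + 1))) := by
  obtain ⟨n, rfl⟩ := Nat.exists_eq_succ_of_ne_zero hm
  rw [iUnion_fin_succ' fun i => segment ℝ (f (subdiv k i)) (f (subdiv k (i + 1))),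
    iUnion_fin_succ' fun i => segment ℝ (f (subdiv k (i + 1))) (f (subdiv k (i + 1 + 1))),
    iUnion_fin_succ' fun i => segment ℝ (f (k i)) (f (k (i + 1))), ← union_assoc]
  congr 1
  simp only [subdiv, zero_add, hf]
  exact segment_midpoint _ _

theorem linkSet_eq_iUnion (m r : ℕ) (k l : ℕ → E3) (ρ g : ℝ) :
    linkSet m r k l ρ g =
      (⋃ j : Fin 6, segment ℝ (pieceStart (m := m) (r := r) k l ρ (.inl j))
        (pieceEnd (m := m) (r := r) k l ρ g (.inl j))) ∪
      ((⋃ σ : Bool, ⋃ i : Fin m, segment ℝ (k i + (side σ * ρ) • bandDir)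
        (k (i + 1) + (side σ * ρ) • bandDir)) ∪ loopSet r l ρ) := by
  ext x
  simp only [linkSet, loopSet, mem_iUnion, mem_union, Sum.exists, Prod.exists, pieceStart, pieceEnd]
  rw [exists_comm (α := Fin m)]

theorem linkSet_subdiv_left {m : ℕ} (hm : m ≠ 0) (r : ℕ) (k l : ℕ → E3) (ρ g : ℝ) :
    linkSet (m + 1) r (subdiv k) l ρ g = linkSet m r k l ρ g := by
  rw [linkSet_eq_iUnion, linkSet_eq_iUnion]
  have : ∀ σ, ⋃ i : Fin (m + 1), segment ℝ (subdiv k i + (side σ * ρ) • bandDir)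
      (subdiv k (i + 1) + (side σ * ρ) • bandDir) = ⋃ i : Fin m,
      segment ℝ (k i + (side σ * ρ) • bandDir) (k (i + 1) + (side σ * ρ) • bandDir) := fun σ =>
    iUnion_subdiv hm k (fun x => x + (side σ * ρ) • bandDir) fun x y => by module
  simp only [this]
  rfl

/-- Only the loop depends on `l`, through a map that preserves midpoints. -/
theorem linkSet_subdiv_right {r : ℕ} (hr : r ≠ 0) (m : ℕ) (k l : ℕ → E3) (ρ g : ℝ) :
    linkSet m (r + 1) k (subdiv l) ρ g = linkSet m r k l ρ g := by
  rw [linkSet_eq_iUnion, linkSet_eq_iUnion]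
  have : loopSet (r + 1) (subdiv l) ρ = loopSet r l ρ :=
    iUnion_subdiv hr l (fun x => !₂[1, ρ, 0] + ρ • flip x) fun x y => by
      simp only [flip_eq]
      apply E3_ext <;> simp <;> ring
  rw [this]
  rfl

theorem exists_subdiv_left {m : ℕ} {k : ℕ → E3} (hk : BandArc m k) (r n : ℕ) (l : ℕ → E3) :
    ∃ k', BandArc (m + n) k' ∧ linkSet (m + n) r k' l = linkSet m r k l := by
  induction n with
  | zero => exact ⟨k, hk, rfl⟩
  | succ n ih =>
    obtain ⟨k', hk', h⟩ := ih
    refine ⟨subdiv k', hk'.subdiv, ?_⟩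
    rw [← h]
    ext1 ρ
    ext1 g
    exact linkSet_subdiv_left (m := m + n) (by have := hk'.two_le; omega) r k' l ρ g

theorem exists_subdiv_right {r : ℕ} {l : ℕ → E3} (hl : BandArc r l) (m n : ℕ) (k : ℕ → E3) :
    ∃ l', BandArc (r + n) l' ∧ linkSet m (r + n) k l' = linkSet m r k l := by
  induction n with
  | zero => exact ⟨l, hl, rfl⟩
  | succ n ih =>
    obtain ⟨l', hl', h⟩ := ih
    refine ⟨subdiv l', hl'.subdiv, ?_⟩
    rw [← h]
    ext1 ρ
    ext1 g
    exact linkSet_subdiv_right (r := r + n) (by have := hl'.two_le; omega) m k l' ρ g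

/-- The germ depends only on the polygons as sets, not on their vertices, so subdividing does not
change it. -/
theorem germ_congr {N p q : ℕ} {t₀ : ℝ} {m r m' r' : ℕ} {k l k' l' : ℕ → E3}
    (h : linkSet m r k l = linkSet m' r' k' l') :
    germ N p q t₀ m r k l = germ N p q t₀ m' r' k' l' := by
  have : famSet (germFam N p q m r k l) = famSet (germFam N p q m' r' k' l') := by
    ext1 t
    rw [famSet_germFam, famSet_germFam, h]
  rw [germ, germ, this]

/-- Any two germs of the construction are equivalent. -/
theorem outerBiLipschitzEquiv_germ_general {N p q : ℕ} (hN : N ≠ 0) (hp : p ≠ 0) (hq : q ≠ 0)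
    {m r m' r' : ℕ} {k l k' l' : ℕ → E3} (hk : BandArc m k) (hk' : BandArc m' k')
    (hl : BandArc r l) (hl' : BandArc r' l') {t₀ t₁ : ℝ} (ht₀ : 0 < t₀) (ht₁ : 0 < t₁) :
    OuterBiLipschitzEquiv (germ N p q t₀ m r k l) (germ N p q t₁ m' r' k' l') := by
  obtain ⟨k₁, hk₁, e₁⟩ := exists_subdiv_left hk r m' l
  obtain ⟨l₁, hl₁, f₁⟩ := exists_subdiv_right hl (m + m') r' k₁
  obtain ⟨k₂, hk₂, e₂⟩ := exists_subdiv_left hk' r' m l'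
  obtain ⟨l₂, hl₂, f₂⟩ := exists_subdiv_right hl' (m' + m) r k₂
  rw [germ_congr (e₁.symm.trans f₁.symm), germ_congr (e₂.symm.trans f₂.symm)]
  rw [Nat.add_comm m' m] at hk₂ f₂ ⊢
  rw [Nat.add_comm r' r] at hl₂ ⊢
  obtain ⟨c, hc, h⟩ := outerBiLipschitzEquiv_germ hN hp hq hk₁ hk₂ hl₁ hl₂
  have hs : 0 < min c (min t₀ t₁) := by positivity
  refine OuterBiLipschitzEquiv.of_inter_closedBall hs ?_
  -- The two germs may be cut off at different radii; inside a small ball both are cones with the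
  -- same cutoff.
  rw [germ, germ, coneOver_inter_closedBall hs.le ((min_le_right _ _).trans (min_le_left _ _)),
    coneOver_inter_closedBall hs.le ((min_le_right _ _).trans (min_le_right _ _))]
  exact h _ hs (min_le_left _ _)

/-! ### The wedge -/

/-- The embedding of the box around the standard wedge. -/
def wedgeMap (x : E3) : E4 := lift (x 2) ((x 2)⁻¹ • !₂[x 1, x 0, 0])

/-- The map sends `x` to the point at distance `x 2` from the origin on the ray through `(x 1, x 0,
0, x 2)`. Heights thus become radii, and the two horizontal axes are exchanged because the thin
direction of the box is the second axis of the chart. -/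
theorem smul_wedgeMap {x : E3} (hx : 0 < x 2) :
    ‖x‖ • wedgeMap x = x 2 • (!₂[x 1, x 0, 0, x 2] : E4) := by
  set p : E4 := !₂[x 1, x 0, 0, x 2] with hp
  have h1 : chart p = (x 2)⁻¹ • !₂[x 1, x 0, 0] := by
    apply E3_ext <;> simp [chart, hp] <;> ring
  have h2 : ‖p‖ = ‖x‖ := by
    rw [← pow_left_inj₀ (norm_nonneg _) (norm_nonneg _) two_ne_zero, norm_E3_sq,
      EuclideanSpace.norm_sq_eq, Fin.sum_univ_four]
    simp [hp]
    ring
  have h3 := smul_hemi_chart (p := p) (by simpa [hp] using hx)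
  rw [h1, h2] at h3
  rw [wedgeMap, lift, smul_comm, h3]

/-- The map `wedgeMap` is bi-Lipschitz on a box. -/
theorem isBiLipschitzOn_wedgeMap {B : Set E3}
    (hB : ∀ x ∈ B, 0 ≤ x 2 ∧ |x 0| ≤ x 2 ∧ |x 1| ≤ x 2) : IsBiLipschitzOn wedgeMap B := by
  set v : E3 → E3 := fun x => !₂[x 1, x 0, 0] with hv
  set w : E3 → E3 := fun x => (x 2)⁻¹ • v x with hw
  have hvw : ∀ x ∈ B, v x = x 2 • w x := fun x hx => by
    rcases (hB x hx).1.eq_or_lt with h0 | h0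
    · obtain ⟨-, h1, h2⟩ := hB x hx
      rw [← h0] at h1 h2
      have h1 := abs_nonpos_iff.1 h1
      have h2 := abs_nonpos_iff.1 h2
      rw [← h0, zero_smul]
      apply E3_ext <;> simp [hv, h1, h2]
    · rw [hw, smul_smul, mul_inv_cancel₀ h0.ne', one_smul]
  have hw2 : ∀ x ∈ B, ‖w x‖ ≤ 2 := fun x hx => by
    obtain ⟨h0, h1, h2⟩ := hB x hx
    have hn : ‖v x‖ ≤ 2 * x 2 := by
      refine abs_le_of_sq_le_sq' ?_ (by positivity) |>.2
      have h3 := sq_le_sq' (by linarith [neg_abs_le (x 0)]) ((le_abs_self _).trans h1)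
      have h4 := sq_le_sq' (by linarith [neg_abs_le (x 1)]) ((le_abs_self _).trans h2)
      rw [norm_E3_sq]
      simp [hv]
      nlinarith
    rcases h0.eq_or_lt with h0' | h0'
    · simp [hw, ← h0']
    · rw [hw, norm_smul, norm_inv, Real.norm_of_nonneg h0, inv_mul_le_iff₀ h0']
      linarith
  have key : ∀ x ∈ B, ∀ y ∈ B, x 2 ≤ y 2 →
      ‖wedgeMap x - wedgeMap y‖ ≤ 23 * ‖x - y‖ ∧ ‖x - y‖ ≤ 23 * ‖wedgeMap x - wedgeMap y‖ := by
    intro x hx y hy hxy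
    have h0 := (hB x hx).1
    have h0' := (hB y hy).1
    have b1 := norm_lift_sub_le (u := y 2) h0 (w x) (w y)
    have b2 := le_norm_lift_sub h0 h0' (hw2 x hx) (hw2 y hy)
    have b3 : y 2 - x 2 ≤ ‖wedgeMap x - wedgeMap y‖ := by
      have := norm_sub_norm_le (wedgeMap y) (wedgeMap x)
      rwa [wedgeMap, wedgeMap, norm_lift h0, norm_lift h0', norm_sub_rev] at this
    rw [abs_sub_comm, abs_of_nonneg (sub_nonneg.2 hxy)] at b1
    have e1 : v x - v y = x 2 • (w x - w y) - (y 2 - x 2) • w y := by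
      rw [hvw x hx, hvw y hy]; module
    have e2 : x 2 • (w x - w y) = (v x - v y) + (y 2 - x 2) • w y := by
      rw [e1]; module
    have n1 : ‖(y 2 - x 2) • w y‖ ≤ 2 * (y 2 - x 2) := by
      rw [norm_smul, Real.norm_of_nonneg (sub_nonneg.2 hxy), mul_comm]
      exact mul_le_mul_of_nonneg_right (hw2 y hy) (sub_nonneg.2 hxy)
    have n2 : ‖x 2 • (w x - w y)‖ = x 2 * ‖w x - w y‖ := by
      rw [norm_smul, Real.norm_of_nonneg h0]
    have b4 : ‖v x - v y‖ ≤ x 2 * ‖w x - w y‖ + 2 * (y 2 - x 2) := by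
      rw [e1, ← n2]; exact (norm_sub_le _ _).trans (add_le_add_right n1 _)
    have b5 : x 2 * ‖w x - w y‖ ≤ ‖v x - v y‖ + 2 * (y 2 - x 2) := by
      rw [← n2, e2]; exact (norm_add_le _ _).trans (add_le_add_right n1 _)
    have hsq : ‖x - y‖ ^ 2 = ‖v x - v y‖ ^ 2 + (y 2 - x 2) ^ 2 := by
      rw [norm_E3_sq, norm_E3_sq]; simp [hv]; ring
    have b6 : ‖v x - v y‖ ≤ ‖x - y‖ :=
      abs_le_of_sq_le_sq' (by nlinarith [sq_nonneg (y 2 - x 2)]) (norm_nonneg _) |>.2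
    have b7 : y 2 - x 2 ≤ ‖x - y‖ :=
      abs_le_of_sq_le_sq' (by nlinarith [sq_nonneg ‖v x - v y‖]) (norm_nonneg _) |>.2
    have b8 : ‖x - y‖ ≤ ‖v x - v y‖ + (y 2 - x 2) := by
      have h1 := sub_nonneg.2 hxy
      refine abs_le_of_sq_le_sq' ?_ (by positivity) |>.2
      nlinarith [mul_nonneg (norm_nonneg (v x - v y)) h1]
    have c1 : wedgeMap x = lift (x 2) (w x) := rfl
    have c2 : wedgeMap y = lift (y 2) (w y) := rfl
    rw [← c1, ← c2] at b1 b2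
    constructor <;> linarith [norm_nonneg (x - y), norm_nonneg (wedgeMap x - wedgeMap y)]
  -- With `R = 2` the lifting estimate contributes `4 * (1 + 2 ^ 2) = 20`, and the difference of
  -- heights contributes `3`.
  refine ⟨23, by norm_num, fun x hx y hy => ?_⟩
  rw [inv_mul_le_iff₀ (by norm_num), dist_eq_norm, dist_eq_norm]
  rcases le_total (x 2) (y 2) with h | h
  · exact (key x hx y hy h).symm
  · have := key y hy x hx h
    rw [norm_sub_rev x, norm_sub_rev (wedgeMap x)]
    exact this.symm

/-- The graph becomes polynomial once `‖x‖` is allowed as an extra variable. At height `0` the map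
takes the value `0`, which has to be treated separately. -/
theorem wedgeMap_eq_iff {x : E3} (h0 : 0 ≤ x 2) (u : E4) :
    wedgeMap x = u ↔ (x 2 = 0 ∧ ∀ c, u c = 0) ∨
      (0 < x 2 ∧ ‖x‖ * u 0 = x 2 * x 1 ∧ ‖x‖ * u 1 = x 2 * x 0 ∧ ‖x‖ * u 2 = 0 ∧
        ‖x‖ * u 3 = x 2 * x 2) := by
  rcases h0.eq_or_lt with h | h
  · have : wedgeMap x = 0 := by rw [wedgeMap, ← h, lift, zero_smul]
    rw [this, ← h]
    simp only [true_and, lt_irrefl, false_and, or_false]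
    constructor
    · rintro rfl c; rfl
    · intro h; ext c; exact (h c).symm
  · have hx : ‖x‖ ≠ 0 := by
      rw [norm_ne_zero_iff]
      rintro rfl
      simp at h
    have h1 : wedgeMap x = u ↔ ‖x‖ • u = x 2 • (!₂[x 1, x 0, 0, x 2] : E4) := by
      rw [← smul_wedgeMap h]
      exact ⟨fun h => by rw [h], fun h => (smul_right_injective _ hx h).symm⟩
    rw [h1]
    simp only [h.ne', false_and, false_or, h, true_and]
    constructor
    · intro h
      refine ⟨?_, ?_, ?_, ?_⟩
      · simpa using congrArg (fun v : E4 => v 0) h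
      · simpa using congrArg (fun v : E4 => v 1) h
      · simpa [hx] using congrArg (fun v : E4 => v 2) h
      · simpa using congrArg (fun v : E4 => v 3) h
    · rintro ⟨h0, h1, h2, h3⟩
      ext c
      fin_cases c
      · simpa using h0
      · simpa using h1
      · simpa using h2
      · simpa using h3

/-- Real powers with rational exponents in terms of roots. -/
theorem rpow_eq_root {N p : ℕ} {α : ℚ} (hN : N ≠ 0) (hα : (α : ℝ) = 1 + p / N) {t : ℝ}
    (ht : 0 ≤ t) : t ^ (α : ℝ) = t * posRoot N t ^ p := by
  have hN' : (0 : ℝ) < N := by positivity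
  rw [hα, Real.rpow_add_of_nonneg ht zero_le_one (by positivity), Real.rpow_one, posRoot,
    max_eq_left ht, ← Real.rpow_natCast, ← Real.rpow_mul ht, div_eq_inv_mul]

/-- Raising to the even power `2 * N` removes both the absolute value and the rational exponent. -/
theorem abs_le_rpow_iff {N p : ℕ} {α : ℚ} (hN : N ≠ 0) (hα : (α : ℝ) = 1 + p / N) {t x : ℝ}
    (ht : 0 ≤ t) : |x| ≤ t ^ (α : ℝ) ↔ x ^ (2 * N) ≤ t ^ (2 * (N + p)) := by
  have h0 : 0 ≤ t * posRoot N t ^ p := mul_nonneg ht (pow_nonneg (posRoot_nonneg N t) p)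
  have h1 : (t * posRoot N t ^ p) ^ N = t ^ (N + p) := by
    rw [mul_pow, ← pow_mul, mul_comm p, pow_mul, posRoot_pow hN ht, pow_add]
  rw [rpow_eq_root hN hα ht, ← pow_le_pow_iff_left₀ (abs_nonneg _) h0
    (mul_ne_zero two_ne_zero hN), Even.pow_abs (even_two_mul N), mul_comm 2 N,
    pow_mul (t * _), h1, ← pow_mul, mul_comm (N + p), mul_comm N]

theorem isSemialgebraicMapOn_wedgeMap {N p : ℕ} {α : ℚ} (hN : N ≠ 0)
    (hα : (α : ℝ) = 1 + p / N) (δ : ℝ) : IsSemialgebraicMapOn wedgeMap (wedgeBox α δ) := by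
  have hg : IsPoly fun z : EuclideanSpace ℝ (Fin 3 ⊕ Fin 4) => ∑ i, z (.inl i) ^ 2 :=
    IsPoly.sum _ fun i => by fun_prop
  have hS : IsSemialgebraic {z : EuclideanSpace ℝ (Option (Fin 3 ⊕ Fin 4)) |
      (0 ≤ z (some (.inl 2)) ∧ z (some (.inl 2)) ≤ δ ∧
        z (some (.inl 0)) ^ (2 * N) ≤ z (some (.inl 2)) ^ (2 * (N + p)) ∧
        z (some (.inl 1)) ^ 2 ≤ z (some (.inl 2)) ^ 2) ∧
      ((z (some (.inl 2)) = 0 ∧ ∀ c : Fin 4, z (some (.inr c)) = 0) ∨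
        (0 < z (some (.inl 2)) ∧
          z none * z (some (.inr 0)) = z (some (.inl 2)) * z (some (.inl 1)) ∧
          z none * z (some (.inr 1)) = z (some (.inl 2)) * z (some (.inl 0)) ∧
          z none * z (some (.inr 2)) = 0 ∧
          z none * z (some (.inr 3)) = z (some (.inl 2)) * z (some (.inl 2))))} := by
    refine .and (.and (.le ?_ ?_) (.and (.le ?_ ?_) (.and (.le ?_ ?_) (.le ?_ ?_))))
      (.or (.and (.eq ?_ ?_) (.forall_finite fun c => .eq ?_ ?_))
        (.and (.lt ?_ ?_) (.and (.eq ?_ ?_) (.and (.eq ?_ ?_) (.and (.eq ?_ ?_) (.eq ?_ ?_))))))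
    all_goals fun_prop
  unfold IsSemialgebraicMapOn
  convert hS.root (N := 2) two_ne_zero hg using 1
  ext z
  set x : E3 := WithLp.toLp 2 fun i => z (Sum.inl i) with hx
  set u : E4 := WithLp.toLp 2 fun i => z (Sum.inr i) with hu
  have hxi : ∀ i, z (.inl i) = x i := fun i => rfl
  have hui : ∀ i, z (.inr i) = u i := fun i => rfl
  have hxn : ∑ i, x i ^ 2 = ‖x‖ ^ 2 := by rw [EuclideanSpace.norm_sq_eq]; simp
  simp only [mem_ofPred_eq, optExt_some, optExt_none, hxi, hui, hxn, posRoot_two_norm_sq,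
    graphOver, wedgeBox]
  constructor
  · rintro ⟨⟨h0, h1, h2, h3⟩, h4⟩
    refine ⟨⟨h0, h1, (abs_le_rpow_iff hN hα h0).1 h2, ?_⟩, (wedgeMap_eq_iff h0 u).1 h4⟩
    exact sq_le_sq.2 (by rwa [abs_of_nonneg h0])
  · rintro ⟨⟨h0, h1, h2, h3⟩, h4⟩
    refine ⟨⟨h0, h1, (abs_le_rpow_iff hN hα h0).2 h2, ?_⟩, (wedgeMap_eq_iff h0 u).2 h4⟩
    exact abs_le_of_sq_le_sq h3 h0

/-- The points of the links of the construction in the rectangle of the wedge. -/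
theorem exists_wedge_of_mem_linkSet {m r : ℕ} {k l : ℕ → E3} (hk : BandArc m k)
    (hl : BandArc r l) :
    ∃ c : ℝ, 0 < c ∧ ∀ ρ g, 0 < ρ → ρ ≤ c → ∀ x y : ℝ, |x| ≤ 1 → |y| ≤ ρ →
      (!₂[x, y, 0] ∈ linkSet m r k l ρ g ↔ ∃ σ ∈ ({1, -1} : Set ℝ), ∃ τ ∈ ({1, -1} : Set ℝ),
        ∃ s ∈ Icc (0 : ℝ) 1, x = τ + s * (τ * g - τ) ∧ y = σ * ρ + s * (0 - σ * ρ)) := by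
  obtain ⟨c, hc, hband⟩ := hk.exists_band_lower
  refine ⟨c / 2, by positivity, fun ρ g hρ hρc x y hx hy => ⟨fun h => ?_, ?_⟩⟩
  · rw [linkSet_eq] at h
    have one : (1 : ℝ) ∈ ({1, -1} : Set ℝ) := by simp
    have neg : (-1 : ℝ) ∈ ({1, -1} : Set ℝ) := by simp
    obtain ⟨hx0, hx1⟩ := abs_le.1 hx
    rcases h with (((((h | h) | h) | h) | h) | h) | h | h
    · obtain ⟨s, hs, e0, e1, -⟩ := mem_segment_coord h
      simp only [Matrix.cons_val] at e0 e1
      exact ⟨1, one, 1, one, s, hs, by linarith, by linarith⟩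
    · rw [segment_symm] at h
      obtain ⟨s, hs, e0, e1, -⟩ := mem_segment_coord h
      simp only [Matrix.cons_val] at e0 e1
      exact ⟨-1, neg, 1, one, s, hs, by linarith, by linarith⟩
    · obtain ⟨s, hs, e0, e1, -⟩ := mem_segment_coord h
      simp only [Matrix.cons_val] at e0 e1
      have := hs.1
      exact ⟨-1, neg, 1, one, 0, by simp, by linarith, by linarith⟩
    · obtain ⟨s, hs, e0, e1, -⟩ := mem_segment_coord h
      simp only [Matrix.cons_val] at e0 e1
      obtain ⟨h0, h1⟩ := hs
      have hs1 : s = 1 := by nlinarith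
      subst hs1
      linarith
    · rcases hl.loopSet_cases hρ h with h | h | h
      · simp at h
      · have e0 := congrArg (fun v : E3 => v 0) h
        have e1 := congrArg (fun v : E3 => v 1) h
        simp at e0 e1
        exact ⟨1, one, 1, one, 0, by simp, by linarith, by linarith⟩
      -- The second end of the loop has abscissa `1 + ρ > 1`, outside the rectangle.
      · have e0 := congrArg (fun v : E3 => v 0) h
        simp at e0
        linarith
    -- The rectangle is part of the band over the closing edge, and it meets the sides over the arc
    -- only at the left corners.
    · rw [show (!₂[x, y, 0] : E3) = bandPt m k m ((x + 1) / 3) y by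
        rw [hk.bandPt_closing]; congr 2; ring, bandPt] at h
      obtain ⟨h1, h2⟩ := BandArc.eq_of_mem_sidesSet hc hband hρ (by linarith) le_rfl
        ⟨by linarith, by linarith⟩ hy (fun _ => by linarith) h
      rcases (abs_eq hρ.le).1 h2 with h3 | h3
      · exact ⟨1, one, -1, neg, 0, by simp, by linarith, by linarith⟩
      · exact ⟨-1, neg, -1, neg, 0, by simp, by linarith, by linarith⟩
    · obtain ⟨s, hs, e0, e1, -⟩ := mem_segment_coord h
      simp only [Matrix.cons_val] at e0 e1
      exact ⟨1, one, -1, neg, s, hs, by linarith, by linarith⟩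
    · rw [segment_symm] at h
      obtain ⟨s, hs, e0, e1, -⟩ := mem_segment_coord h
      simp only [Matrix.cons_val] at e0 e1
      exact ⟨-1, neg, -1, neg, s, hs, by linarith, by linarith⟩
  · have hpiece : ∀ j : Fin 6, ∀ a b c d : ℝ,
        pieceStart (m := m) (r := r) k l ρ (.inl j) = !₂[a, b, 0] →
        pieceEnd (m := m) (r := r) k l ρ g (.inl j) = !₂[c, d, 0] → ∀ s ∈ Icc (0 : ℝ) 1,
        x = a + s * (c - a) → y = b + s * (d - b) → !₂[x, y, 0] ∈ linkSet m r k l ρ g := by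
      intro j a b c d h1 h2 s hs hx hy
      refine mem_iUnion.2 ⟨.inl j, ?_⟩
      rw [h1, h2, segment_eq_image']
      refine ⟨s, hs, ?_⟩
      apply E3_ext <;> simp [hx, hy]
    rintro ⟨σ, rfl | rfl, τ, rfl | rfl, s, hs, e0, e1⟩
    · exact hpiece 2 1 ρ g 0 rfl rfl s hs (by linarith) (by linarith)
    · exact hpiece 0 (-1) ρ (-g) 0 rfl rfl s hs (by linarith) (by linarith)
    · exact hpiece 3 1 (-ρ) g 0 rfl rfl s hs (by linarith) (by linarith)
    · exact hpiece 1 (-1) (-ρ) (-g) 0 rfl rfl s hs (by linarith) (by linarith)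

theorem containsWedge_germ {N p q : ℕ} (hN : N ≠ 0) (hp : p ≠ 0) {α β : ℚ}
    (hα : (α : ℝ) = 1 + p / N) (hβ : (β : ℝ) = 1 + q / N) {m r : ℕ} {k l : ℕ → E3}
    (hk : BandArc m k) (hl : BandArc r l) {t₀ : ℝ} (ht₀ : 0 < t₀) (ht₁ : t₀ ≤ 1) :
    ContainsWedge α β (germ N p q t₀ m r k l) := by
  obtain ⟨c, hc, hw⟩ := exists_wedge_of_mem_linkSet hk hl
  set e := min c 1
  have he : 0 < e := by positivity
  -- Below this height the root of the height is at most `e`, so the width is in the range of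
  -- `exists_wedge_of_mem_linkSet` and the box has `|x| ≤ z`.
  set δ := min t₀ (e ^ N)
  have hδ : 0 < δ := by positivity
  have hδ₀ : δ ≤ t₀ := min_le_left _ _
  have hroot : ∀ t, t ≤ δ → posRoot N t ≤ e := fun t h => by
    have := posRoot_mono N (h.trans (min_le_right _ _))
    rwa [posRoot_pow_self hN he.le] at this
  have hroot1 : ∀ t, t ≤ δ → posRoot N t ≤ 1 := fun t h => (hroot t h).trans (min_le_right _ _)
  have hα0 : (0 : ℝ) ^ (α : ℝ) = 0 := by rw [rpow_eq_root hN hα le_rfl, zero_mul]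
  have hβ0 : (0 : ℝ) ^ (β : ℝ) = 0 := by rw [rpow_eq_root hN hβ le_rfl, zero_mul]
  have hbox : ∀ x ∈ wedgeBox α δ, 0 ≤ x 2 ∧ |x 0| ≤ x 2 ∧ |x 1| ≤ x 2 := by
    rintro x ⟨h0, h1, h2, h3⟩
    refine ⟨h0, h2.trans ?_, h3⟩
    rw [rpow_eq_root hN hα h0]
    exact mul_le_of_le_one_right h0 (pow_le_one₀ (posRoot_nonneg _ _) (hroot1 _ h1))
  have hsub : wedge α β δ ⊆ wedgeBox α δ := by
    rintro x ⟨h0, h1, σ, hσ, τ, hτ, h⟩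
    rw [rpow_eq_root hN hα h0, rpow_eq_root hN hβ h0, segment_eq_image'] at h
    obtain ⟨s, ⟨hs0, hs1⟩, h⟩ := h
    obtain ⟨e0, e1⟩ := Prod.ext_iff.1 h
    simp at e0 e1
    refine ⟨h0, h1, ?_, ?_⟩
    · rw [rpow_eq_root hN hα h0, ← e0]
      have h4 : 0 ≤ x 2 * posRoot N (x 2) ^ p :=
        mul_nonneg h0 (pow_nonneg (posRoot_nonneg _ _) p)
      rw [abs_le]
      rcases hσ with rfl | rfl <;> constructor <;> nlinarith
    · rw [← e1]
      have h4 : 0 ≤ x 2 * posRoot N (x 2) ^ q :=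
        mul_nonneg h0 (pow_nonneg (posRoot_nonneg _ _) q)
      have h5 : x 2 * posRoot N (x 2) ^ q ≤ x 2 :=
        mul_le_of_le_one_right h0 (pow_le_one₀ (posRoot_nonneg _ _) (hroot1 _ h1))
      rw [abs_le]
      rcases hτ with rfl | rfl <;> constructor <;> nlinarith
  have hmem : ∀ x ∈ wedgeBox α δ, (wedgeMap x ∈ germ N p q t₀ m r k l ↔ x ∈ wedge α β δ) := by
    intro x hx
    have hx' := hx
    obtain ⟨h0, h1, h2, h3⟩ := hx
    rcases h0.eq_or_lt with h | h
    · obtain ⟨-, h4, h5⟩ := hbox x hx'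
      rw [← h] at h4 h5
      have h4 := abs_nonpos_iff.1 h4
      have h5 := abs_nonpos_iff.1 h5
      refine iff_of_true (Or.inl ?_) ⟨h0, h1, 1, by simp, 1, by simp, ?_⟩
      · rw [wedgeMap, ← h, lift, zero_smul]
      · rw [← h, h4, h5, hα0, hβ0, segment_eq_image']
        exact ⟨0, by simp, by simp⟩
    · have hρ : 0 < posRoot N (x 2) ^ p := pow_pos (posRoot_pos h) p
      have hρc : posRoot N (x 2) ^ p ≤ c :=
        (pow_le_of_le_one (posRoot_nonneg _ _) (hroot1 _ h1) hp).trans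
          ((hroot _ h1).trans (min_le_left _ _))
      have ev : (x 2)⁻¹ • (!₂[x 1, x 0, 0] : E3) = !₂[x 1 / x 2, x 0 / x 2, 0] := by
        apply E3_ext <;> simp <;> ring
      -- The image of `x` has norm `x 2`, so the relevant polygon is the one at parameter `t = x 2`.
      -- Dividing by this height turns `t ^ α` and `t ^ β` into the width `ρ` and the half-gap `g`.
      have hgm : wedgeMap x ∈ germ N p q t₀ m r k l ↔
          !₂[x 1 / x 2, x 0 / x 2, 0] ∈ linkSet m r k l (posRoot N (x 2) ^ p)
            (posRoot N (x 2) ^ q) := by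
        rw [← famSet_germFam, ← ev]
        have hne : wedgeMap x ≠ 0 := by
          rw [← norm_ne_zero_iff, wedgeMap, norm_lift h0]; exact h.ne'
        change (_ = _ ∨ _) ↔ _
        rw [or_iff_right hne, wedgeMap, norm_lift h0, chart_lift h.ne']
        exact ⟨fun h => h.2.2, fun h' => ⟨lift_pos h _, h1.trans hδ₀, h'⟩⟩
      rw [rpow_eq_root hN hα h0] at h2
      rw [hgm, hw _ _ hρ hρc]
      · simp only [wedge, mem_ofPred_eq, h0, h1, true_and]
        refine exists_congr fun σ => and_congr_right fun _ => exists_congr fun τ =>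
          and_congr_right fun _ => ?_
        rw [rpow_eq_root hN hα h0, rpow_eq_root hN hβ h0, segment_eq_image', mem_image]
        refine exists_congr fun s => and_congr_right fun _ => ?_
        rw [Prod.ext_iff, div_eq_iff h.ne', div_eq_iff h.ne']
        simp only [Prod.fst_add, Prod.snd_add, Prod.smul_fst, Prod.smul_snd, Prod.fst_sub,
          Prod.snd_sub, smul_eq_mul]
        constructor
        · rintro ⟨e0, e1⟩
          constructor
          · rw [e1]; ring
          · rw [e0]; ring
        · rintro ⟨e0, e1⟩
          constructor
          · rw [← e1]; ring
          · rw [← e0]; ring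
      · rw [abs_div, abs_of_pos h, div_le_one h]; exact h3
      · rw [abs_div, abs_of_pos h, div_le_iff₀ h, mul_comm]; exact h2
  refine ⟨δ, hδ, hδ₀.trans ht₁, wedgeMap, ?_, isBiLipschitzOn_wedgeMap hbox,
    isSemialgebraicMapOn_wedgeMap hN hα δ, ?_⟩
  · simp [wedgeMap, lift]
  · ext u
    constructor
    · rintro ⟨x, hx, rfl⟩
      exact ⟨(hmem x (hsub hx)).2 hx, x, hsub hx, rfl⟩
    · rintro ⟨h, x, hx, rfl⟩
      exact ⟨x, (hmem x hx).1 h, rfl⟩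

theorem exists_link_germ {N p q : ℕ} (hN : N ≠ 0) (hp : p ≠ 0) (hq : q ≠ 0) {m r : ℕ}
    {k l : ℕ → E3} (hk : BandArc m k) (hl : BandArc r l) :
    ∃ t₀ : ℝ, 0 < t₀ ∧ t₀ ≤ 1 ∧ ∀ ε, 0 < ε → ε ≤ t₀ →
      AmbientIsotopic (sphereSection (germ N p q t₀ m r k l) ε) (inSphere (closedArc r l)) := by
  obtain ⟨c, hc, h⟩ := hk.exists_link hl
  set e := min c 1
  have he : 0 < e := by positivity
  refine ⟨e ^ N, by positivity, pow_le_one₀ he.le (min_le_right _ _), fun ε h0 h1 => ?_⟩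
  have h2 : posRoot N ε ≤ e := by
    have := posRoot_mono N h1
    rwa [posRoot_pow_self hN he.le] at this
  have h3 := posRoot_pos (N := N) h0
  have h4 : posRoot N ε ≤ 1 := h2.trans (min_le_right _ _)
  have h5 : posRoot N ε ≤ c := h2.trans (min_le_left _ _)
  rw [germ, sphereSection_coneOver _ h0 h1, famSet_germFam]
  exact h _ _ (pow_pos h3 p) ((pow_le_of_le_one h3.le h4 hp).trans h5) (pow_pos h3 q)
    ((pow_le_of_le_one h3.le h4 hq).trans h5)

/-- Two rational numbers greater than one, written with a common denominator. -/
theorem exists_common_denominator {α β : ℚ} (hα : 1 < α) (hβ : 1 < β) :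
    ∃ N p q : ℕ, N ≠ 0 ∧ p ≠ 0 ∧ q ≠ 0 ∧ (α : ℝ) = 1 + p / N ∧ (β : ℝ) = 1 + q / N := by
  have key : ∀ γ : ℚ, 1 < γ → ∃ a : ℕ, a ≠ 0 ∧ γ = 1 + a / γ.den := fun γ hγ => by
    have hd : (0 : ℚ) < γ.den := by exact_mod_cast γ.den_pos
    have hnum : (γ.den : ℤ) < γ.num := by
      have : (γ.den : ℚ) < γ.num := by
        rw [← Rat.mul_den_eq_num]
        nlinarith
      exact_mod_cast this
    refine ⟨(γ.num - γ.den).toNat, by omega, ?_⟩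
    have h1 : (((γ.num - γ.den).toNat : ℤ) : ℚ) = γ.num - γ.den := by
      rw [Int.toNat_of_nonneg (by omega)]
      push_cast
      ring
    rw [Int.cast_natCast] at h1
    rw [h1, ← Rat.mul_den_eq_num]
    field_simp
    ring
  obtain ⟨a, ha, hαa⟩ := key α hα
  obtain ⟨b, hb, hβb⟩ := key β hβ
  have h1 : (α.den : ℝ) ≠ 0 := by exact_mod_cast α.den_ne_zero
  have h2 : (β.den : ℝ) ≠ 0 := by exact_mod_cast β.den_ne_zero
  refine ⟨α.den * β.den, a * β.den, b * α.den, mul_ne_zero α.den_ne_zero β.den_ne_zero,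
    mul_ne_zero ha β.den_ne_zero, mul_ne_zero hb α.den_ne_zero, ?_, ?_⟩
  · have h := congrArg (fun x : ℚ => (x : ℝ)) hαa
    simp only [Rat.cast_add, Rat.cast_one, Rat.cast_div, Rat.cast_natCast] at h
    rw [h]
    push_cast
    field_simp
  · have h := congrArg (fun x : ℚ => (x : ℝ)) hβb
    simp only [Rat.cast_add, Rat.cast_one, Rat.cast_div, Rat.cast_natCast] at h
    rw [h]
    push_cast
    field_simp

end KnottedGerm
end

/-! ### Assembly of the theorem -/

theorem theorem3p10 (α β : ℚ) (hα : 1 ≤ α) (hαβ : α ≤ β) :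
    ∃ X : KnottedGerm.Knot → KnottedGerm.Knot → Set KnottedGerm.E4,
      (∀ K L : KnottedGerm.Knot,
        KnottedGerm.IsSurfaceGerm (X K L) ∧
        KnottedGerm.LinkIsotopicTo (X K L) L ∧
        KnottedGerm.TangentLinkIsotopicTo (X K L) K ∧
        (1 < α → KnottedGerm.ContainsWedge α β (X K L))) ∧
      (∀ K L K' L' : KnottedGerm.Knot,
        KnottedGerm.OuterBiLipschitzEquiv (X K L) (X K' L')) := by
  obtain ⟨N, p, q, hN, hp, hq, hwedge⟩ : ∃ N p q : ℕ, N ≠ 0 ∧ p ≠ 0 ∧ q ≠ 0 ∧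
      (1 < α → (α : ℝ) = 1 + p / N ∧ (β : ℝ) = 1 + q / N) := by
    rcases hα.eq_or_lt with h | h
    -- For `α = 1` the width must still tend to `0` in the chart, so positive exponents are chosen,
    -- unrelated to `α` and `β`.
    · exact ⟨1, 1, 1, one_ne_zero, one_ne_zero, one_ne_zero, fun h' => absurd h h'.ne⟩
    · obtain ⟨N, p, q, hN, hp, hq, h1⟩ := KnottedGerm.exists_common_denominator h (h.trans_le hαβ)
      exact ⟨N, p, q, hN, hp, hq, fun _ => h1⟩
  -- The same arc serves for a knot in both roles, as tangent link and as link; only the cutoff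
  -- radius depends on the pair.
  choose m k hk hiso using fun K : KnottedGerm.Knot => KnottedGerm.exists_bandArc K.2
  choose t ht₀ ht₁ hlink using fun K L : KnottedGerm.Knot =>
    KnottedGerm.exists_link_germ hN hp hq (hk K) (hk L)
  refine ⟨fun K L => KnottedGerm.germ N p q (t K L) (m K) (m L) (k K) (k L), fun K L =>
    ⟨KnottedGerm.isSurfaceGerm_germ hN hp hq (ht₀ K L) (ht₁ K L) _ _ _ _, ?_, ?_, fun h => ?_⟩,
    fun K L K' L' => KnottedGerm.outerBiLipschitzEquiv_germ_general hN hp hq (hk K) (hk K') (hk L)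
      (hk L') (ht₀ K L) (ht₀ K' L')⟩
  · filter_upwards [Ioc_mem_nhdsGT (ht₀ K L)] with ε hε
    exact (hlink K L ε hε.1 hε.2).trans (hiso L)
  · filter_upwards [self_mem_nhdsWithin] with ε hε
    rw [KnottedGerm.tangentLink_germ hN hp hq (ht₀ K L) (ht₁ K L) (hk K) hε]
    exact hiso K
  · obtain ⟨h1, h2⟩ := hwedge h
    exact KnottedGerm.containsWedge_germ hN hp h1 h2 (hk K) (hk L) (ht₀ K L) (ht₁ K L)
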